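/- **Setting.** Let $N$ be a real vector space carrying a finite reduced crystallographic root system $\Sigma$ (roots are linear forms on $N$, $\alpha^\vee\in N$ are the coroots), with simple roots $\Delta$, positive roots $\Sigma^+$ and Weyl group $W_0$; finite lengths and longest elements are taken with respect to $\Delta$. Let $W_{\mathrm{aff}}$ be the group generated by the affine reflections $x\mapsto x-(\alpha(x)-k)\alpha^\vee$ ($\alpha\in\Sigma$, $k\in\mathbb Z$). Consider data as attached to a connected reductive group over a non-archimedean local field (with $\Sigma$ normalized so that the affine hyperplanes are $\alpha=k$, the origin being the chosen special point): a group $W(1)$ with a finite commutative normal subgroup $Z_\kappa$ and $W=W(1)/Z_\kappa$; an action of $W$ on $N$ by affine automorphisms with linear parts in $W_0$ and with $\alpha(w\cdot 0)\in\mathbb Z$ for $w\in W,\ \alpha\in\Sigma$; a homomorphism $W_{\mathrm{aff}}\to W$ with normal image, compatible with the actions on $N$; and lifts $n_w\in W(1)$ of the $w\in W_0\subset W_{\mathrm{aff}}$ such that $n_{vw}=n_vn_w$ whenever $\ell(vw)=\ell(v)+\ell(w)$. Let $\Lambda(1)=\ker(W(1)\to W_0)$; $\lambda\in\Lambda(1)$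 acts on $N$ by translation by $\nu(\lambda)$. Let $C$ be a commutative ring. Let $q$ be a $C$-valued function on the set of reflections of $W_{\mathrm{aff}}$ (viewed in $W$), invariant under conjugation by $W$, and let $c$ be a $C[Z_\kappa]$-valued function on the set of lifts to $W(1)$ of these reflections such that $c_{wsw^{-1}}=w\cdot c_s$ for $w\in W(1)$, $c_{ts}=tc_s$ for $t\in Z_\kappa$, and $c_{s^{-1}}$ is the image of $c_s$ under $t\mapsto t^{-1}$ (all these hold for the parameters of a reductive group). Parabolics $P$ correspond to subsets $\Delta_P\subset\Delta$ ($\Delta_G=\Delta$). Let $\Sigma_P$ be the roots in the span of $\Delta_P$, $\Sigma_P^+=\Sigma_P\cap\Sigma^+$, $W_{0,P}$ the subgroup generated by the reflections in $\Delta_P$, $W_P(1)$ its inverse image in $W(1)$, and $\ell_P(w)$ the number of hyperplanes $\alpha=k$ ($\alpha\in\Sigma_P$, $k\in\mathbb Z$) separating the alcove $\{0<\alpha<1\ \forall\alpha\in\Sigma^+_P\}$ from its image under $w$. Let $S_{\mathrm{aff},P}(1)$ be the set of lifts $s$ of reflections in such hyperplanes with $\ell_P(s)=1$. The algebra $\mathcal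 H_P$ is the $C$-algebra generated by $T^P_w$ ($w\in W_P(1)$), with $T^P_1=1$, $T^P_vT^P_w=T^P_{vw}$ if $\ell_P(vw)=\ell_P(v)+\ell_P(w)$, and $(T^P_s)^2=q_sT^P_{s^2}+c_sT^P_s$ for $s\in S_{\mathrm{aff},P}(1)$, where $t\in Z_\kappa$ is read as $T^P_t$; put $\mathcal H=\mathcal H_G$, $T_w=T_w^G$. For $w=s_1\cdots s_lu$ with $s_i\in S_{\mathrm{aff},P}(1)$, $l=\ell_P(w)$, $\ell_P(u)=0$ put $T^{P*}_w=(T^P_{s_1}-c_{s_1})\cdots(T^P_{s_l}-c_{s_l})T^P_u$ (and $T_w^*=T_w^{G*}$). Let $W_P^-(1)$ be the set of $n_v\lambda$ ($v\in W_{0,P}$, $\lambda\in\Lambda(1)$) with $\alpha(\nu(\lambda))\ge 0$ for all $\alpha\in\Sigma^+\setminus\Sigma_P^+$, and $\mathcal H_P^-$ the span of the $T_w^P$, $w\in W_P^-(1)$, with $j_P^-(T_w^P)=T_w$ and $j_P^{-*}(T_w^{P*})=T_w^*$. Modules are right modules. For an $\mathcal H_P$-module $\sigma$ put $$I_P(\sigma)=\operatorname{Hom}_{(\mathcal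 H_P^-,j_P^{-*})}(\mathcal H,\sigma)=\{\varphi:\varphi(XT_w^*)=\varphi(X)T_w^{P*}\ \forall w\in W_P^-(1)\},$$ $$I'_P(\sigma)=\operatorname{Hom}_{(\mathcal H_P^-,j_P^{-})}(\mathcal H,\sigma)=\{\varphi:\varphi(XT_w)=\varphi(X)T_w^{P}\ \forall w\in W_P^-(1)\},$$ where $\varphi$ runs through the $C$-linear maps $\mathcal H\to\sigma$, $X$ through $\mathcal H$, and $(\varphi Y)(X)=\varphi(YX)$. The dual of an $\mathcal H_P$-module $\sigma$ is $\sigma^*=\operatorname{Hom}_C(\sigma,C)$ with $(fX)(v)=f(v\,\zeta_P(X))$, where $\zeta_P$ is the anti-automorphism of $\mathcal H_P$ with $\zeta_P(T^P_w)=T^P_{w^{-1}}$ (likewise for $\mathcal H$). Let $w_P$ be the longest element of $W_{0,P}$, $n=n_{w_Gw_P}$, and let $P'=n\overline Pn^{-1}$, i.e. the parabolic with $\Delta_{P'}=-w_G(\Delta_P)$. For an $\mathcal H_P$-module $\tau$, $n\tau$ is the $\mathcal H_{P'}$-module on the same space on which $T^{P'}_w$ acts as $T^P_{n^{-1}wn}$.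 **Proposition.** For every commutative ring $C$, every $P$ and every $\mathcal H_P$-module $\sigma$ there are isomorphisms of $\mathcal H$-modules $$I_P(\sigma)^*\cong I'_{P'}(n_{w_Gw_P}\sigma^*),\qquad I'_P(\sigma)^*\cong I_{P'}(n_{w_Gw_P}\sigma^*).$$ -/

import Mathlib

/-!
# Pro-p-Iwahori Hecke algebras and their parabolically induced modules
-/

open Module MulOpposite

noncomputable section

namespace ProPIwahori

set_option linter.unusedSectionVars false

/-! ## Root systems, finite Weyl groups, affine reflections

`R` is a root pairing whose roots are regarded, through `R.root'`, as linear forms on the real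
vector space `N`.  Parabolic subgroups correspond to sets `J` of simple roots. -/

section Roots

variable {ι M N : Type*} [AddCommGroup M] [Module ℝ M] [AddCommGroup N] [Module ℝ N]
  {R : RootPairing ι ℝ M N} (b : R.Base)

/-- The span of the simple roots in `J`, inside the dual of `N`. -/
def rootSpan (J : Set b.support) : Submodule ℝ (Dual ℝ N) :=
  Submodule.span ℝ {f | ∃ j ∈ J, f = R.root' j}

/-- The root subsystem `Σ_J` spanned by the simple roots in `J`. -/
def levRoots (J : Set b.support) : Set ι := {i | R.root' i ∈ rootSpan b J}

/-- The finite Weyl group `W_{0,J}`, acting on `N`. For `J = Set.univ` it is `W₀`. -/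
def finWeyl (J : Set b.support) : Subgroup (N ≃ₗ[ℝ] N) :=
  Subgroup.closure {g | ∃ j ∈ J, g = R.coreflection (j : ι)}

/-- The length of an element of the finite Weyl group: its number of inversions, i.e. of positive
roots that it sends to negative roots. -/
def finLen (v : N ≃ₗ[ℝ] N) : ℕ :=
  {i : ι | b.IsPos i ∧ ∃ j, ¬ b.IsPos j ∧ R.coroot j = v (R.coroot i)}.ncard

variable (R) in
/-- The affine reflection `x ↦ x - (α_i(x) - k) α_i^∨`. -/
def affRefl (i : ι) (k : ℤ) : N ≃ᵃ[ℝ] N :=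
  (R.coreflection i).toAffineEquiv.trans (AffineEquiv.constVAdd ℝ N ((k : ℝ) • R.coroot i))

variable (R) in
/-- The affine Weyl group of `Σ`. -/
def affWeyl : Subgroup (N ≃ᵃ[ℝ] N) :=
  Subgroup.closure {g | ∃ i k, g = affRefl R i k}

variable (R) in
/-- The affine hyperplane `α_i = k`. -/
def hyperplane (i : ι) (k : ℤ) : Set N := {x | R.root' i x = k}

/-- The affine hyperplanes attached to the roots in `Σ_J`. -/
def walls (J : Set b.support) : Set (Set N) := {H | ∃ i ∈ levRoots b J, ∃ k, H = hyperplane R i k}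

/-- The fundamental alcove for `Σ_J`: the alcove in the dominant chamber with the origin in its
closure. -/
def alcove (J : Set b.support) : Set N :=
  {x | ∀ i ∈ levRoots b J, b.IsPos i → 0 < R.root' i x ∧ R.root' i x < 1}

/-- `H` separates `A` from `B`. -/
def Separates (H A B : Set N) : Prop := ∀ x ∈ A, ∀ y ∈ B, (segment ℝ x y ∩ H).Nonempty

/-- The length of an affine transformation (preserving the hyperplanes of `Σ_J`): the number of
these hyperplanes which separate the fundamental alcove from its image. -/
def affLen (J : Set b.support) (g : N ≃ᵃ[ℝ] N) : ℕ :=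
  {H | H ∈ walls b J ∧ Separates H (alcove b J) (g '' alcove b J)}.ncard

theorem affRefl_apply (i : ι) (k : ℤ) (x : N) :
    affRefl R i k x = x - (R.root' i x - k) • R.coroot i := by
  simp [affRefl, RootPairing.coreflection_apply, sub_smul]
  abel

theorem affRefl_mem (i : ι) (k : ℤ) : affRefl R i k ∈ affWeyl R :=
  Subgroup.subset_closure ⟨i, k, rfl⟩

theorem coreflection_mem {J : Set b.support} {j : b.support} (hj : j ∈ J) :
    R.coreflection (j : ι) ∈ finWeyl b J := Subgroup.subset_closure ⟨j, hj, rfl⟩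

theorem finWeyl_mono {J K : Set b.support} (h : J ⊆ K) : finWeyl b J ≤ finWeyl b K :=
  Subgroup.closure_mono fun _ ⟨j, hj, e⟩ => ⟨j, h hj, e⟩

theorem toAffineEquiv_mem {v : N ≃ₗ[ℝ] N} {J : Set b.support} (hv : v ∈ finWeyl b J) :
    v.toAffineEquiv ∈ affWeyl R := by
  induction hv using Subgroup.closure_induction with
  | mem g hg =>
    obtain ⟨j, -, rfl⟩ := hg
    have : (R.coreflection (j : ι)).toAffineEquiv = affRefl R j 0 := by
      ext x; simp [affRefl]
    rw [this]; exact affRefl_mem _ _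
  | one => exact one_mem _
  | mul x y _ _ hx hy => exact mul_mem hx hy
  | inv x _ hx => exact inv_mem hx

/-- `v` sends the root `i` to the root `j`. -/
def MapsRoot (R : RootPairing ι ℝ M N) (v : N ≃ₗ[ℝ] N) (i j : ι) : Prop :=
  R.coroot j = v (R.coroot i) ∧ ∀ x, R.root' j (v x) = R.root' i x

theorem MapsRoot.inv {v : N ≃ₗ[ℝ] N} {i j : ι} (h : MapsRoot R v i j) : MapsRoot R v⁻¹ j i := by
  have e : ∀ x, v (v⁻¹ x) = x := fun x => v.apply_symm_apply x
  have e' : ∀ x, v⁻¹ (v x) = x := fun x => v.symm_apply_apply x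
  exact ⟨by rw [h.1, e'], fun x => by rw [← h.2, e]⟩

theorem MapsRoot.mul {v w : N ≃ₗ[ℝ] N} {i j k : ι} (h : MapsRoot R w i j) (h' : MapsRoot R v j k) :
    MapsRoot R (v * w) i k :=
  ⟨by rw [h'.1, h.1]; rfl, fun x => by rw [← h.2, ← h'.2]; rfl⟩

theorem mapsRoot_coreflection (a i : ι) :
    MapsRoot R (R.coreflection a) i (R.reflectionPerm a i) := by
  refine ⟨R.coroot_reflectionPerm a i, fun x => ?_⟩
  have h : R.root' (R.reflectionPerm a i) = R.root' i - R.pairing i a • R.root' a := by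
    simp only [RootPairing.root', RootPairing.root_reflectionPerm, RootPairing.reflection_apply,
      map_sub, map_smul]
    congr 2
  rw [h, RootPairing.coreflection_apply]
  simp only [LinearMap.sub_apply, LinearMap.smul_apply, map_sub, map_smul, smul_eq_mul,
    RootPairing.root'_coroot_eq_pairing, RootPairing.pairing_same]
  ring

theorem exists_mapsRoot {v : N ≃ₗ[ℝ] N} {J : Set b.support} (hv : v ∈ finWeyl b J) :
    (∀ i, ∃ j, MapsRoot R v i j) ∧ (∀ j, ∃ i, MapsRoot R v i j) := by
  induction hv using Subgroup.closure_induction with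
  | mem g hg =>
    obtain ⟨a, -, rfl⟩ := hg
    refine ⟨fun i => ⟨_, mapsRoot_coreflection _ i⟩, fun j => ⟨R.reflectionPerm a j, ?_⟩⟩
    simpa using mapsRoot_coreflection (R := R) a (R.reflectionPerm a j)
  | one => exact ⟨fun i => ⟨i, rfl, fun _ => rfl⟩, fun i => ⟨i, rfl, fun _ => rfl⟩⟩
  | mul x y _ _ hx hy =>
    refine ⟨fun i => ?_, fun k => ?_⟩
    · obtain ⟨j, hj⟩ := hy.1 i
      obtain ⟨k, hk⟩ := hx.1 j
      exact ⟨k, hj.mul hk⟩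
    · obtain ⟨j, hj⟩ := hx.2 k
      obtain ⟨i, hi⟩ := hy.2 j
      exact ⟨i, hi.mul hj⟩
  | inv x _ hx =>
    refine ⟨fun i => ?_, fun k => ?_⟩
    · obtain ⟨j, hj⟩ := hx.2 i
      exact ⟨j, hj.inv⟩
    · obtain ⟨j, hj⟩ := hx.1 k
      exact ⟨j, hj.inv⟩

theorem comp_sub_mem {v : N ≃ₗ[ℝ] N} {J : Set b.support} (hv : v ∈ finWeyl b J) (f : Dual ℝ N) :
    f ∘ₗ (v : N →ₗ[ℝ] N) - f ∈ rootSpan b J := by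
  induction hv using Subgroup.closure_induction generalizing f with
  | mem g hg =>
    obtain ⟨a, ha, rfl⟩ := hg
    have : f ∘ₗ (R.coreflection (a : ι) : N →ₗ[ℝ] N) - f = (-f (R.coroot a)) • R.root' a := by
      ext x
      simp [RootPairing.coreflection_apply, mul_comm]
    rw [this]
    exact Submodule.smul_mem _ _ (Submodule.subset_span ⟨a, ha, rfl⟩)
  | one =>
    have : f ∘ₗ ((1 : N ≃ₗ[ℝ] N) : N →ₗ[ℝ] N) - f = 0 := by ext x; simp
    rw [this]; exact zero_mem _
  | mul x y _ _ hx hy =>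
    have := add_mem (hy (f ∘ₗ (x : N →ₗ[ℝ] N))) (hx f)
    convert this using 1
    ext z; simp
  | inv x _ hx =>
    have := neg_mem (hx (f ∘ₗ ((x⁻¹ : N ≃ₗ[ℝ] N) : N →ₗ[ℝ] N)))
    convert this using 1
    ext z
    simp

theorem MapsRoot.mem_levRoots_iff {v : N ≃ₗ[ℝ] N} {J : Set b.support} (hv : v ∈ finWeyl b J)
    {i j : ι} (h : MapsRoot R v i j) : i ∈ levRoots b J ↔ j ∈ levRoots b J := by
  have e : R.root' j ∘ₗ (v : N →ₗ[ℝ] N) = R.root' i := by ext x; exact h.2 x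
  have := comp_sub_mem b hv (R.root' j)
  rw [e] at this
  constructor
  · intro hi
    have := sub_mem (show R.root' i ∈ rootSpan b J from hi) this
    rw [sub_sub_cancel] at this
    exact this
  · intro hj
    have := add_mem this (show R.root' j ∈ rootSpan b J from hj)
    rw [sub_add_cancel] at this
    exact this

variable [Finite ι]

theorem exists_longest (J : Set b.support) :
    ∃ w ∈ finWeyl b J, ∀ v ∈ finWeyl b J, finLen b v ≤ finLen b w := by
  have hne : (finLen b '' (finWeyl b J : Set (N ≃ₗ[ℝ] N))).Nonempty := ⟨_, 1, one_mem _, rfl⟩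
  have hb : BddAbove (finLen b '' (finWeyl b J : Set (N ≃ₗ[ℝ] N))) := by
    refine ⟨(Set.univ : Set ι).ncard, ?_⟩
    rintro _ ⟨v, -, rfl⟩
    exact Set.ncard_le_ncard (Set.subset_univ _) (Set.toFinite _)
  obtain ⟨w, hw, e⟩ := Nat.sSup_mem hne hb
  exact ⟨w, hw, fun v hv => e ▸ le_csSup hb ⟨v, hv, rfl⟩⟩

/-- The longest element `w_J` of `W_{0,J}`. -/
def longest (J : Set b.support) : N ≃ₗ[ℝ] N := (exists_longest b J).choose

theorem longest_mem (J : Set b.support) : longest b J ∈ finWeyl b J :=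
  (exists_longest b J).choose_spec.1

theorem le_longest (J : Set b.support) {v : N ≃ₗ[ℝ] N} (hv : v ∈ finWeyl b J) :
    finLen b v ≤ finLen b (longest b J) :=
  (exists_longest b J).choose_spec.2 v hv

/-- `-w_G(J)`, the set of simple roots of the parabolic `P' = n P̄ n⁻¹`, `n = n_{w_G w_P}`. -/
def opp (J : Set b.support) : Set b.support :=
  {j | ∃ i ∈ J, R.coroot (j : ι) = -longest b Set.univ (R.coroot (i : ι))}

/-- `w_G w_P`. -/
def wGP (J : Set b.support) : N ≃ₗ[ℝ] N := longest b Set.univ * longest b J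

theorem wGP_mem (J : Set b.support) : wGP b J ∈ finWeyl b Set.univ :=
  mul_mem (longest_mem b _) (finWeyl_mono b (Set.subset_univ J) (longest_mem b J))

/-! The next facts show that `w_G w_P` maps the positive roots of `Σ_P` onto those of `Σ_{P'}`. -/

theorem exists_dual_point (g : b.support → ℝ) : ∃ y : N, ∀ j : b.support, R.root' j y = g j := by
  have hli : LinearIndependent ℝ (fun j : b.support => R.root (j : ι)) := b.linearIndepOn_root
  obtain ⟨φ, hφ⟩ : ∃ φ : M →ₗ[ℝ] ℝ, ∀ j : b.support, φ (R.root (j : ι)) = g j := by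
    let B := Basis.span hli
    obtain ⟨φ, hφ⟩ := LinearMap.exists_extend (B.constr ℝ g)
    refine ⟨φ, fun j => ?_⟩
    have := LinearMap.congr_fun hφ (B j)
    rw [Basis.constr_basis] at this
    rw [← this]
    simp [B, Basis.span_apply]
  refine ⟨R.flip.toPerfPair.symm φ, fun j => ?_⟩
  rw [← hφ j]
  have := LinearMap.congr_fun (R.flip.toPerfPair.apply_symm_apply φ) (R.root (j : ι))
  exact this

theorem exists_nat_comb {i : ι} (hi : b.IsPos i) :
    ∃ f : ι → ℤ, (∀ j, 0 ≤ f j) ∧ ∀ x, R.root' i x = ∑ j ∈ b.support, (f j : ℝ) * R.root' j x := by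
  obtain ⟨f, -, hf, e⟩ := b.exists_root_eq_sum_int i
  have hpos : 0 < f := by
    refine hf.resolve_right fun hn => ?_
    rw [b.isPos_iff, RootPairing.Base.height_eq_sum e] at hi
    exact absurd (Finset.sum_nonpos fun j _ => hn.le j) (not_le.2 hi)
  refine ⟨f, fun j => hpos.le j, fun x => ?_⟩
  simp only [RootPairing.root', e, map_sum, LinearMap.sum_apply, map_zsmul]
  simp

theorem exists_rho : ∃ ρ : N, ∀ i, R.root' i ρ = b.height i := by
  obtain ⟨ρ, hρ⟩ := exists_dual_point b (fun _ => 1)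
  refine ⟨ρ, fun i => ?_⟩
  obtain ⟨f, -, -, e⟩ := b.exists_root_eq_sum_int i
  rw [RootPairing.Base.height_eq_sum e]
  have h : ∀ j ∈ b.support, R.toLinearMap (R.root j) ρ = 1 := fun j hj => hρ ⟨j, hj⟩
  simp only [RootPairing.root', e, map_sum, LinearMap.sum_apply, map_zsmul, LinearMap.smul_apply]
  push_cast
  exact Finset.sum_congr rfl fun j hj => by simp [h j hj]

theorem coroot_neg (i : ι) : R.coroot (R.reflectionPerm i i) = -R.coroot i := by
  rw [R.coroot_reflectionPerm, R.coreflection_apply_self]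

theorem neg_neg_root (i : ι) :
    R.reflectionPerm (R.reflectionPerm i i) (R.reflectionPerm i i) = i :=
  R.coroot.injective (by rw [coroot_neg, coroot_neg, neg_neg])

theorem MapsRoot.neg {v : N ≃ₗ[ℝ] N} {i j : ι} (h : MapsRoot R v i j) :
    MapsRoot R v (R.reflectionPerm i i) (R.reflectionPerm j j) := by
  have e : ∀ k, R.root' (R.reflectionPerm k k) = -R.root' k := fun k => by
    simp [RootPairing.root', RootPairing.root_reflectionPerm]
  refine ⟨by rw [coroot_neg, coroot_neg, h.1, map_neg], fun x => ?_⟩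
  simp [e, h.2]

theorem isPos_neg_iff (i : ι) : b.IsPos (R.reflectionPerm i i) ↔ ¬ b.IsPos i :=
  RootPairing.Base.IsPos.neg_iff_not b i

theorem mem_levRoots_of_mem {J : Set b.support} {j : b.support} (hj : j ∈ J) :
    (j : ι) ∈ levRoots b J := Submodule.subset_span ⟨j, hj, rfl⟩

theorem neg_mem_levRoots {J : Set b.support} {i : ι} (hi : i ∈ levRoots b J) :
    R.reflectionPerm i i ∈ levRoots b J := by
  have e : R.root' (R.reflectionPerm i i) = -R.root' i := by
    simp [RootPairing.root', RootPairing.root_reflectionPerm]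
  change R.root' _ ∈ rootSpan b J
  rw [e]
  exact neg_mem hi

theorem MapsRoot.right_unique {v : N ≃ₗ[ℝ] N} {i j k : ι} (h : MapsRoot R v i j)
    (h' : R.coroot k = v (R.coroot i)) : j = k :=
  R.coroot.injective (h.1.trans h'.symm)

variable [R.IsCrystallographic] [R.IsReduced]

theorem longest_neg_simple {J : Set b.support} {i : b.support} (hi : i ∈ J) {j : ι}
    (h : MapsRoot R (longest b J) i j) : ¬ b.IsPos j := by
  intro hj
  set w := longest b J with hw
  have hwm : w ∈ finWeyl b J := longest_mem b J
  have hle := le_longest b J (mul_mem hwm (coreflection_mem b hi))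
  have hss : ∀ x, R.coreflection (i : ι) (R.coreflection (i : ι) x) = x :=
    fun x => R.coreflection_same (i : ι) x
  have hpi : b.IsPos (i : ι) := b.isPos_of_mem_support i.2
  refine absurd hle (not_le.2 ?_)
  have hinj : Function.Injective (R.reflectionPerm (i : ι)) := (R.reflectionPerm _).injective
  unfold finLen
  rw [← Set.ncard_image_of_injective _ hinj]
  refine Set.ncard_lt_ncard ?_ (Set.toFinite _)
  refine Set.ssubset_iff_exists.2 ⟨?_, i, ⟨hpi, ?_⟩, ?_⟩
  · rintro _ ⟨k, ⟨hk, l, hl, e⟩, rfl⟩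
    have hki : k ≠ i := by
      rintro rfl
      exact hl (h.right_unique e ▸ hj)
    refine ⟨RootPairing.Base.IsPos.reflectionPerm hk i.2 hki, l, hl, ?_⟩
    rw [e, R.coroot_reflectionPerm]
    change _ = w (R.coreflection (i : ι) (R.coreflection (i : ι) _))
    rw [hss]
  · refine ⟨R.reflectionPerm j j, by rw [isPos_neg_iff]; exact not_not.2 hj, ?_⟩
    rw [h.neg.1, R.coroot_reflectionPerm]
    rfl
  · rintro ⟨k, ⟨hk, -⟩, e⟩
    have : k = R.reflectionPerm (i : ι) i := by
      have := congrArg (R.reflectionPerm (i : ι)) e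
      rwa [R.reflectionPerm_self] at this
    rw [this, isPos_neg_iff] at hk
    exact hk hpi

theorem longest_neg {J : Set b.support} {i j : ι} (hi : i ∈ levRoots b J) (hp : b.IsPos i)
    (h : MapsRoot R (longest b J) i j) : ¬ b.IsPos j := by
  classical
  obtain ⟨f, hf, e⟩ := exists_nat_comb b hp
  obtain ⟨y, hy⟩ := exists_dual_point b (fun j => if j ∈ J then 0 else 1)
  have hy0 : R.root' i y = 0 := by
    have : ∀ g ∈ rootSpan b J, g y = 0 := by
      intro g hg
      induction hg using Submodule.span_induction with
      | mem g hg => obtain ⟨a, ha, rfl⟩ := hg; simp [hy, ha]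
      | zero => rfl
      | add x z _ _ hx hz => simp [hx, hz]
      | smul c x _ hx => simp [hx]
    exact this _ hi
  have hfJ : ∀ a : b.support, a ∉ J → f a = 0 := by
    rw [e, Finset.sum_eq_zero_iff_of_nonneg] at hy0
    · intro a ha
      have := hy0 a a.2
      rw [hy a, if_neg ha, mul_one] at this
      exact_mod_cast this
    · intro a ha
      have h1 := hy ⟨a, ha⟩
      rw [show R.root' a y = _ from h1]
      have : (0 : ℝ) ≤ f a := by exact_mod_cast hf a
      split_ifs <;> simp [this]
  obtain ⟨ρ, hρ⟩ := exists_rho b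
  have key : (b.height j : ℝ) ≤ 0 := by
    rw [← hρ j, ← h.inv.2, e]
    refine Finset.sum_nonpos fun a ha => ?_
    by_cases haJ : (⟨a, ha⟩ : b.support) ∈ J
    · obtain ⟨l, hl⟩ := (exists_mapsRoot b (longest_mem b J)).1 a
      have := longest_neg_simple b haJ hl
      rw [hl.inv.2, hρ]
      refine mul_nonpos_of_nonneg_of_nonpos (by exact_mod_cast hf a) ?_
      rw [b.isPos_iff, not_lt] at this
      exact_mod_cast this
    · simp [hfJ ⟨a, ha⟩ haJ]
  rw [b.isPos_iff, not_lt]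
  exact_mod_cast key

theorem alcove_nonempty (J : Set b.support) : (alcove b J).Nonempty := by
  obtain ⟨ρ, hρ⟩ := exists_rho b
  obtain ⟨B, hB⟩ := (Set.finite_range b.height).bddAbove
  have hB' : ∀ i, (b.height i : ℝ) ≤ |(B : ℝ)| := fun i =>
    le_trans (by exact_mod_cast hB ⟨i, rfl⟩) (le_abs_self _)
  have hpos : 0 < |(B : ℝ)| + 1 := by positivity
  refine ⟨(|(B : ℝ)| + 1)⁻¹ • ρ, fun i _ hi => ?_⟩
  have hi' : (0 : ℝ) < b.height i := by exact_mod_cast (b.isPos_iff.1 hi)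
  rw [map_smul, hρ, smul_eq_mul, inv_mul_eq_div]
  exact ⟨by positivity, (div_lt_one hpos).2 (by linarith [hB' i])⟩

theorem affLen_one (J : Set b.support) : affLen b J (1 : N ≃ᵃ[ℝ] N) = 0 := by
  unfold affLen
  convert Set.ncard_empty (Set N)
  refine Set.eq_empty_iff_forall_notMem.2 ?_
  rintro _ ⟨⟨i, hi, k, rfl⟩, hS⟩
  have key : ∀ i ∈ levRoots b J, b.IsPos i → ∀ k : ℤ, ∀ x ∈ alcove b J, R.root' i x ≠ k := by
    intro i hi hp k x hx e
    obtain ⟨h0, h1⟩ := hx i hi hp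
    rw [e] at h0 h1
    have h0' : 0 < k := by exact_mod_cast h0
    have h1' : k < 1 := by exact_mod_cast h1
    lia
  obtain ⟨x, hx⟩ := alcove_nonempty b J
  have hx1 : x ∈ (1 : N ≃ᵃ[ℝ] N) '' alcove b J := ⟨x, hx, rfl⟩
  obtain ⟨z, hz, hzH⟩ := hS x hx x hx1
  rw [segment_same, Set.mem_singleton_iff] at hz
  subst hz
  change R.root' i z = k at hzH
  by_cases hp : b.IsPos i
  · exact key i hi hp k z hx hzH
  · rw [← isPos_neg_iff] at hp
    refine key _ (neg_mem_levRoots b hi) hp (-k) z hx ?_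
    have e : R.root' (R.reflectionPerm i i) = -R.root' i := by
      simp [RootPairing.root', RootPairing.root_reflectionPerm]
    rw [e, LinearMap.neg_apply, hzH]
    push_cast; rfl

theorem mem_levRoots_univ (i : ι) : i ∈ levRoots b Set.univ := by
  obtain ⟨f, -, -, e⟩ := b.exists_root_eq_sum_int i
  change R.root' i ∈ rootSpan b Set.univ
  have : R.root' i = ∑ j ∈ b.support, (f j : ℝ) • R.root' j := by
    ext x
    simp only [RootPairing.root', e, map_sum, LinearMap.sum_apply, map_zsmul]
    simp
  rw [this]
  exact Submodule.sum_mem _ fun j hj =>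
    Submodule.smul_mem _ _ (Submodule.subset_span ⟨⟨j, hj⟩, trivial, rfl⟩)

theorem longest_pos_iff {i j : ι} (h : MapsRoot R (longest b Set.univ) i j) :
    b.IsPos j ↔ ¬ b.IsPos i := by
  constructor
  · intro hj hi
    exact longest_neg b (mem_levRoots_univ b i) hi h hj
  · intro hi
    rw [← isPos_neg_iff] at hi
    have := longest_neg b (mem_levRoots_univ b _) hi h.neg
    rwa [isPos_neg_iff, not_not] at this

/-- `-w_G` permutes the simple roots. -/
theorem neg_longest_simple (i : b.support) : ∃ j : b.support,
    MapsRoot R (longest b Set.univ) i (R.reflectionPerm (j : ι) j) := by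
  classical
  obtain ⟨l, hl⟩ := (exists_mapsRoot b (longest_mem b Set.univ)).1 i
  have hpi : b.IsPos (i : ι) := b.isPos_of_mem_support i.2
  have hpl : b.IsPos (R.reflectionPerm l l) := by
    rw [isPos_neg_iff, longest_pos_iff b hl, not_not]; exact hpi
  obtain ⟨f, hf, e⟩ := exists_nat_comb b hpl
  obtain ⟨ρ, hρ⟩ := exists_rho b
  choose g hg using fun a : b.support => (exists_mapsRoot b (longest_mem b Set.univ)).2 (a : ι)
  have hgn : ∀ a, b.height (g a) ≤ -1 := by
    intro a
    have := (longest_pos_iff b (hg a)).1 (b.isPos_of_mem_support a.2)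
    rw [b.isPos_iff] at this
    have h0 := b.height_ne_zero (g a)
    lia
  have hsum : ∑ a : b.support, f a * b.height (g a) = -1 := by
    have h1 := e (longest b Set.univ ρ)
    have h2 : R.root' (R.reflectionPerm l l) (longest b Set.univ ρ) = -1 := by
      have : R.root' (R.reflectionPerm l l) = -R.root' l := by
        simp [RootPairing.root', RootPairing.root_reflectionPerm]
      rw [this, LinearMap.neg_apply, hl.2, hρ, RootPairing.Base.height_one_of_mem_support i.2]
      simp
    rw [h2, ← Finset.sum_coe_sort] at h1
    have h3 : ∀ a : b.support, R.root' a (longest b Set.univ ρ) = b.height (g a) := fun a => by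
      rw [(hg a).2, hρ]
    simp only [h3] at h1
    exact_mod_cast h1.symm
  obtain ⟨a, -, ha⟩ : ∃ a ∈ Finset.univ, f ((a : b.support) : ι) * b.height (g a) ≠ 0 := by
    refine Finset.exists_ne_zero_of_sum_ne_zero ?_
    rw [hsum]; decide
  have hle : ∀ c : b.support, f c * b.height (g c) ≤ -f c := fun c => by
    nlinarith [hf c, hgn c]
  have hfs : ∑ c : b.support, f c ≤ 1 := by
    have := Finset.sum_le_sum fun c (_ : c ∈ Finset.univ) => hle c
    rw [hsum, Finset.sum_neg_distrib] at this
    lia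
  have ha1 : 1 ≤ f a := by
    have : f a ≠ 0 := left_ne_zero_of_mul ha
    have := hf a
    lia
  have hsplit := Finset.add_sum_erase Finset.univ (fun c : b.support => f c) (Finset.mem_univ a)
  have hrest : ∀ c : b.support, c ≠ a → f c = 0 := by
    intro c hc
    have h1 := Finset.single_le_sum (f := fun c : b.support => f c) (fun d _ => hf d)
      (Finset.mem_erase.2 ⟨hc, Finset.mem_univ c⟩)
    have := hf c
    lia
  have hfa : f a = 1 := by
    have h1 := Finset.sum_nonneg fun d (_ : d ∈ Finset.univ.erase a) => hf (d : ι)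
    lia
  refine ⟨a, ?_⟩
  have hroot : R.root' (R.reflectionPerm l l) = R.root' a := by
    ext x
    rw [e x, ← Finset.sum_coe_sort, Finset.sum_eq_single a]
    · simp [hfa]
    · intro c _ hc; simp [hrest c hc]
    · simp
  have hla : R.reflectionPerm l l = a := by
    apply R.root.injective
    exact R.toPerfPair.injective hroot
  rw [← hla, neg_neg_root]
  exact hl

theorem opp_iff (J : Set b.support) (j : b.support) : j ∈ opp b J ↔
    ∃ i ∈ J, MapsRoot R (longest b Set.univ) i (R.reflectionPerm (j : ι) j) := by
  constructor
  · rintro ⟨i, hi, e⟩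
    obtain ⟨l, hl⟩ := (exists_mapsRoot b (longest_mem b Set.univ)).1 i
    refine ⟨i, hi, ?_⟩
    rwa [← hl.right_unique (k := R.reflectionPerm (j : ι) j)]
    rw [coroot_neg, e, neg_neg]
  · rintro ⟨i, hi, h⟩
    exact ⟨i, hi, by rw [← h.1, coroot_neg, neg_neg]⟩

theorem wGP_mem_levRoots {J : Set b.support} {k l : ι} (h : MapsRoot R (wGP b J) k l) :
    k ∈ levRoots b J ↔ l ∈ levRoots b (opp b J) := by
  obtain ⟨m, hm⟩ := (exists_mapsRoot b (longest_mem b J)).1 k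
  obtain ⟨l', hl'⟩ := (exists_mapsRoot b (longest_mem b Set.univ)).1 m
  obtain rfl : l = l' := h.right_unique (hm.mul hl').1
  rw [hm.mem_levRoots_iff b (longest_mem b J)]
  have e1 : (R.root' l).comp (longest b Set.univ : N →ₗ[ℝ] N) = R.root' m := by
    ext x; exact hl'.2 x
  have e2 : (R.root' m).comp ((longest b Set.univ)⁻¹ : N ≃ₗ[ℝ] N).toLinearMap = R.root' l := by
    ext x; exact hl'.inv.2 x
  constructor
  · intro hmJ
    change R.root' l ∈ rootSpan b (opp b J)
    rw [← e2]
    have : ∀ g ∈ rootSpan b J,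
        g.comp ((longest b Set.univ)⁻¹ : N ≃ₗ[ℝ] N).toLinearMap ∈ rootSpan b (opp b J) := by
      intro g hg
      induction hg using Submodule.span_induction with
      | mem g hg =>
        obtain ⟨a, ha, rfl⟩ := hg
        obtain ⟨j, hj⟩ := neg_longest_simple b a
        have : (R.root' (a : ι)).comp ((longest b Set.univ)⁻¹ : N ≃ₗ[ℝ] N).toLinearMap
            = -R.root' (j : ι) := by
          ext x
          refine (hj.inv.2 x).trans ?_
          simp [RootPairing.root', RootPairing.root_reflectionPerm]
        rw [this]
        exact neg_mem (Submodule.subset_span ⟨j, (opp_iff b J j).2 ⟨a, ha, hj⟩, rfl⟩)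
      | zero => simp
      | add x z _ _ hx hz => rw [LinearMap.add_comp]; exact add_mem hx hz
      | smul c x _ hx => rw [LinearMap.smul_comp]; exact Submodule.smul_mem _ _ hx
    exact this _ hmJ
  · intro hlJ
    change R.root' m ∈ rootSpan b J
    rw [← e1]
    have : ∀ g ∈ rootSpan b (opp b J),
        g.comp (longest b Set.univ : N →ₗ[ℝ] N) ∈ rootSpan b J := by
      intro g hg
      induction hg using Submodule.span_induction with
      | mem g hg =>
        obtain ⟨j, hj, rfl⟩ := hg
        obtain ⟨a, ha, hj⟩ := (opp_iff b J j).1 hj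
        have : (R.root' (j : ι)).comp (longest b Set.univ : N →ₗ[ℝ] N) = -R.root' (a : ι) := by
          ext x
          have := hj.2 x
          simp only [RootPairing.root', RootPairing.root_reflectionPerm,
            RootPairing.reflection_apply_self, map_neg, LinearMap.neg_apply] at this ⊢
          rw [← this, neg_neg]
          rfl
        rw [this]
        exact neg_mem (Submodule.subset_span ⟨a, ha, rfl⟩)
      | zero => simp
      | add x z _ _ hx hz => rw [LinearMap.add_comp]; exact add_mem hx hz
      | smul c x _ hx => rw [LinearMap.smul_comp]; exact Submodule.smul_mem _ _ hx
    exact this _ hlJ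

theorem wGP_pos {J : Set b.support} {k l : ι} (h : MapsRoot R (wGP b J) k l)
    (hk : k ∈ levRoots b J) : b.IsPos k ↔ b.IsPos l := by
  obtain ⟨m, hm⟩ := (exists_mapsRoot b (longest_mem b J)).1 k
  obtain ⟨l', hl'⟩ := (exists_mapsRoot b (longest_mem b Set.univ)).1 m
  obtain rfl : l = l' := h.right_unique (hm.mul hl').1
  rw [longest_pos_iff b hl']
  constructor
  · intro hp
    exact longest_neg b hk hp hm
  · intro hp
    by_contra hkn
    rw [← isPos_neg_iff] at hkn
    have := longest_neg b (neg_mem_levRoots b hk) hkn hm.neg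
    rw [isPos_neg_iff] at this
    exact this hp

theorem wGP_image_alcove (J : Set b.support) :
    (wGP b J).toAffineEquiv '' alcove b J = alcove b (opp b J) := by
  have hE := exists_mapsRoot b (wGP_mem b J)
  ext y
  constructor
  · rintro ⟨x, hx, rfl⟩ l hl hp
    obtain ⟨k, hk⟩ := hE.2 l
    have hkJ := (wGP_mem_levRoots b hk).2 hl
    have := hx k hkJ ((wGP_pos b hk hkJ).2 hp)
    rwa [← hk.2 x] at this
  · intro hy
    refine ⟨(wGP b J).symm y, fun k hk hp => ?_, (wGP b J).apply_symm_apply y⟩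
    obtain ⟨l, hl⟩ := hE.1 k
    have := hy l ((wGP_mem_levRoots b hl).1 hk) ((wGP_pos b hl hk).1 hp)
    rwa [← hl.2, LinearEquiv.apply_symm_apply]

theorem MapsRoot.image_hyperplane {v : N ≃ₗ[ℝ] N} {i j : ι} (h : MapsRoot R v i j) (k : ℤ) :
    v.toAffineEquiv '' hyperplane R i k = hyperplane R j k := by
  ext y
  constructor
  · rintro ⟨x, hx, rfl⟩
    exact (h.2 x).trans hx
  · intro hy
    refine ⟨v.symm y, ?_, v.apply_symm_apply y⟩
    change R.root' i _ = _
    rw [← h.2, LinearEquiv.apply_symm_apply]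
    exact hy

theorem separates_image (a : N ≃ᵃ[ℝ] N) {H A B : Set N} :
    Separates (a '' H) (a '' A) (a '' B) ↔ Separates H A B := by
  have hseg : ∀ x y, a '' segment ℝ x y = segment ℝ (a x) (a y) := fun x y =>
    image_segment ℝ (a : N →ᵃ[ℝ] N) x y
  simp only [Separates, Set.forall_mem_image, ← hseg, ← Set.image_inter a.injective,
    Set.image_nonempty]

theorem separates_comm {H A B : Set N} : Separates H A B ↔ Separates H B A := by
  simp only [Separates]
  exact ⟨fun h x hx y hy => segment_symm ℝ x y ▸ h y hy x hx,
    fun h x hx y hy => segment_symm ℝ x y ▸ h y hy x hx⟩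

theorem affLen_eq_of_image {J K : Set b.support} (a g g' : N ≃ᵃ[ℝ] N)
    (hw : ∀ H, a '' H ∈ walls b K ↔ H ∈ walls b J)
    (hs : ∀ H, Separates (a '' H) (alcove b K) (g' '' alcove b K) ↔
      Separates H (alcove b J) (g '' alcove b J)) :
    affLen b J g = affLen b K g' := by
  unfold affLen
  rw [← Set.ncard_image_of_injective _ (Set.image_injective.2 a.injective)]
  congr 1
  ext H'
  constructor
  · rintro ⟨H, ⟨hH, hS⟩, rfl⟩
    exact ⟨(hw H).2 hH, (hs H).2 hS⟩
  · rintro ⟨hH, hS⟩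
    obtain ⟨H, rfl⟩ : ∃ H, a '' H = H' := ⟨a ⁻¹' H', Set.image_preimage_eq _ a.surjective⟩
    exact ⟨H, ⟨(hw H).1 hH, (hs H).1 hS⟩, rfl⟩

theorem wGP_image_walls (J : Set b.support) (H : Set N) :
    (wGP b J).toAffineEquiv '' H ∈ walls b (opp b J) ↔ H ∈ walls b J := by
  have hE := exists_mapsRoot b (wGP_mem b J)
  constructor
  · rintro ⟨l, hl, k, e⟩
    obtain ⟨i, hi⟩ := hE.2 l
    refine ⟨i, (wGP_mem_levRoots b hi).2 hl, k, ?_⟩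
    rw [← hi.image_hyperplane] at e
    exact Set.image_injective.2 (wGP b J).toAffineEquiv.injective e
  · rintro ⟨i, hi, k, rfl⟩
    obtain ⟨l, hl⟩ := hE.1 i
    exact ⟨l, (wGP_mem_levRoots b hl).1 hi, k, hl.image_hyperplane k⟩

theorem affLen_conj (J : Set b.support) (g : N ≃ᵃ[ℝ] N) :
    affLen b (opp b J) ((wGP b J).toAffineEquiv * g * ((wGP b J).toAffineEquiv)⁻¹) =
      affLen b J g := by
  refine (affLen_eq_of_image b _ _ _ (wGP_image_walls b J) fun H => ?_).symm
  rw [← wGP_image_alcove, ← separates_image (wGP b J).toAffineEquiv (H := H)]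
  rw [← Set.image_comp, ← Set.image_comp]
  have : ⇑((wGP b J).toAffineEquiv * g * ((wGP b J).toAffineEquiv)⁻¹) ∘ (wGP b J).toAffineEquiv
      = (wGP b J).toAffineEquiv ∘ g := by
    ext x
    change (wGP b J) (g ((wGP b J).symm (wGP b J x))) = _
    rw [LinearEquiv.symm_apply_apply]
    rfl
  rw [this]

theorem conj_reflection {v : N ≃ₗ[ℝ] N} {i j : ι} (h : MapsRoot R v i j) :
    v * R.coreflection i * v⁻¹ = R.coreflection j := by
  ext x
  change v (R.coreflection i (v.symm x)) = _
  rw [RootPairing.coreflection_apply, RootPairing.coreflection_apply, map_sub, map_smul,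
    LinearEquiv.apply_symm_apply, h.1]
  congr 2
  exact (h.inv.2 x)

theorem coreflection_neg (i : ι) : R.coreflection (R.reflectionPerm i i) = R.coreflection i := by
  ext x
  rw [RootPairing.coreflection_apply, RootPairing.coreflection_apply, coroot_neg]
  simp [RootPairing.root', RootPairing.root_reflectionPerm]

theorem wGP_conj_mem {J : Set b.support} {g : N ≃ₗ[ℝ] N} (hg : g ∈ finWeyl b (opp b J)) :
    (wGP b J)⁻¹ * g * wGP b J ∈ finWeyl b J := by
  induction hg using Subgroup.closure_induction with
  | mem g hg =>
    obtain ⟨j, hj, rfl⟩ := hg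
    obtain ⟨i, hi, h⟩ := (opp_iff b J j).1 hj
    have h1 := conj_reflection h
    rw [coreflection_neg] at h1
    rw [← h1, wGP]
    have : (longest b Set.univ * longest b J)⁻¹ * (longest b Set.univ * R.coreflection (i : ι) *
        (longest b Set.univ)⁻¹) * (longest b Set.univ * longest b J) =
        (longest b J)⁻¹ * R.coreflection (i : ι) * longest b J := by group
    rw [this]
    exact mul_mem (mul_mem (inv_mem (longest_mem b J)) (coreflection_mem b hi)) (longest_mem b J)
  | one => simp
  | mul x y _ _ hx hy =>
    have := mul_mem hx hy
    convert this using 1; group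
  | inv x _ hx =>
    have := inv_mem hx
    convert this using 1; group

theorem conj_affRefl {v : N ≃ₗ[ℝ] N} {i j : ι} (h : MapsRoot R v i j) (k : ℤ) :
    v.toAffineEquiv * affRefl R i k * v.toAffineEquiv⁻¹ = affRefl R j k := by
  ext x
  change v (affRefl R i k (v.symm x)) = _
  rw [affRefl_apply, affRefl_apply, map_sub, map_smul, LinearEquiv.apply_symm_apply, h.1]
  congr 3
  exact h.inv.2 x

end Roots

/-! ## Right modules

A right module over a `C`-algebra `A` on the `C`-module `V` is given by its action
`Aᵐᵒᵖ → End_C(V)`; `π (op X) v` is `v X`. -/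

section RightModules

variable {C A B V V' : Type*} [CommRing C] [Ring A] [Algebra C A] [Ring B] [Algebra C B]
  [AddCommMonoid V] [Module C V] [AddCommMonoid V'] [Module C V']

variable (C A V) in
/-- Right `A`-module structures on `V`. -/
abbrev RightMod := Aᵐᵒᵖ →ₐ[C] Module.End C V

/-- Isomorphism of right `A`-modules. -/
def RightMod.Iso (π : RightMod C A V) (π' : RightMod C A V') : Prop :=
  ∃ e : V ≃ₗ[C] V', ∀ (X : A) (v : V), e (π (op X) v) = π' (op X) (e v)

/-- The dual `π^* = Hom_C(π, C)` with `(f X)(v) = f (v ζ(X))`, for an anti-endomorphism `ζ`. -/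
def RightMod.dual (ζ : A →ₐ[C] Aᵐᵒᵖ) (π : RightMod C A V) : RightMod C A (Dual C V) where
  toFun X := (π (ζ X.unop)).dualMap
  map_one' := by ext; simp
  map_mul' X Y := by ext; simp
  map_zero' := by ext; simp
  map_add' X Y := by ext; simp
  commutes' r := by ext; simp [Algebra.algebraMap_eq_smul_one]

/-- The pull-back of a right module along an algebra homomorphism. -/
def RightMod.pullback (ψ : A →ₐ[C] B) (σ : RightMod C B V) : RightMod C A V :=
  σ.comp (AlgHom.op ψ)

/-- The `C`-linear maps `φ : A → V` with `φ(X g_i) = φ(X) f_i` for all `X ∈ A` and all `i`.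
When the `f_i` span a subalgebra `B'` of `B` and `f_i ↦ g_i` defines an algebra homomorphism
`j : B' → A`, this is `Hom_{(B', j)}(A, V)`. -/
def coind {I : Type*} (f : I → B) (g : I → A) (σ : RightMod C B V) : Submodule C (A →ₗ[C] V) where
  carrier := {φ | ∀ X i, φ (X * g i) = σ (op (f i)) (φ X)}
  add_mem' h h' X i := by simp [h X i, h' X i]
  zero_mem' X i := by simp
  smul_mem' r φ h X i := by simp [h X i]

/-- The right `A`-module structure `(φ Y)(X) = φ(Y X)` on `Hom_{(B', j)}(A, V)`. -/
def coindMod {I : Type*} (f : I → B) (g : I → A) (σ : RightMod C B V) :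
    RightMod C A (coind f g σ) where
  toFun Y := LinearMap.restrict (LinearMap.lcomp C V (LinearMap.mulLeft C Y.unop))
    (fun φ h X i => by
      change φ (_ * (X * g i)) = σ (op (f i)) (φ (_ * X))
      rw [← mul_assoc, h])
  map_one' := by ext φ X; simp [LinearMap.restrict_apply]
  map_mul' Y Z := by
    ext φ X
    change (φ : A →ₗ[C] V) (Z.unop * Y.unop * X) = (φ : A →ₗ[C] V) (Z.unop * (Y.unop * X))
    rw [mul_assoc]
  map_zero' := by ext φ X; simp [LinearMap.restrict_apply]
  map_add' Y Z := by
    ext φ X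
    change (φ : A →ₗ[C] V) ((Y.unop + Z.unop) * X) =
      (φ : A →ₗ[C] V) (Y.unop * X) + (φ : A →ₗ[C] V) (Z.unop * X)
    rw [add_mul, map_add]
  commutes' r := by
    ext φ X
    simp [LinearMap.restrict_apply, Algebra.algebraMap_eq_smul_one]

end RightModules

/-! ## The combinatorial data -/

section Data

variable {ι M N : Type*} [AddCommGroup M] [Module ℝ M] [AddCommGroup N] [Module ℝ N]
  {R : RootPairing ι ℝ M N}

/-- The data attached to a reductive group `G` over a local field: the extension
`1 → Z_κ → W(1) → W → 1`, the action of `W` on the apartment `N` (with origin the chosen special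
point), the affine Weyl group `W_aff ⊆ W`, and representatives `n_v ∈ W(1)` of `v ∈ W₀`. -/
structure Datum (b : R.Base) (W1 : Type*) [Group W1] where
  /-- The group `Z_κ`. -/
  Zk : Subgroup W1
  [normal : Zk.Normal]
  finite : Finite Zk
  comm : ∀ s t : Zk, s * t = t * s
  /-- The action of `W = W(1) / Z_κ` on the apartment. -/
  act : W1 ⧸ Zk →* (N ≃ᵃ[ℝ] N)
  /-- The linear part of an element of `W` is its image in the finite Weyl group `W₀`. -/
  act_linear : ∀ w, (act w).linear ∈ finWeyl b Set.univ
  /-- Together with `act_linear`: `W` permutes the affine hyperplanes `α = k`. -/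
  act_int : ∀ w i, ∃ k : ℤ, R.root' i (act w 0) = k
  /-- The affine Weyl group is a normal subgroup of `W`, which acts on the apartment as it should;
  `W` is then the semidirect product of it and of the stabilizer `Ω` of the fundamental alcove. -/
  aff : affWeyl R →* W1 ⧸ Zk
  act_aff : ∀ x, act (aff x) = x
  aff_normal : aff.range.Normal
  /-- The representatives `n_v`. -/
  n : finWeyl b Set.univ → W1
  n_spec : ∀ v, (n v : W1 ⧸ Zk) = aff ⟨_, toAffineEquiv_mem b v.2⟩
  n_mul : ∀ v w : finWeyl b Set.univ,
    finLen b ((v * w : finWeyl b Set.univ) : N ≃ₗ[ℝ] N) =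
        finLen b (v : N ≃ₗ[ℝ] N) + finLen b (w : N ≃ₗ[ℝ] N) →
      n (v * w) = n v * n w

attribute [instance] Datum.normal

namespace Datum

variable {b : R.Base} {W1 : Type*} [Group W1] (D : Datum b W1)

/-- The action of `W(1)` on the apartment. -/
def act1 : W1 →* (N ≃ᵃ[ℝ] N) := D.act.comp (QuotientGroup.mk' D.Zk)

/-- The projection `W(1) → W₀`. -/
def proj : W1 →* (N ≃ₗ[ℝ] N) := AffineEquiv.linearHom.comp D.act1

/-- `W_J(1)`: the inverse image of `W_{0,J}` in `W(1)`. -/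
def lev (J : Set b.support) : Subgroup W1 := (finWeyl b J).comap D.proj

/-- `Λ(1)`, the kernel of `W(1) → W₀`. -/
def Lam : Subgroup W1 := D.proj.ker

/-- `λ ∈ Λ(1)` acts on the apartment as the translation by `ν(λ)`. -/
def nu (l : W1) : N := D.act1 l 0

/-- The length function `ℓ_J` of `W_J(1)`. -/
def len (J : Set b.support) (w : W1) : ℕ := affLen b J (D.act1 w)

/-- The reflections of the affine Weyl group `W_{aff,J}`, in `W`. -/
def refl (J : Set b.support) : Set (W1 ⧸ D.Zk) :=
  {r | ∃ i ∈ levRoots b J, ∃ k, r = D.aff ⟨affRefl R i k, affRefl_mem i k⟩}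

/-- `S_{aff,J}(1)`: lifts of the simple affine reflections for `Σ_J`, which are those of length
one. -/
def IsSimple (J : Set b.support) (s : W1) : Prop := (s : W1 ⧸ D.Zk) ∈ D.refl J ∧ D.len J s = 1

/-- `w = n_v λ` (`v ∈ W_{0,J}`, `λ ∈ Λ(1)`) is `J`-negative if `⟨α, ν(λ)⟩ ≥ 0` for all
`α ∈ Σ⁺ \ Σ_J⁺`. -/
def IsNeg (J : Set b.support) (w : W1) : Prop :=
  ∃ v : finWeyl b Set.univ, (v : N ≃ₗ[ℝ] N) ∈ finWeyl b J ∧ ∃ l ∈ D.Lam, w = D.n v * l ∧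
    ∀ i, b.IsPos i → i ∉ levRoots b J → 0 ≤ R.root' i (D.nu l)

theorem act1_zk (t : D.Zk) : D.act1 t = 1 := by
  have : ((t : W1) : W1 ⧸ D.Zk) = 1 := (QuotientGroup.eq_one_iff _).2 t.2
  change D.act ((t : W1) : W1 ⧸ D.Zk) = 1
  rw [this, map_one]

theorem zk_le_lev (J : Set b.support) : D.Zk ≤ D.lev J := by
  intro t ht
  change AffineEquiv.linearHom (D.act1 t) ∈ finWeyl b J
  rw [D.act1_zk ⟨t, ht⟩, map_one]
  exact one_mem _

theorem lev_le (J : Set b.support) : D.lev J ≤ D.lev Set.univ :=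
  Subgroup.comap_mono (finWeyl_mono b (Set.subset_univ J))

/-- The inclusion `Z_κ → W_J(1)`. -/
def zin (J : Set b.support) (t : D.Zk) : D.lev J := ⟨t, D.zk_le_lev J t.2⟩

theorem len_zk_mul (J : Set b.support) (t : D.Zk) (w : W1) : D.len J (t * w) = D.len J w := by
  rw [len, map_mul, act1_zk, one_mul, len]

theorem len_mul_zk (J : Set b.support) (t : D.Zk) (w : W1) : D.len J (w * t) = D.len J w := by
  rw [len, map_mul, act1_zk, mul_one, len]

end Datum

/-- The parameters `(q, c)`.  Only the values of `q` on the reflections, and of `c` on the lifts of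
reflections, matter; a function `q` on the simple reflections as usual extends uniquely to a
conjugation invariant function on all reflections.  The condition `c_inv` says that
`T_w ↦ T_{w⁻¹}` respects the quadratic relations. -/
structure Param {b : R.Base} {W1 : Type*} [Group W1] (D : Datum b W1) (C : Type*) [CommRing C] where
  q : W1 ⧸ D.Zk → C
  c : W1 → MonoidAlgebra C D.Zk
  q_conj : ∀ r ∈ D.refl Set.univ, ∀ w, q (w * r * w⁻¹) = q r
  c_conj : ∀ r : W1, (r : W1 ⧸ D.Zk) ∈ D.refl Set.univ → ∀ w : W1,
    c (w * r * w⁻¹) = MonoidAlgebra.mapDomain (MulAut.conjNormal w) (c r)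
  c_mul : ∀ r : W1, (r : W1 ⧸ D.Zk) ∈ D.refl Set.univ → ∀ t : D.Zk,
    c (t * r) = MonoidAlgebra.single t 1 * c r
  c_inv : ∀ r : W1, (r : W1 ⧸ D.Zk) ∈ D.refl Set.univ →
    c r⁻¹ = MonoidAlgebra.mapDomain (fun t => t⁻¹) (c r)

/-- The linear map `C[Z_κ] → A` given by `f : Z_κ → A`. -/
def zlin {C Z A : Type*} [CommRing C] [Ring A] [Algebra C A] (f : Z → A)
    (x : MonoidAlgebra C Z) : A := x.coeff.sum fun t a => a • f t

/-! ## The Hecke algebras -/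

namespace Param

variable {b : R.Base} {W1 : Type*} [Group W1] {D : Datum b W1} {C : Type*} [CommRing C]
  (p : Param D C)

/-- The relations of the pro-`p`-Iwahori Hecke algebra of the Levi subgroup attached to `J`. -/
inductive Rel (J : Set b.support) :
    FreeAlgebra C (D.lev J) → FreeAlgebra C (D.lev J) → Prop
  | one : Rel J (FreeAlgebra.ι C 1) 1
  | braid (v w : D.lev J) (h : D.len J (v * w : D.lev J) = D.len J v + D.len J w) :
      Rel J (FreeAlgebra.ι C v * FreeAlgebra.ι C w) (FreeAlgebra.ι C (v * w))
  | quad (s : D.lev J) (hs : D.IsSimple J s) :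
      Rel J (FreeAlgebra.ι C s * FreeAlgebra.ι C s)
        (p.q (s : W1) • FreeAlgebra.ι C (s * s) +
          zlin (fun t => FreeAlgebra.ι C (D.zin J t)) (p.c s) * FreeAlgebra.ι C s)

/-- The pro-`p`-Iwahori Hecke algebra `H_J` of the Levi subgroup attached to `J`: the `C`-algebra
generated by the `T_w`, `w ∈ W_J(1)`, with the braid relations and the quadratic relations. The
algebra `H` is `H_J` for `J = Set.univ`. -/
abbrev Hecke (J : Set b.support) : Type _ := RingQuot (p.Rel J)

/-- The element `T_w` of `H_J`. -/
def T (J : Set b.support) (w : D.lev J) : p.Hecke J :=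
  RingQuot.mkAlgHom C (p.Rel J) (FreeAlgebra.ι C w)

/-- The element `c_s` of `C[Z_κ] ⊆ H_J`. -/
def cT (J : Set b.support) (s : W1) : p.Hecke J := zlin (fun t => p.T J (D.zin J t)) (p.c s)

/-- `w = s₁ ⋯ s_l u` with `s_i ∈ S_{aff,J}(1)`, `l = ℓ_J(w)` and `ℓ_J(u) = 0`. -/
def IsReduced (J : Set b.support) (w : D.lev J) (s : List (D.lev J)) (u : D.lev J) : Prop :=
  (∀ x ∈ s, D.IsSimple J x) ∧ s.length = D.len J w ∧ D.len J u = 0 ∧ w = s.prod * u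

/-- The element `T_w^* = (T_{s₁} - c_{s₁}) ⋯ (T_{s_l} - c_{s_l}) T_u` of `H_J`, for a
decomposition `w = s₁ ⋯ s_l u` as above, on which it does not depend. -/
def Tstar (J : Set b.support) (w : D.lev J) : p.Hecke J :=
  Classical.epsilon fun X => ∃ s u, IsReduced J w s u ∧
    X = (s.map fun x => p.T J x - p.cT J x).prod * p.T J u

theorem zlin_map {Z A B : Type*} [Ring A] [Algebra C A] [Ring B] [Algebra C B] (F : A →ₐ[C] B)
    (f : Z → A) (x : MonoidAlgebra C Z) : F (zlin f x) = zlin (fun t => F (f t)) x := by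
  simp [zlin, Finsupp.sum, map_sum]

theorem zlin_mapDomain {Z Z' A : Type*} [Ring A] [Algebra C A] (f : Z' → A) (g : Z → Z')
    (x : MonoidAlgebra C Z) :
    zlin f (MonoidAlgebra.mapDomain g x) = zlin (fun t => f (g t)) x := by
  unfold zlin
  rw [MonoidAlgebra.coeff_mapDomain, Finsupp.sum_mapDomain_index]
  · intro t; simp
  · intro t a a'; rw [add_smul]

theorem T_one (J : Set b.support) : p.T J 1 = 1 := by
  rw [T, RingQuot.mkAlgHom_rel C (Rel.one (p := p)), map_one]

theorem T_braid (J : Set b.support) (v w : D.lev J)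
    (h : D.len J (v * w : D.lev J) = D.len J v + D.len J w) :
    p.T J v * p.T J w = p.T J (v * w) := by
  rw [T, T, T, ← map_mul, RingQuot.mkAlgHom_rel C (Rel.braid (p := p) v w h)]

theorem T_quad (J : Set b.support) (s : D.lev J) (hs : D.IsSimple J s) :
    p.T J s * p.T J s = p.q (s : W1) • p.T J (s * s) + p.cT J s * p.T J s := by
  rw [T, ← map_mul, RingQuot.mkAlgHom_rel C (Rel.quad (p := p) s hs), map_add, map_mul, map_smul,
    zlin_map]
  rfl

/-- Algebra homomorphisms out of `H_J`. -/
def lift (J : Set b.support) {A : Type*} [Ring A] [Algebra C A] (f : D.lev J → A)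
    (h1 : f 1 = 1)
    (hb : ∀ v w : D.lev J, D.len J (v * w : D.lev J) = D.len J v + D.len J w →
      f v * f w = f (v * w))
    (hq : ∀ s : D.lev J, D.IsSimple J s →
      f s * f s = p.q (s : W1) • f (s * s) + zlin (fun t => f (D.zin J t)) (p.c s) * f s) :
    p.Hecke J →ₐ[C] A :=
  RingQuot.liftAlgHom C ⟨FreeAlgebra.lift C f, by
    intro x y h
    cases h with
    | one => simpa using h1
    | braid v w h => simpa using hb v w h
    | quad s hs => simpa [zlin_map] using hq s hs⟩

theorem lift_T (J : Set b.support) {A : Type*} [Ring A] [Algebra C A] (f : D.lev J → A)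
    (h1 hb hq) (w : D.lev J) : p.lift J f h1 hb hq (p.T J w) = f w := by
  rw [lift, T, RingQuot.liftAlgHom_mkAlgHom_apply, FreeAlgebra.lift_ι_apply]

end Param

/-! ### The anti-automorphism `ζ` -/

variable [Finite ι] [R.IsCrystallographic] [R.IsReduced]

namespace Datum

variable {b : R.Base} {W1 : Type*} [Group W1] (D : Datum b W1)

theorem act1_apply (w : W1) (x : N) : D.act1 w x = D.proj w x + D.act1 w 0 := by
  have := (D.act1 w).map_vadd 0 x
  simp only [vadd_eq_add, add_zero] at this
  exact this

theorem image_walls_of_mem {J : Set b.support} {w : W1} (hw : w ∈ D.lev J) {H : Set N}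
    (hH : H ∈ walls b J) : D.act1 w '' H ∈ walls b J := by
  obtain ⟨i, hi, k, rfl⟩ := hH
  obtain ⟨j, hj⟩ := (exists_mapsRoot b hw).1 i
  obtain ⟨m, hm⟩ := D.act_int (w : W1 ⧸ D.Zk) j
  change R.root' j (D.act1 w 0) = m at hm
  have hj2 : ∀ x, R.root' j (D.act1 w x) = R.root' i x + m := fun x => by
    rw [act1_apply, map_add, hj.2, hm]
  refine ⟨j, (hj.mem_levRoots_iff b hw).1 hi, k + m, ?_⟩
  ext y
  constructor
  · rintro ⟨x, hx, rfl⟩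
    change R.root' i x = k at hx
    change R.root' j _ = _
    rw [hj2, hx]; push_cast; rfl
  · intro hy
    obtain ⟨x, rfl⟩ := (D.act1 w).surjective y
    refine ⟨x, ?_, rfl⟩
    change R.root' j _ = _ at hy
    rw [hj2] at hy
    push_cast at hy
    exact add_right_cancel hy

theorem image_walls {J : Set b.support} {w : W1} (hw : w ∈ D.lev J) (H : Set N) :
    D.act1 w '' H ∈ walls b J ↔ H ∈ walls b J := by
  refine ⟨fun h => ?_, D.image_walls_of_mem hw⟩
  have := D.image_walls_of_mem (inv_mem hw) h
  rw [← Set.image_comp, map_inv] at this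
  have e : ⇑((D.act1 w)⁻¹) ∘ ⇑(D.act1 w) = id := by
    ext x; exact (D.act1 w).symm_apply_apply x
  rwa [e, Set.image_id] at this

theorem len_inv {J : Set b.support} {w : W1} (hw : w ∈ D.lev J) : D.len J w⁻¹ = D.len J w := by
  unfold len
  refine affLen_eq_of_image b (D.act1 w) _ _ (D.image_walls hw) fun H => ?_
  rw [← separates_image (D.act1 w) (H := H), map_inv, ← Set.image_comp _ ⇑(D.act1 w)⁻¹]
  have e : ⇑(D.act1 w) ∘ ⇑((D.act1 w)⁻¹) = id := by
    ext x; exact (D.act1 w).apply_symm_apply x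
  rw [e, Set.image_id, separates_comm]

theorem refl_mono {J K : Set b.support} (h : J ⊆ K) : D.refl J ⊆ D.refl K := by
  rintro _ ⟨i, hi, k, rfl⟩
  refine ⟨i, Submodule.span_mono ?_ hi, k, rfl⟩
  rintro _ ⟨j, hj, rfl⟩
  exact ⟨j, h hj, rfl⟩

theorem refl_univ {J : Set b.support} {r : W1 ⧸ D.Zk} (h : r ∈ D.refl J) :
    r ∈ D.refl Set.univ := D.refl_mono (Set.subset_univ J) h

theorem refl_inv {J : Set b.support} {r : W1 ⧸ D.Zk} (h : r ∈ D.refl J) : r⁻¹ = r := by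
  obtain ⟨i, -, k, rfl⟩ := h
  rw [← map_inv]
  congr 1
  rw [inv_eq_iff_mul_eq_one]
  ext x
  change affRefl R i k (affRefl R i k x) = x
  simp only [affRefl_apply, map_sub, map_smul, RootPairing.root'_coroot_eq_pairing,
    RootPairing.pairing_same, smul_eq_mul]
  module

theorem isSimple_inv {J : Set b.support} {s : W1} (hs : s ∈ D.lev J) (h : D.IsSimple J s) :
    D.IsSimple J s⁻¹ :=
  ⟨by rw [QuotientGroup.mk_inv, D.refl_inv h.1]; exact h.1, by rw [D.len_inv hs]; exact h.2⟩

theorem len_zk (J : Set b.support) (t : D.Zk) : D.len J t = 0 := by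
  rw [len, act1_zk, affLen_one]

end Datum

namespace Param

variable {b : R.Base} {W1 : Type*} [Group W1] {D : Datum b W1} {C : Type*} [CommRing C]
  (p : Param D C)

theorem T_zk_mul (J : Set b.support) (t : D.Zk) (w : D.lev J) :
    p.T J (D.zin J t) * p.T J w = p.T J (D.zin J t * w) := by
  refine p.T_braid J _ _ ?_
  change D.len J ((t : W1) * w) = D.len J (t : W1) + D.len J w
  rw [D.len_zk_mul, D.len_zk, zero_add]

theorem T_mul_zk (J : Set b.support) (t : D.Zk) (w : D.lev J) :
    p.T J w * p.T J (D.zin J t) = p.T J (w * D.zin J t) := by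
  refine p.T_braid J _ _ ?_
  change D.len J ((w : W1) * t) = D.len J w + D.len J (t : W1)
  rw [D.len_mul_zk, D.len_zk, add_zero]

/-- `T_s` commutes with `c_s`. -/
theorem cT_comm (J : Set b.support) (s : D.lev J) (hs : D.IsSimple J s) :
    p.T J s * p.cT J s = p.cT J s * p.T J s := by
  have h := p.c_conj (s : W1) (D.refl_univ hs.1) s
  rw [mul_inv_cancel_right] at h
  conv_rhs => rw [cT, h, zlin_mapDomain]
  rw [cT, zlin, zlin, Finsupp.mul_sum, Finsupp.sum_mul]
  refine Finsupp.sum_congr fun t _ => ?_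
  rw [mul_smul_comm, smul_mul_assoc, T_mul_zk, T_zk_mul]
  congr 2
  ext
  simp [Datum.zin, MulAut.conjNormal_apply]

/-- The anti-automorphism `ζ` of `H_J`, `ζ(T_w) = T_{w⁻¹}`. -/
def zeta (J : Set b.support) : p.Hecke J →ₐ[C] (p.Hecke J)ᵐᵒᵖ :=
  p.lift J (fun w => op (p.T J w⁻¹)) (by rw [inv_one, T_one, op_one])
    (fun v w h => by
      rw [← op_mul, mul_inv_rev, T_braid]
      rw [← mul_inv_rev]
      change D.len J ((v * w : D.lev J) : W1)⁻¹ = D.len J (w : W1)⁻¹ + D.len J (v : W1)⁻¹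
      rw [D.len_inv (v * w).2, D.len_inv v.2, D.len_inv w.2, h, add_comm])
    (fun s hs => by
      have hs' : D.IsSimple J (s⁻¹ : D.lev J) := D.isSimple_inv s.2 hs
      have hq : ((s⁻¹ : D.lev J) : W1 ⧸ D.Zk) = (s : W1) := D.refl_inv hs.1
      have hz : zlin (fun t => op (p.T J (D.zin J t)⁻¹)) (p.c s) =
          op (p.cT J (s⁻¹ : D.lev J)) := by
        have hc : p.c ((s⁻¹ : D.lev J) : W1) = _ := p.c_inv s (D.refl_univ hs.1)
        rw [cT, hc, zlin_mapDomain, zlin, zlin, Finsupp.sum, Finsupp.sum, ← opAddEquiv_apply, map_sum]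
        rfl
      rw [← op_mul, p.T_quad J _ hs', hz, hq, ← op_mul, p.cT_comm J _ hs', mul_inv_rev, op_add,
        op_smul])

theorem zeta_T (J : Set b.support) (w : D.lev J) : p.zeta J (p.T J w) = op (p.T J w⁻¹) :=
  p.lift_T J _ _ _ _ w

/-! ### The twist by `n = n_{w_G w_P}` -/

/-- `n = n_{w_G w_P} ∈ W(1)`. -/
def _root_.ProPIwahori.Datum.nGP (D : Datum b W1) (J : Set b.support) : W1 :=
  D.n ⟨wGP b J, wGP_mem b J⟩

theorem _root_.ProPIwahori.Datum.act1_nGP (D : Datum b W1) (J : Set b.support) :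
    D.act1 (D.nGP J) = (wGP b J).toAffineEquiv := by
  change D.act ((D.nGP J : W1) : W1 ⧸ D.Zk) = _
  rw [Datum.nGP, D.n_spec, D.act_aff]

theorem _root_.ProPIwahori.Datum.conj_mem (D : Datum b W1) (J : Set b.support)
    (w : D.lev (opp b J)) : (D.nGP J)⁻¹ * w * D.nGP J ∈ D.lev J := by
  have hn : D.proj (D.nGP J) = wGP b J := by
    change AffineEquiv.linearHom (D.act1 (D.nGP J)) = _
    rw [D.act1_nGP]
    rfl
  change D.proj _ ∈ finWeyl b J
  rw [map_mul, map_mul, map_inv, hn]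
  exact wGP_conj_mem b w.2

/-- The map `w ↦ n⁻¹ w n` from `W_{P'}(1)` to `W_P(1)`. -/
def _root_.ProPIwahori.Datum.conj (D : Datum b W1) (J : Set b.support)
    (w : D.lev (opp b J)) : D.lev J := ⟨(D.nGP J)⁻¹ * w * D.nGP J, D.conj_mem J w⟩

theorem _root_.ProPIwahori.Datum.len_conj (D : Datum b W1) (J : Set b.support)
    (w : D.lev (opp b J)) : D.len J (D.conj J w) = D.len (opp b J) w := by
  unfold Datum.len
  rw [← affLen_conj]
  congr 1
  change _ * D.act1 ((D.nGP J)⁻¹ * w * D.nGP J) * _ = _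
  rw [map_mul, map_mul, map_inv, D.act1_nGP]
  group

theorem _root_.ProPIwahori.Datum.conj_isSimple (D : Datum b W1) (J : Set b.support)
    (s : D.lev (opp b J)) (hs : D.IsSimple (opp b J) s) : D.IsSimple J (D.conj J s) := by
  refine ⟨?_, by rw [D.len_conj]; exact hs.2⟩
  obtain ⟨j, hj, k, e⟩ := hs.1
  obtain ⟨i, hi⟩ := (exists_mapsRoot b (wGP_mem b J)).2 j
  refine ⟨i, (wGP_mem_levRoots b hi).2 hj, k, ?_⟩
  change (((D.nGP J)⁻¹ * s * D.nGP J : W1) : W1 ⧸ D.Zk) = _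
  have hn : ((D.nGP J : W1) : W1 ⧸ D.Zk) = D.aff ⟨_, toAffineEquiv_mem b (wGP_mem b J)⟩ :=
    D.n_spec _
  rw [QuotientGroup.mk_mul, QuotientGroup.mk_mul, QuotientGroup.mk_inv, e, hn, ← map_inv,
    ← map_mul, ← map_mul]
  congr 1
  ext1
  change (wGP b J).toAffineEquiv⁻¹ * affRefl R j k * (wGP b J).toAffineEquiv = affRefl R i k
  rw [← conj_affRefl hi k]
  group

/-- The homomorphism `H_{P'} → H_P`, `T_w ↦ T_{n⁻¹ w n}`. -/
def conjHom (J : Set b.support) : p.Hecke (opp b J) →ₐ[C] p.Hecke J :=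
  p.lift (opp b J) (fun w => p.T J (D.conj J w))
    (by
      have : D.conj J 1 = 1 := by ext; simp [Datum.conj]
      rw [this, T_one])
    (fun v w h => by
      have e : D.conj J (v * w) = D.conj J v * D.conj J w := by
        ext; simp [Datum.conj, mul_assoc]
      rw [e, T_braid]
      rw [← e, D.len_conj, D.len_conj, D.len_conj, h])
    (fun s hs => by
      have e : D.conj J (s * s) = D.conj J s * D.conj J s := by
        ext; simp [Datum.conj, mul_assoc]
      rw [p.T_quad J _ (D.conj_isSimple J s hs), e]
      have hs1 : ((s : W1) : W1 ⧸ D.Zk) ∈ D.refl Set.univ := D.refl_univ hs.1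
      congr 2
      · have := p.q_conj _ hs1 (((D.nGP J)⁻¹ : W1) : W1 ⧸ D.Zk)
        rw [← this]
        simp [Datum.conj]
      · have hc := p.c_conj s hs1 (D.nGP J)⁻¹
        rw [inv_inv] at hc
        change p.c (D.conj J s : W1) = _ at hc
        rw [cT, hc, zlin_mapDomain]
        congr 1
        funext t
        congr 1
        ext
        simp [Datum.conj, Datum.zin])

theorem conjHom_T (J : Set b.support) (w : D.lev (opp b J)) :
    p.conjHom J (p.T (opp b J) w) = p.T J (D.conj J w) :=
  p.lift_T _ _ _ _ _ w

/-! ### Parabolic induction -/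

section Induction

variable {V : Type*} [AddCommMonoid V] [Module C V]

/-- The inclusion `W_J(1) ⊆ W(1)`. -/
def _root_.ProPIwahori.Datum.incl (D : Datum b W1) (J : Set b.support) (w : D.lev J) :
    D.lev Set.univ := ⟨w, D.lev_le J w.2⟩

/-- The set `W_J^-(1)` of `J`-negative elements of `W_J(1)`. -/
def _root_.ProPIwahori.Datum.negSet (D : Datum b W1) (J : Set b.support) : Set (D.lev J) :=
  {w | D.IsNeg J w}

/-- The parabolic induction `I_P(σ) = Hom_{(H_P^-, j_P^{-*})}(H, σ)`, where `H_P^-` has the basis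
`T_w^{P*}` and `j_P^{-*}(T_w^{P*}) = T_w^*` (`w ∈ W_P^-(1)`). -/
def ind (J : Set b.support) (σ : RightMod C (p.Hecke J) V) :=
  coindMod (fun w : D.negSet J => p.Tstar J w)
    (fun w : D.negSet J => p.Tstar Set.univ (D.incl J w)) σ

/-- The induction `I'_P(σ) = Hom_{(H_P^-, j_P^-)}(H, σ)`, where `H_P^-` has the basis `T_w^P`
and `j_P^-(T_w^P) = T_w` (`w ∈ W_P^-(1)`). -/
def ind' (J : Set b.support) (σ : RightMod C (p.Hecke J) V) :=
  coindMod (fun w : D.negSet J => p.T J w)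
    (fun w : D.negSet J => p.T Set.univ (D.incl J w)) σ

/-- The dual of an `H_J`-module. -/
def dual (J : Set b.support) (σ : RightMod C (p.Hecke J) V) : RightMod C (p.Hecke J) (Dual C V) :=
  RightMod.dual (p.zeta J) σ

/-- The `H_{P'}`-module `n_{w_G w_P} σ`, on which `T_w` acts as `T_{n⁻¹ w n}` acts on `σ`. -/
def twist (J : Set b.support) (σ : RightMod C (p.Hecke J) V) :
    RightMod C (p.Hecke (opp b J)) V :=
  RightMod.pullback (p.conjHom J) σ

end Induction

end Param

end Data

end ProPIwahori

/-!
The duality rests on an explicit description of the induced module `I'_P(σ)`. There is a linear map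
`x ↦ φ_x` from `σ` to `I'_P(σ)` (`phi`), where `φ_x` is supported on the coset of `n = n_{w_G w_P}`,
and the isomorphism from the dual of `I'_P(σ)` to `I_{P'}(n σ^*)` is `f ↦ ψ_f`,
`ψ_f(Y)(x) = f(φ_x ζ(Y))` (`dualMap`).

*Hecke algebras.* The operators of left and right multiplication by simple elements on `C[W_P(1)]`
commute (`opL_opR_comm`), which yields the regular representation on `C[W_P(1)]` (`rep`); an element
of the algebra is determined by its value at the unit vector (`theta_rep_one`). If the parameters
`q` are not zero divisors, the elements `T_w^*` are independent of the reduced decomposition,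
because `T_{w⁻¹} T_w^*` is a scalar. In general, one passes to the parameters `q + X` over `C[X]`
and specializes (`word_unique`). It follows that `T_w ↦ T_w^*` is an isomorphism from the Hecke
algebra with parameters `(q, -c)` to the one with parameters `(q, c)`, which exchanges the `T_w` and
the `T_w^*` and is compatible with the anti-automorphism `ζ` and with the twist by `n`
(`kappaEquiv`, `zeta_kappa`, `conjHom_kappa`). Hence the first isomorphism for `(q, c)` is the
second one for `(q, -c)`.

*The induced module.* Let `μ` be a translation orthogonal to `Σ_P` and positive on the other positive
roots. For `h` in the Hecke algebra and a vector `v` of `C[W(1)]`, the vectors `h (v μ^r) μ^{-r}`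
do not depend on `r` if `r` is large. This defines a limit action of the Hecke algebra on `C[W(1)]`
(`Param.star`), in which the multiplication rule for `T_s` is governed by the sign of the simple
affine root far out in the direction of `μ`. A linear map `Φ : C[W(1)] → σ` with
`Φ(d x) = Φ(d) T_x`, for `d` minimal in its coset and `x ∈ W_P(1)`, remains of this kind when it is
composed with the limit action (`IsEquivariant.comp_star`), and therefore gives the element
`h ↦ Φ(h ⋆ 1)` of `I'_P(σ)` (`toInd`). Conversely, an element `φ` of `I'_P(σ)` is determined by the
values `φ(T_d)` at minimal representatives `d` of the finitely many cosets of `W_P(1)`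
(`coind_ext`).

*Walks.* For `z ∈ W(1)`, let `Φ_z` be the equivariant map supported on the coset of `z⁻¹` with
`Φ_z(d) = x T_{z d}^{P*}` (`walk`), so that `φ_x` comes from `Φ_{n⁻¹}`. Composing with the limit
action of `T_s^*` replaces `z` by `z s`, provided that the step from `z` to `z s` crosses a wall of
`Σ_P` away from the fundamental alcove, or another wall in the direction opposite to `μ`
(`walk_comp_star_of_mem`, `walk_comp_star_of_notMem`). Starting from `n⁻¹`, which turns the positive
roots outside `Σ_{P'}` into negative ones, all steps of a reduced decomposition of `w` are of this
kind if `w⁻¹ ∈ W_{P'}^-(1)` or if `w` fixes the origin (`walk_nGP_comp_star`). The first case says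
that `φ_x T_w^* = φ_{x T^{P*}_{n⁻¹ w n}}`, i.e. that `ψ_f` lies in `I_{P'}(n σ^*)`. The second case
with `w = n d⁻¹` says that `φ_x T_w^*` takes the value `x` at `T_d` and vanishes at the other
`T_{d'}`. So `φ = ∑_d φ_{φ(T_d)} T_{n d⁻¹}^*` for `φ ∈ I'_P(σ)` (`eq_sum_phi`), which makes
`f ↦ ψ_f` injective, and `f(φ) = ∑_d ψ(T_{d n⁻¹}^*)(φ(T_d))` is a preimage of `ψ ∈ I_{P'}(n σ^*)`.
-/

open Module MulOpposite

noncomputable section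

namespace ProPIwahori

set_option linter.unusedSectionVars false

/-! ### Affine roots and lengths -/

section AffineRoots

variable {ι M N : Type*} [AddCommGroup M] [Module ℝ M] [AddCommGroup N] [Module ℝ N]
  [Finite ι] {R : RootPairing ι ℝ M N} [R.IsCrystallographic] [R.IsReduced] (b : R.Base)

theorem root'_neg (i : ι) : R.root' (R.reflectionPerm i i) = -R.root' i := by
  simp [RootPairing.root', RootPairing.root_reflectionPerm]

theorem root'_injective : Function.Injective R.root' := fun _ _ h =>
  R.root.injective (R.toPerfPair.injective h)

variable (R) in
/-- The affine function `x ↦ α_i(x) + k` on the apartment. -/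
def affRoot (i : ι) (k : ℤ) (x : N) : ℝ := R.root' i x + k

/-- The affine roots whose gradient lies in `Σ_J`. -/
def affRoots (J : Set b.support) : Set (N → ℝ) :=
  {f | ∃ i ∈ levRoots b J, ∃ k : ℤ, f = affRoot R i k}

/-- The affine roots of `Σ_J` which are positive at `y` and negative at `z`. -/
def sep (J : Set b.support) (y z : N) : Set (N → ℝ) := {f | f ∈ affRoots b J ∧ 0 < f y ∧ f z < 0}

/-- No affine root vanishes at `y`. -/
def Regular (y : N) : Prop := ∀ f ∈ affRoots b Set.univ, f y ≠ 0

variable {b}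

theorem affRoot_mem {J : Set b.support} {i : ι} (hi : i ∈ levRoots b J) (k : ℤ) :
    affRoot R i k ∈ affRoots b J := ⟨i, hi, k, rfl⟩

theorem affRoot_inj {i j : ι} {k l : ℤ} (h : affRoot R i k = affRoot R j l) : i = j ∧ k = l := by
  have h0 := congrFun h 0
  simp only [affRoot, map_zero, zero_add, Int.cast_inj] at h0
  subst h0
  refine ⟨root'_injective (R := R) (LinearMap.ext fun x => ?_), rfl⟩
  simpa [affRoot] using congrFun h x

theorem affRoot_mem_iff {J : Set b.support} {i : ι} {k : ℤ} :
    affRoot R i k ∈ affRoots b J ↔ i ∈ levRoots b J :=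
  ⟨fun ⟨_, hj, _, e⟩ => (affRoot_inj e).1 ▸ hj, fun h => affRoot_mem h k⟩

theorem affRoot_neg (i : ι) (k : ℤ) : affRoot R (R.reflectionPerm i i) (-k) = -affRoot R i k := by
  funext x
  simp [affRoot, root'_neg]
  ring

theorem neg_mem_affRoots {J : Set b.support} {f : N → ℝ} (hf : f ∈ affRoots b J) :
    -f ∈ affRoots b J := by
  obtain ⟨i, hi, k, rfl⟩ := hf
  rw [← affRoot_neg]
  exact affRoot_mem (neg_mem_levRoots b hi) _

theorem levRoots_mono {J K : Set b.support} (h : J ⊆ K) : levRoots b J ⊆ levRoots b K :=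
  fun _ hi => (Submodule.span_mono fun _ ⟨j, hj, e⟩ => ⟨j, h hj, e⟩ :
    rootSpan b J ≤ rootSpan b K) hi

theorem affRoots_mono {J K : Set b.support} (h : J ⊆ K) : affRoots b J ⊆ affRoots b K :=
  fun _ ⟨i, hi, k, e⟩ => ⟨i, levRoots_mono h hi, k, e⟩

theorem affRoots_univ {J : Set b.support} {f : N → ℝ} (hf : f ∈ affRoots b J) :
    f ∈ affRoots b Set.univ := affRoots_mono (Set.subset_univ J) hf

theorem Regular.pos_or_neg {y : N} (hy : Regular b y) {J : Set b.support} {f : N → ℝ}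
    (hf : f ∈ affRoots b J) : 0 < f y ∨ f y < 0 :=
  (lt_or_gt_of_ne (hy f (affRoots_univ hf))).symm

theorem Regular.not_pos {y : N} (hy : Regular b y) {J : Set b.support} {f : N → ℝ}
    (hf : f ∈ affRoots b J) : ¬ 0 < f y ↔ f y < 0 :=
  ⟨fun h => (hy.pos_or_neg hf).resolve_left h, fun h h' => lt_asymm h h'⟩

theorem sep_finite (J : Set b.support) (y z : N) : (sep b J y z).Finite := by
  have : sep b J y z ⊆ ⋃ i : ι, (fun k => affRoot R i k) ''
      Set.Icc ⌊-R.root' i y⌋ ⌈-R.root' i z⌉ := by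
    rintro _ ⟨⟨i, -, k, rfl⟩, h1, h2⟩
    refine Set.mem_iUnion.2 ⟨i, k, ⟨?_, ?_⟩, rfl⟩
    · refine Int.floor_le_iff.2 ?_
      simp only [affRoot] at h1
      linarith
    · refine Int.le_ceil_iff.2 ?_
      simp only [affRoot] at h2
      linarith
  exact (Set.finite_iUnion fun i => (Set.finite_Icc _ _).image _).subset this

theorem mem_alcove_pos_iff {J : Set b.support} {x : N} (hx : x ∈ alcove b J) {i : ι}
    (hi : i ∈ levRoots b J) (k : ℤ) :
    (b.IsPos i → (0 < affRoot R i k x ↔ 0 ≤ k) ∧ (affRoot R i k x < 0 ↔ k < 0)) ∧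
    (¬ b.IsPos i → (0 < affRoot R i k x ↔ 1 ≤ k) ∧ (affRoot R i k x < 0 ↔ k < 1)) := by
  have key : ∀ i ∈ levRoots b J, b.IsPos i → ∀ k : ℤ,
      (0 < affRoot R i k x ↔ 0 ≤ k) ∧ (affRoot R i k x < 0 ↔ k < 0) := by
    intro i hi hp k
    obtain ⟨h0, h1⟩ := hx i hi hp
    have a1 : 0 ≤ k → 0 < affRoot R i k x := fun h => by
      have : (0 : ℝ) ≤ k := by exact_mod_cast h
      simp only [affRoot]; linarith
    have a2 : k < 0 → affRoot R i k x < 0 := fun h => by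
      have : (k : ℝ) ≤ -1 := by exact_mod_cast (by lia : k ≤ -1)
      simp only [affRoot]; linarith
    refine ⟨⟨fun h => ?_, a1⟩, ⟨fun h => ?_, a2⟩⟩
    · by_contra hk
      exact lt_asymm h (a2 (not_le.1 hk))
    · by_contra hk
      exact lt_asymm h (a1 (not_lt.1 hk))
  refine ⟨fun hp => key i hi hp k, fun hp => ?_⟩
  rw [← isPos_neg_iff] at hp
  obtain ⟨h1, h2⟩ := key _ (neg_mem_levRoots b hi) hp (-k)
  rw [affRoot_neg] at h1 h2
  simp only [Pi.neg_apply, Left.neg_pos_iff, Left.neg_neg_iff] at h1 h2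
  rw [h1, h2]
  constructor <;> constructor <;> intro h <;> lia

variable (b) in
/-- A point of the fundamental alcove of `Σ`. -/
def basePoint : N := (alcove_nonempty b Set.univ).choose

theorem alcove_anti {J K : Set b.support} (h : J ⊆ K) : alcove b K ⊆ alcove b J :=
  fun _ hx i hi hp => hx i (levRoots_mono h hi) hp

variable (b) in
theorem basePoint_mem (J : Set b.support) : basePoint b ∈ alcove b J :=
  alcove_anti (Set.subset_univ J) (alcove_nonempty b Set.univ).choose_spec

theorem mem_alcove_ne_zero {J : Set b.support} {x : N} (hx : x ∈ alcove b J) {f : N → ℝ}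
    (hf : f ∈ affRoots b J) : f x ≠ 0 := by
  obtain ⟨i, hi, k, rfl⟩ := hf
  intro h0
  obtain ⟨h1, h2⟩ := mem_alcove_pos_iff hx hi k
  by_cases hp : b.IsPos i
  · obtain ⟨h1, h3⟩ := h1 hp
    rw [h0] at h1 h3
    simp only [lt_irrefl, false_iff] at h1 h3
    lia
  · obtain ⟨h1, h3⟩ := h2 hp
    rw [h0] at h1 h3
    simp only [lt_irrefl, false_iff] at h1 h3
    lia

/-- An affine root of `Σ_J` has constant sign on the fundamental alcove of `Σ_J`. -/
theorem alcove_sign {J : Set b.support} {x y : N} (hx : x ∈ alcove b J) (hy : y ∈ alcove b J)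
    {f : N → ℝ} (hf : f ∈ affRoots b J) : 0 < f x ↔ 0 < f y := by
  obtain ⟨i, hi, k, rfl⟩ := hf
  by_cases hp : b.IsPos i
  · rw [((mem_alcove_pos_iff hx hi k).1 hp).1, ((mem_alcove_pos_iff hy hi k).1 hp).1]
  · rw [((mem_alcove_pos_iff hx hi k).2 hp).1, ((mem_alcove_pos_iff hy hi k).2 hp).1]

variable (b) in
theorem basePoint_regular : Regular b (basePoint b) := fun _ hf =>
  mem_alcove_ne_zero (basePoint_mem b Set.univ) hf

theorem affRoot_convex (f : N → ℝ) {J : Set b.support} (hf : f ∈ affRoots b J) {s t : ℝ} (x y : N)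
    (h : s + t = 1) : f (s • x + t • y) = s * f x + t * f y := by
  obtain ⟨i, -, k, rfl⟩ := hf
  simp only [affRoot, map_add, map_smul, smul_eq_mul]
  linear_combination (-(k : ℝ)) * h

/-- The length of an affine transformation preserving the affine roots of `Σ_J` counts the affine
roots of `Σ_J` separating the base point from its image. -/
theorem affLen_eq_ncard_sep (J : Set b.support) (g : N ≃ᵃ[ℝ] N)
    (hg : ∀ f ∈ affRoots b J, f ∘ g ∈ affRoots b J) :
    affLen b J g = (sep b J (basePoint b) (g (basePoint b))).ncard := by
  set x0 := basePoint b
  have hx0 : x0 ∈ alcove b J := basePoint_mem b J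
  have hne : ∀ f ∈ affRoots b J, f (g x0) ≠ 0 := fun f hf => mem_alcove_ne_zero hx0 (hg f hf)
  have hinj : Set.InjOn (fun f : N → ℝ => {x | f x = 0}) (sep b J x0 (g x0)) := by
    rintro _ ⟨⟨i, hi, k, rfl⟩, hk, -⟩ _ ⟨⟨j, hj, l, rfl⟩, hl, -⟩ e
    simp only at e
    have hs : ∀ x, affRoot R i k x = 0 ↔ affRoot R j l x = 0 := fun x => Set.ext_iff.1 e x
    set p : N := (-(k : ℝ) / 2) • R.coroot i with hp
    have hpi : R.root' i p = -k := by
      rw [hp, map_smul, RootPairing.root'_coroot_eq_pairing, RootPairing.pairing_same]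
      simp
    have hpl : affRoot R j l p = 0 := (hs p).1 (by simp [affRoot, hpi])
    have hker : ∀ x, R.root' i x = 0 → R.root' j x = 0 := fun x hx => by
      have h1 : affRoot R j l (p + x) = 0 := (hs _).1 (by simp [affRoot, hpi, hx])
      simp only [affRoot, map_add] at h1 hpl
      linarith
    have hdep : R.root' j = (R.root' j (R.coroot i) / 2) • R.root' i := by
      ext x
      have := hker (x - (R.root' i x / 2) • R.coroot i) (by
        rw [map_sub, map_smul, RootPairing.root'_coroot_eq_pairing, RootPairing.pairing_same]
        simp)
      rw [map_sub, map_smul, smul_eq_mul] at this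
      rw [LinearMap.smul_apply, smul_eq_mul]
      linarith
    have hroot : R.root j = (R.root' j (R.coroot i) / 2) • R.root i := by
      apply R.toPerfPair.injective
      rw [map_smul]
      exact hdep
    have hli : ¬ LinearIndependent ℝ ![R.root j, R.root i] := by
      rw [LinearIndependent.pair_iff]
      intro h
      have := (h 1 (-(R.root' j (R.coroot i) / 2)) (by
        rw [one_smul, neg_smul, ← hroot, add_neg_cancel])).1
      exact one_ne_zero this
    rcases RootPairing.IsReduced.eq_or_eq_neg j i hli with h | h
    · obtain rfl := R.root.injective h
      simp only [affRoot, hpi] at hpl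
      have : k = l := by
        have : (k : ℝ) = l := by linarith
        exact_mod_cast this
      rw [this]
    · exfalso
      have hij : j = R.reflectionPerm i i := R.root.injective (by
        rw [h, RootPairing.root_reflectionPerm, RootPairing.reflection_apply_self])
      subst hij
      have : l = -k := by
        simp only [affRoot, root'_neg, LinearMap.neg_apply, hpi] at hpl
        have : (l : ℝ) = -k := by linarith
        exact_mod_cast this
      rw [this, affRoot_neg] at hl
      simp only [Pi.neg_apply] at hl
      linarith
  rw [affLen, ← hinj.ncard_image]
  congr 1
  have hseg : ∀ f ∈ affRoots b J, (Separates {x | f x = 0} (alcove b J) (g '' alcove b J) ↔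
      ¬ (0 < f x0 ↔ 0 < f (g x0))) := by
    intro f hf
    constructor
    · intro hS hsame
      obtain ⟨z, ⟨s, t, hs, ht, hst, rfl⟩, hz⟩ := hS x0 hx0 _ ⟨x0, hx0, rfl⟩
      rw [Set.mem_ofPred_eq, affRoot_convex f hf _ _ hst] at hz
      have h1 : f x0 ≠ 0 := mem_alcove_ne_zero hx0 hf
      have h2 := hne f hf
      rcases lt_or_gt_of_ne h1 with h1 | h1
      · have h2 : f (g x0) < 0 :=
          lt_of_le_of_ne (not_lt.1 fun h => lt_asymm h1 (hsame.2 h)) h2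
        rcases eq_or_lt_of_le hs with rfl | hs
        · have : t = 1 := by linarith
          subst this; linarith
        · nlinarith [mul_neg_of_pos_of_neg hs h1]
      · have h2 := hsame.1 h1
        rcases eq_or_lt_of_le hs with rfl | hs
        · have : t = 1 := by linarith
          subst this; linarith
        · nlinarith [mul_pos hs h1]
    · rintro hdiff x hx _ ⟨y, hy, rfl⟩
      have hx1 := alcove_sign hx hx0 hf
      have hy1 : 0 < f (g y) ↔ 0 < f (g x0) := alcove_sign hy hx0 (hg f hf)
      rw [← hx1, ← hy1] at hdiff
      have n1 : f x ≠ 0 := mem_alcove_ne_zero hx hf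
      have n2 : f (g y) ≠ 0 := mem_alcove_ne_zero hy (hg f hf)
      have hprod : f x * f (g y) < 0 := by
        rcases lt_or_gt_of_ne n1 with h1 | h1 <;> rcases lt_or_gt_of_ne n2 with h2 | h2
        · exact absurd (by constructor <;> intro h <;> linarith) hdiff
        · exact mul_neg_of_neg_of_pos h1 h2
        · exact mul_neg_of_pos_of_neg h1 h2
        · exact absurd (by constructor <;> intro h <;> linarith) hdiff
      have hd : f x - f (g y) ≠ 0 := by
        intro h
        have : f x = f (g y) := by linarith
        rw [this] at hprod
        nlinarith [mul_self_nonneg (f (g y))]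
      have hst : -f (g y) / (f x - f (g y)) + f x / (f x - f (g y)) = 1 := by
        field_simp; ring
      have hq : ∀ u : ℝ, 0 ≤ u * (f x - f (g y)) → 0 ≤ u / (f x - f (g y)) := fun u hu => by
        have : u / (f x - f (g y)) = u * (f x - f (g y)) / (f x - f (g y)) ^ 2 := by
          field_simp
        rw [this]
        positivity
      refine ⟨_, ⟨-f (g y) / (f x - f (g y)), f x / (f x - f (g y)), hq _ ?_, hq _ ?_, hst, rfl⟩, ?_⟩
      · nlinarith [mul_self_nonneg (f (g y))]
      · nlinarith [mul_self_nonneg (f x)]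
      · rw [Set.mem_ofPred_eq, affRoot_convex f hf _ _ hst]
        field_simp; ring
  ext H
  constructor
  · rintro ⟨⟨i, hi, k, rfl⟩, hS⟩
    have hH : hyperplane R i k = {x | affRoot R i (-k) x = 0} := by
      ext x
      simp only [hyperplane, affRoot, Set.mem_ofPred_eq]
      push_cast
      constructor <;> intro h <;> linarith
    have hf : affRoot R i (-k) ∈ affRoots b J := affRoot_mem hi _
    rw [hH, hseg _ hf] at hS
    rw [hH]
    have n1 := mem_alcove_ne_zero hx0 hf
    have n2 := hne _ hf
    rcases lt_or_gt_of_ne n1 with h1 | h1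
    · refine ⟨-affRoot R i (-k), ⟨neg_mem_affRoots hf, by simpa using h1, ?_⟩, by simp⟩
      rw [Pi.neg_apply, neg_lt_zero]
      rcases lt_or_gt_of_ne n2 with h2 | h2
      · exact absurd (by constructor <;> intro h <;> linarith) hS
      · exact h2
    · refine ⟨affRoot R i (-k), ⟨hf, h1, ?_⟩, rfl⟩
      rcases lt_or_gt_of_ne n2 with h2 | h2
      · exact h2
      · exact absurd (by constructor <;> intro h <;> linarith) hS
  · rintro ⟨f, ⟨hf, h1, h2⟩, rfl⟩
    refine ⟨?_, (hseg f hf).2 fun h => lt_asymm h2 (h.1 h1)⟩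
    obtain ⟨i, hi, k, rfl⟩ := hf
    refine ⟨i, hi, -k, ?_⟩
    ext x
    simp only [hyperplane, affRoot, Set.mem_ofPred_eq]
    push_cast
    constructor <;> intro h <;> linarith

end AffineRoots

/-! ### Finite root combinatorics -/

section FiniteRoots

variable {ι M N : Type*} [AddCommGroup M] [Module ℝ M] [AddCommGroup N] [Module ℝ N]
  [Finite ι] {R : RootPairing ι ℝ M N} [R.IsCrystallographic] [R.IsReduced] {b : R.Base}

theorem root'_reflectionPerm (i j : ι) :
    R.root' (R.reflectionPerm i j) = R.root' j - R.pairing j i • R.root' i := by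
  simp only [RootPairing.root', RootPairing.root_reflectionPerm, RootPairing.reflection_apply,
    map_sub, map_smul]
  congr 2

theorem reflectionPerm_mem_levRoots {J : Set b.support} {i j : ι} (hi : i ∈ levRoots b J)
    (hj : j ∈ levRoots b J) : R.reflectionPerm i j ∈ levRoots b J := by
  change R.root' _ ∈ rootSpan b J
  rw [root'_reflectionPerm]
  exact sub_mem hj (Submodule.smul_mem _ _ hi)

theorem affRoot_comp_affRefl (i j : ι) (k l : ℤ) :
    affRoot R j l ∘ affRefl R i k =
      affRoot R (R.reflectionPerm i j) (l + k * R.pairingIn ℤ j i) := by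
  funext x
  simp only [Function.comp_apply, affRoot, affRefl_apply, root'_reflectionPerm, map_sub, map_smul,
    RootPairing.root'_coroot_eq_pairing, LinearMap.sub_apply, LinearMap.smul_apply, smul_eq_mul]
  have : (R.pairingIn ℤ j i : ℝ) = R.pairing j i := R.algebraMap_pairingIn ℤ j i
  push_cast
  rw [this]
  ring

theorem comp_affRefl_mem {J : Set b.support} {i : ι} (hi : i ∈ levRoots b J) (k : ℤ) {f : N → ℝ}
    (hf : f ∈ affRoots b J) : f ∘ affRefl R i k ∈ affRoots b J := by
  obtain ⟨j, hj, l, rfl⟩ := hf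
  rw [affRoot_comp_affRefl]
  exact affRoot_mem (reflectionPerm_mem_levRoots hi hj) _

theorem affRoot_comp_affRefl_self (i : ι) (k : ℤ) :
    affRoot R i k ∘ affRefl R i (-k) = -affRoot R i k := by
  rw [affRoot_comp_affRefl, ← affRoot_neg]
  congr 1
  simp
  ring

/-- If some affine root of `Σ_J` is positive at the base point and negative at `y`, then so is a
simple one, i.e. one whose reflection makes only this affine root negative at the base point.
It is found by minimizing the value at the base point: a positive affine root which is not simple
is a sum of two positive ones, or is parallel to a smaller one. -/
theorem exists_simple_mem_sep {J : Set b.support} {y : N}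
    (hne : (sep b J (basePoint b) y).Nonempty) :
    ∃ i ∈ levRoots b J, ∃ k : ℤ, affRoot R i k ∈ sep b J (basePoint b) y ∧
      sep b J (basePoint b) (affRefl R i (-k) (basePoint b)) = {affRoot R i k} := by
  set x0 := basePoint b
  have hreg : Regular b x0 := basePoint_regular b
  obtain ⟨a, ha, hmin⟩ := (sep_finite J x0 y).exists_minimalFor (fun f => f x0) _ hne
  replace hmin : ∀ g ∈ sep b J x0 y, a x0 ≤ g x0 := fun g hg => by
    by_contra h
    exact h (hmin hg (le_of_lt (not_le.1 h)))
  have ha' := ha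
  obtain ⟨⟨i, hi, k, rfl⟩, h0, hy⟩ := ha'
  set a := affRoot R i k with hadef
  refine ⟨i, hi, k, ha, ?_⟩
  have hself : a ∘ affRefl R i (-k) = -a := affRoot_comp_affRefl_self i k
  -- a sum of two positive affine roots cannot minimize the value at the base point
  have split : ∀ g ∈ affRoots b J, ∀ h ∈ affRoots b J, 0 < g x0 → 0 < h x0 → a ≠ g + h := by
    intro g hg h hh g0 h0' e
    have e0 : a x0 = g x0 + h x0 := congrFun e x0
    have ey : a y = g y + h y := congrFun e y
    rcases lt_or_ge (g y) 0 with gy | gy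
    · have := hmin g ⟨hg, g0, gy⟩
      linarith
    · have := hmin h ⟨hh, h0', by linarith⟩
      linarith
  ext f
  simp only [Set.mem_singleton_iff]
  constructor
  swap
  · rintro rfl
    refine ⟨ha.1, h0, ?_⟩
    have := congrFun hself x0
    simp only [Function.comp_apply, Pi.neg_apply] at this
    linarith
  rintro ⟨⟨j, hj, l, rfl⟩, hf0, hfs⟩
  set f := affRoot R j l with hf
  have hfJ : f ∈ affRoots b J := affRoot_mem hj l
  set m : ℤ := R.pairingIn ℤ j i with hm
  have hmR : (m : ℝ) = R.pairing j i := R.algebraMap_pairingIn ℤ j i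
  have hcomp : ∀ x, f (affRefl R i (-k) x) = f x - m * a x := fun x => by
    simp only [hf, hadef, affRoot, affRefl_apply, map_sub, map_smul,
      RootPairing.root'_coroot_eq_pairing, smul_eq_mul, hmR]
    push_cast
    ring
  set c : N → ℝ := -(f ∘ affRefl R i (-k)) with hc
  have hcx : ∀ x, c x = m * a x - f x := fun x => by simp [hc, hcomp]
  have hcJ : c ∈ affRoots b J := neg_mem_affRoots (comp_affRefl_mem hi _ hfJ)
  have hc0 : 0 < c x0 := by simp [hc]; exact hfs
  have hmpos : 0 < m := by
    have h1 := hcx x0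
    have : 0 < (m : ℝ) * a x0 := by linarith
    have := pos_of_mul_pos_left this h0.le
    exact_mod_cast this
  by_cases hij : j = i
  · subst hij
    have hm2 : m = 2 := by simp [hm]
    have hfa : ∀ x, f x = a x + (l - k : ℤ) := fun x => by
      simp only [hf, hadef, affRoot]; push_cast; ring
    rcases lt_trichotomy k l with h | h | h
    · exfalso
      have hlk : (0 : ℝ) < (l - k : ℤ) := by exact_mod_cast (by lia : 0 < l - k)
      have e0 := hcx x0
      have ey := hcx y
      rw [hfa, hm2] at e0 ey
      push_cast at e0 ey hlk
      have := hmin c ⟨hcJ, hc0, by linarith⟩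
      linarith
    · rw [hf, ← h]
    · exfalso
      have hlk : ((l - k : ℤ) : ℝ) < 0 := by exact_mod_cast (by lia : l - k < 0)
      have e0 := hfa x0
      have ey := hfa y
      have := hmin f ⟨hfJ, hf0, by linarith⟩
      linarith
  exfalso
  obtain ⟨e, he⟩ := R.root_sub_root_mem_of_pairingIn_pos hmpos hij
  have he' : R.root' e = R.root' j - R.root' i := by
    simp only [RootPairing.root', he, map_sub]
  have hd : f - a ∈ affRoots b J := by
    refine ⟨e, ?_, l - k, ?_⟩
    · change R.root' e ∈ rootSpan b J
      rw [he']
      exact sub_mem hj hi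
    · funext x
      simp only [hf, hadef, affRoot, Pi.sub_apply, he', LinearMap.sub_apply]
      push_cast; ring
  have hd' : c - a ∈ affRoots b J := by
    have : c - a = -((f - a) ∘ affRefl R i (-k)) := by
      funext x
      have := congrFun hself x
      simp only [Function.comp_apply, Pi.neg_apply] at this
      simp [hc, this]
      ring
    rw [this]
    exact neg_mem_affRoots (comp_affRefl_mem hi _ hd)
  rcases hreg.pos_or_neg hd with p1 | n1
  swap
  · refine split f hfJ (-(f - a)) (neg_mem_affRoots hd) hf0 ?_ ?_
    · rw [Pi.neg_apply]; linarith
    · funext x; simp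
  rcases hreg.pos_or_neg hd' with p2 | n2
  swap
  · refine split c hcJ (-(c - a)) (neg_mem_affRoots hd') hc0 ?_ ?_
    · rw [Pi.neg_apply]; linarith
    · funext x; simp
  have hsum : ∀ x, (f - a) x + (c - a) x = (m - 2) * a x := fun x => by
    simp [hcx]; ring
  have hm3 : m = 3 := by
    have h1 : 0 < ((m : ℝ) - 2) * a x0 := by rw [← hsum]; linarith
    have h2 : (0 : ℝ) < m - 2 := pos_of_mul_pos_left h1 h0.le
    have h3 : 2 < m := by
      have : (2 : ℝ) < m := by linarith
      exact_mod_cast this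
    have h4 := R.pairingIn_pairingIn_mem_set_of_isCrystal_of_isRed j i
    simp only [Set.mem_insert_iff, Set.mem_singleton_iff, Prod.mk.injEq, ← hm] at h4
    omega
  refine split _ hd _ hd' p1 p2 ?_
  funext x
  rw [Pi.add_apply, hsum, hm3]
  push_cast; ring

/-- A positive root of `Σ_J` is a non-negative combination of the simple roots in `J`. -/
theorem exists_nat_comb_levRoots {J : Set b.support} {i : ι} (hi : i ∈ levRoots b J)
    (hp : b.IsPos i) : ∃ f : ι → ℤ, (∀ j, 0 ≤ f j) ∧ (∀ a : b.support, a ∉ J → f a = 0) ∧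
      ∀ x, R.root' i x = ∑ j ∈ b.support, (f j : ℝ) * R.root' j x := by
  classical
  obtain ⟨f, hf, e⟩ := exists_nat_comb b hp
  obtain ⟨y, hy⟩ := exists_dual_point b (fun j => if j ∈ J then 0 else 1)
  have hy0 : R.root' i y = 0 := by
    have : ∀ g ∈ rootSpan b J, g y = 0 := by
      intro g hg
      induction hg using Submodule.span_induction with
      | mem g hg => obtain ⟨a, ha, rfl⟩ := hg; simp [hy, ha]
      | zero => rfl
      | add x z _ _ hx hz => simp [hx, hz]
      | smul c x _ hx => simp [hx]
    exact this _ hi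
  refine ⟨f, hf, ?_, e⟩
  rw [e, Finset.sum_eq_zero_iff_of_nonneg] at hy0
  · intro a ha
    have := hy0 a a.2
    rw [hy a, if_neg ha, mul_one] at this
    exact_mod_cast this
  · intro a ha
    have h1 := hy ⟨a, ha⟩
    rw [show R.root' a y = _ from h1]
    have : (0 : ℝ) ≤ f a := by exact_mod_cast hf a
    split_ifs <;> simp [this]

theorem coreflection_mem_of_mem_levRoots {J : Set b.support} {i : ι} (hi : i ∈ levRoots b J) :
    R.coreflection i ∈ finWeyl b J := by
  have key : ∀ n : ℕ, ∀ i ∈ levRoots b J, b.IsPos i → (b.height i).toNat ≤ n →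
      R.coreflection i ∈ finWeyl b J := by
    intro n
    induction n with
    | zero =>
      intro i _ hp h
      rw [b.isPos_iff] at hp
      lia
    | succ n ih =>
      intro i hi hp hn
      obtain ⟨f, hf, hfJ, e⟩ := exists_nat_comb_levRoots hi hp
      obtain ⟨a, ha, hpa⟩ : ∃ a ∈ b.support, 0 < (f a : ℝ) * R.root' a (R.coroot i) := by
        by_contra! hcon
        have h1 := e (R.coroot i)
        have h2 := Finset.sum_nonpos hcon
        rw [← h1, RootPairing.root'_coroot_eq_pairing, RootPairing.pairing_same] at h2
        linarith
      have haJ : (⟨a, ha⟩ : b.support) ∈ J := by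
        by_contra h
        have := hfJ _ h
        simp only at this
        simp [this] at hpa
      have hpai : 0 < R.pairingIn ℤ i a := by
        rw [R.zero_lt_pairingIn_iff']
        have h1 : (0 : ℝ) ≤ f a := by exact_mod_cast hf a
        have h2 := pos_of_mul_pos_right hpa h1
        rw [RootPairing.root'_coroot_eq_pairing, ← R.algebraMap_pairingIn ℤ] at h2
        simpa using h2
      have hsa := coreflection_mem b haJ
      rcases eq_or_ne i a with rfl | hia
      · exact hsa
      have hpos' := hp.reflectionPerm ha hia
      have hlt : b.height (R.reflectionPerm a i) < b.height i := by
        have := R.reflection_apply_root' ℤ (i := a) (j := i)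
        rw [← RootPairing.root_reflectionPerm, sub_eq_add_neg, ← neg_smul] at this
        rw [b.height_add_zsmul this, RootPairing.Base.height_one_of_mem_support ha]
        simp only [smul_eq_mul, mul_one]
        lia
      have h1 := ih _ (reflectionPerm_mem_levRoots (mem_levRoots_of_mem b haJ) hi) hpos'
        (by rw [b.isPos_iff] at hp hpos'; lia)
      rw [← conj_reflection (mapsRoot_coreflection a i)] at h1
      have h2 := mul_mem (mul_mem (inv_mem hsa) h1) hsa
      convert h2 using 1
      group
  by_cases hp : b.IsPos i
  · exact key _ i hi hp le_rfl
  · rw [← isPos_neg_iff] at hp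
    rw [← coreflection_neg]
    exact key _ _ (neg_mem_levRoots b hi) hp le_rfl

theorem finLen_lt_of_isPos {w : N ≃ₗ[ℝ] N} {i : b.support} {j : ι} (h : MapsRoot R w i j)
    (hj : b.IsPos j) : finLen b w < finLen b (w * R.coreflection (i : ι)) := by
  have hss : ∀ x, R.coreflection (i : ι) (R.coreflection (i : ι) x) = x :=
    fun x => R.coreflection_same (i : ι) x
  have hpi : b.IsPos (i : ι) := b.isPos_of_mem_support i.2
  have hinj : Function.Injective (R.reflectionPerm (i : ι)) := (R.reflectionPerm _).injective
  unfold finLen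
  rw [← Set.ncard_image_of_injective _ hinj]
  refine Set.ncard_lt_ncard ?_ (Set.toFinite _)
  refine Set.ssubset_iff_exists.2 ⟨?_, i, ⟨hpi, ?_⟩, ?_⟩
  · rintro _ ⟨k, ⟨hk, l, hl, e⟩, rfl⟩
    have hki : k ≠ i := by
      rintro rfl
      exact hl (h.right_unique e ▸ hj)
    refine ⟨RootPairing.Base.IsPos.reflectionPerm hk i.2 hki, l, hl, ?_⟩
    rw [e, R.coroot_reflectionPerm]
    change _ = w (R.coreflection (i : ι) (R.coreflection (i : ι) _))
    rw [hss]
  · refine ⟨R.reflectionPerm j j, by rw [isPos_neg_iff]; exact not_not.2 hj, ?_⟩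
    rw [h.neg.1, R.coroot_reflectionPerm]
    rfl
  · rintro ⟨k, ⟨hk, -⟩, e⟩
    have : k = R.reflectionPerm (i : ι) i := by
      have := congrArg (R.reflectionPerm (i : ι)) e
      rwa [R.reflectionPerm_self] at this
    rw [this, isPos_neg_iff] at hk
    exact hk hpi

variable (b) in
/-- `v` maps the positive roots of `Σ_J` to positive roots, i.e. it is of minimal length in the
coset `v W_{0,J}`. -/
def IsMinRep (J : Set b.support) (v : N ≃ₗ[ℝ] N) : Prop :=
  ∀ i ∈ levRoots b J, b.IsPos i → ∀ j, MapsRoot R v i j → b.IsPos j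

/-- Every coset of `W_{0,J}` has a minimal representative: an element on which the finite length is
minimal. -/
theorem exists_isMinRep (J : Set b.support) {v : N ≃ₗ[ℝ] N} (hv : v ∈ finWeyl b Set.univ) :
    ∃ x ∈ finWeyl b J, IsMinRep b J (v * x) := by
  obtain ⟨x, hx, hmin⟩ : ∃ x ∈ finWeyl b J, ∀ y ∈ finWeyl b J,
      finLen b (v * x) ≤ finLen b (v * y) := by
    have hwf := WellFounded.has_min (measure fun x : N ≃ₗ[ℝ] N => finLen b (v * x)).wf
      (finWeyl b J : Set (N ≃ₗ[ℝ] N)) ⟨1, one_mem _⟩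
    obtain ⟨x, hx, h⟩ := hwf
    exact ⟨x, hx, fun y hy => not_lt.1 (h y hy)⟩
  have hvx : v * x ∈ finWeyl b Set.univ := mul_mem hv (finWeyl_mono b (Set.subset_univ J) hx)
  have hsimple : ∀ a ∈ J, ∀ j, MapsRoot R (v * x) (a : ι) j → b.IsPos j := by
    intro a ha j h
    by_contra hj
    rw [← isPos_neg_iff] at hj
    have hss : R.coreflection (a : ι) * R.coreflection (a : ι) = 1 := by
      ext z
      exact R.coreflection_same (a : ι) z
    have h1 := (mapsRoot_coreflection (R := R) (a : ι) a).mul h.neg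
    have h2 := finLen_lt_of_isPos h1 hj
    rw [mul_assoc (v * x), hss, mul_one, mul_assoc] at h2
    exact absurd (hmin _ (mul_mem hx (coreflection_mem b ha))) (not_le.2 h2)
  refine ⟨x, hx, fun i hi hp j h => ?_⟩
  obtain ⟨f, hf, hfJ, e⟩ := exists_nat_comb_levRoots hi hp
  obtain ⟨ρ, hρ⟩ := exists_rho b
  have h1 : (0 : ℝ) ≤ b.height j := by
    rw [← hρ j, ← h.inv.2, e]
    refine Finset.sum_nonneg fun a ha => ?_
    by_cases haJ : (⟨a, ha⟩ : b.support) ∈ J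
    · obtain ⟨l, hl⟩ := (exists_mapsRoot b hvx).1 a
      have := hsimple _ haJ l hl
      rw [b.isPos_iff] at this
      rw [hl.inv.2, hρ]
      exact mul_nonneg (by exact_mod_cast hf a) (by exact_mod_cast this.le)
    · simp [hfJ ⟨a, ha⟩ haJ]
  rw [b.isPos_iff']
  exact_mod_cast h1

/-- `W_{0,J}` permutes the positive roots outside `Σ_J`. -/
theorem isPos_iff_of_notMem {J : Set b.support} {x : N ≃ₗ[ℝ] N} (hx : x ∈ finWeyl b J) :
    ∀ i j, i ∉ levRoots b J → MapsRoot R x i j → (b.IsPos i ↔ b.IsPos j) := by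
  induction hx using Subgroup.closure_induction with
  | mem g hg =>
    obtain ⟨a, ha, rfl⟩ := hg
    have key : ∀ i j, i ∉ levRoots b J → MapsRoot R (R.coreflection (a : ι)) i j →
        b.IsPos i → b.IsPos j := by
      intro i j hi h hp
      obtain rfl := h.right_unique (mapsRoot_coreflection (R := R) a i).1
      refine hp.reflectionPerm a.2 ?_
      rintro rfl
      exact hi (mem_levRoots_of_mem b ha)
    intro i j hi h
    refine ⟨key i j hi h, key j i ?_ ?_⟩
    · rwa [← h.mem_levRoots_iff b (coreflection_mem b ha)]
    · have := h.inv
      rwa [show (R.coreflection (a : ι))⁻¹ = R.coreflection (a : ι) from R.coreflection_inv _]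
        at this
  | one =>
    intro i j _ h
    rw [R.coroot.injective (h.1 : _ = R.coroot i)]
  | mul x y hx hy hx' hy' =>
    intro i j hi h
    obtain ⟨k, hk⟩ := (exists_mapsRoot b hy).1 i
    obtain ⟨l, hl⟩ := (exists_mapsRoot b hx).1 k
    obtain rfl := h.right_unique (hk.mul hl).1
    have hk' : k ∉ levRoots b J := by rwa [← hk.mem_levRoots_iff b hy]
    rw [hy' i k hi hk, hx' k _ hk' hl]
  | inv x hx hx' =>
    intro i j hi h
    have h' := h.inv
    rw [inv_inv] at h'
    exact (hx' j i (by rwa [h'.mem_levRoots_iff b hx]) h').symm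

/-- The element `w_G w_P` makes the positive roots outside `Σ_P` negative. -/
theorem wGP_isPos_iff_of_notMem {J : Set b.support} {i j : ι} (hi : i ∉ levRoots b J)
    (h : MapsRoot R (wGP b J) i j) : b.IsPos j ↔ ¬ b.IsPos i := by
  obtain ⟨k, hk⟩ := (exists_mapsRoot b (longest_mem b J)).1 i
  obtain ⟨l, hl⟩ := (exists_mapsRoot b (longest_mem b Set.univ)).1 k
  obtain rfl := h.right_unique (hk.mul hl).1
  rw [longest_pos_iff b hl, isPos_iff_of_notMem (longest_mem b J) i k hi hk]

theorem isMinRep_wGP (J : Set b.support) : IsMinRep b J (wGP b J) := fun _ hi hp _ h =>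
  (wGP_pos b h hi).1 hp

/-- An element of `W_0` that fixes all roots is trivial, since it moves every vector by an element
of the coroot space, on which the form defined by the roots is nondegenerate. -/
theorem eq_one_of_forall_mapsRoot {J : Set b.support} {v : N ≃ₗ[ℝ] N} (hv : v ∈ finWeyl b J)
    (h : ∀ i, MapsRoot R v i i) : v = 1 := by
  have := Fintype.ofFinite ι
  have hspan : ∀ x, v x - x ∈ R.corootSpan ℝ := by
    clear h
    induction hv using Subgroup.closure_induction with
    | mem g hg =>
      obtain ⟨a, -, rfl⟩ := hg
      intro x
      rw [RootPairing.coreflection_apply, sub_sub_cancel_left]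
      exact neg_mem (Submodule.smul_mem _ _ (Submodule.subset_span ⟨a, rfl⟩))
    | one => intro x; simp
    | mul y z _ _ hy hz =>
      intro x
      have := add_mem (hy (z x)) (hz x)
      rwa [sub_add_sub_cancel] at this
    | inv y _ hy =>
      intro x
      have := neg_mem (hy (y⁻¹ x))
      rw [neg_sub] at this
      rwa [show y (y⁻¹ x) = x from y.apply_symm_apply x] at this
  ext x
  have h1 : v x - x ∈ LinearMap.ker R.CorootForm := by
    rw [LinearMap.mem_ker]
    ext z
    rw [RootPairing.corootForm_apply_apply]
    simp [(h _).2]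
  have h2 := Submodule.disjoint_def.1 R.disjoint_corootSpan_ker_corootForm _ (hspan x) h1
  exact sub_eq_zero.1 h2

variable (b) in
theorem finite_finWeyl : Finite (finWeyl b Set.univ) := by
  choose f hf using fun v : finWeyl b Set.univ => (exists_mapsRoot b v.2).1
  refine Finite.of_injective f fun v w h => ?_
  have hm := mul_mem (inv_mem w.2) v.2
  have := eq_one_of_forall_mapsRoot hm fun i => by
    have h1 := (hf w i).inv
    rw [← congrFun h i] at h1
    exact (hf v i).mul h1
  exact Subtype.ext (inv_mul_eq_one.1 this).symm

/-- A translation in the affine Weyl group by a vector which is orthogonal to `Σ_J` and positive on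
the remaining positive roots: the sum of the positive coroots outside `Σ_J` gives one. -/
theorem exists_dominant (J : Set b.support) :
    ∃ m : N, AffineEquiv.constVAdd ℝ N m ∈ affWeyl R ∧ (∀ i ∈ levRoots b J, R.root' i m = 0) ∧
      ∀ i, b.IsPos i → i ∉ levRoots b J → 0 < R.root' i m := by
  classical
  have := Fintype.ofFinite ι
  set s : Finset ι := Finset.univ.filter fun i => b.IsPos i ∧ i ∉ levRoots b J
  set t : Finset ι := Finset.univ.filter fun i => b.IsPos i ∧ i ∈ levRoots b J
  set m : N := ∑ i ∈ s, R.coroot i with hm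
  have hmJ : ∀ a ∈ J, R.root' (a : ι) m = 0 := by
    intro a ha
    have hfix : R.coreflection (a : ι) m = m := by
      rw [hm, map_sum]
      refine Finset.sum_bij (fun i _ => R.reflectionPerm (a : ι) i) ?_ ?_ ?_ ?_
      · intro i hi
        simp only [s, Finset.mem_filter, Finset.mem_univ, true_and] at hi ⊢
        have h := mapsRoot_coreflection (R := R) (a : ι) i
        rw [← isPos_iff_of_notMem (coreflection_mem b ha) _ _ hi.2 h,
          ← h.mem_levRoots_iff b (coreflection_mem b ha)]
        exact hi
      · intro i _ j _ h
        exact (R.reflectionPerm _).injective h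
      · intro i hi
        refine ⟨R.reflectionPerm (a : ι) i, ?_, by simp⟩
        simp only [s, Finset.mem_filter, Finset.mem_univ, true_and] at hi ⊢
        have h := mapsRoot_coreflection (R := R) (a : ι) i
        rw [← isPos_iff_of_notMem (coreflection_mem b ha) _ _ hi.2 h,
          ← h.mem_levRoots_iff b (coreflection_mem b ha)]
        exact hi
      · intro i _
        rw [R.coroot_reflectionPerm]
    rw [RootPairing.coreflection_apply, sub_eq_self, smul_eq_zero] at hfix
    exact hfix.resolve_right (R.ne_zero' _)
  have hnonJ : ∀ a : b.support, a ∉ J → 0 < R.root' (a : ι) m := by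
    intro a ha
    have hat : (a : ι) ∉ t := by
      intro h
      simp only [t, Finset.mem_filter, Finset.mem_univ, true_and] at h
      obtain ⟨y, hy⟩ := exists_dual_point b (fun j => if j ∈ J then 0 else 1)
      have : ∀ g ∈ rootSpan b J, g y = 0 := by
        intro g hg
        induction hg using Submodule.span_induction with
        | mem g hg => obtain ⟨a, ha, rfl⟩ := hg; simp [hy, ha]
        | zero => rfl
        | add x z _ _ hx hz => simp [hx, hz]
        | smul c x _ hx => simp [hx]
      have h0 := this _ h.2
      rw [hy a, if_neg ha] at h0
      exact one_ne_zero h0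
    -- the sum of all positive coroots pairs to 2 with each simple root
    have hall : R.root' (a : ι) (∑ i ∈ Finset.univ.filter (fun i => b.IsPos i), R.coroot i) = 2 := by
      set u : Finset ι := Finset.univ.filter fun i => b.IsPos i
      have hau : (a : ι) ∈ u := by
        simp only [u, Finset.mem_filter, Finset.mem_univ, true_and]
        exact b.isPos_of_mem_support a.2
      have hmem : ∀ i ∈ u.erase (a : ι), R.reflectionPerm (a : ι) i ∈ u.erase (a : ι) := by
        intro i hi
        simp only [u, Finset.mem_erase, Finset.mem_filter, Finset.mem_univ, true_and] at hi ⊢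
        refine ⟨fun h => ?_, hi.2.reflectionPerm a.2 hi.1⟩
        have h1 := congrArg (R.reflectionPerm (a : ι)) h
        rw [R.reflectionPerm_self] at h1
        have h2 := hi.2
        rw [h1, isPos_neg_iff] at h2
        exact h2 (b.isPos_of_mem_support a.2)
      have hfix : R.coreflection (a : ι) (∑ i ∈ u.erase (a : ι), R.coroot i) =
          ∑ i ∈ u.erase (a : ι), R.coroot i := by
        rw [map_sum]
        refine Finset.sum_bij (fun i _ => R.reflectionPerm (a : ι) i) hmem ?_ ?_ ?_
        · intro i _ j _ h
          exact (R.reflectionPerm _).injective h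
        · intro i hi
          exact ⟨R.reflectionPerm (a : ι) i, hmem i hi, by simp⟩
        · intro i _
          rw [R.coroot_reflectionPerm]
      rw [RootPairing.coreflection_apply, sub_eq_self, smul_eq_zero] at hfix
      rw [← Finset.add_sum_erase _ _ hau, map_add, hfix.resolve_right (R.ne_zero' _),
        RootPairing.root'_coroot_eq_pairing, RootPairing.pairing_same, add_zero]
    have hsplit : ∑ i ∈ Finset.univ.filter (fun i => b.IsPos i), R.coroot i =
        m + ∑ i ∈ t, R.coroot i := by
      rw [hm, add_comm, ← Finset.sum_filter_add_sum_filter_not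
        (Finset.univ.filter fun i => b.IsPos i) (fun i => i ∈ levRoots b J)]
      rw [Finset.filter_filter, Finset.filter_filter]
    have ht : R.root' (a : ι) (∑ i ∈ t, R.coroot i) ≤ 0 := by
      rw [map_sum]
      refine Finset.sum_nonpos fun i hi => ?_
      simp only [t, Finset.mem_filter, Finset.mem_univ, true_and] at hi
      by_contra hcon
      rw [not_le, RootPairing.root'_coroot_eq_pairing, ← R.algebraMap_pairingIn ℤ] at hcon
      have h1 : 0 < R.pairingIn ℤ (a : ι) i := by simpa using hcon
      rw [R.zero_lt_pairingIn_iff'] at h1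
      obtain ⟨f, hf, hfJ, e⟩ := exists_nat_comb_levRoots hi.2 hi.1
      have h2 : (R.pairing i a : ℝ) ≤ 0 := by
        rw [← RootPairing.root'_coroot_eq_pairing, e]
        refine Finset.sum_nonpos fun c hc => ?_
        by_cases hcJ : (⟨c, hc⟩ : b.support) ∈ J
        · refine mul_nonpos_of_nonneg_of_nonpos (by exact_mod_cast hf c) ?_
          have hca : c ≠ a := by
            rintro rfl
            exact ha hcJ
          have := b.pairingIn_le_zero_of_ne hca hc a.2
          rw [RootPairing.root'_coroot_eq_pairing, ← R.algebraMap_pairingIn ℤ]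
          simpa using this
        · simp [hfJ ⟨c, hc⟩ hcJ]
      rw [← R.algebraMap_pairingIn ℤ] at h2
      simp at h2
      lia
    rw [hsplit, map_add] at hall
    linarith
  refine ⟨m, ?_, ?_, ?_⟩
  · have hadd : ∀ y z : N, AffineEquiv.constVAdd ℝ N (y + z) =
        AffineEquiv.constVAdd ℝ N y * AffineEquiv.constVAdd ℝ N z := fun y z => by
      ext x
      change y + z + x = y + (z + x)
      rw [add_assoc]
    have hco : ∀ i, AffineEquiv.constVAdd ℝ N (R.coroot i) ∈ affWeyl R := fun i => by
      have : AffineEquiv.constVAdd ℝ N (R.coroot i) = affRefl R i 1 * affRefl R i 0 := by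
        ext x
        change R.coroot i + x = affRefl R i 1 (affRefl R i 0 x)
        simp only [affRefl_apply, map_sub, map_smul, RootPairing.root'_coroot_eq_pairing,
          RootPairing.pairing_same, smul_eq_mul]
        push_cast
        module
      rw [this]
      exact mul_mem (affRefl_mem _ _) (affRefl_mem _ _)
    have : ∀ u : Finset ι, AffineEquiv.constVAdd ℝ N (∑ i ∈ u, R.coroot i) ∈ affWeyl R := by
      intro u
      induction u using Finset.induction_on with
      | empty =>
        rw [Finset.sum_empty]
        have : AffineEquiv.constVAdd ℝ N (0 : N) = 1 := by
          ext x
          exact zero_add x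
        rw [this]
        exact one_mem _
      | insert i u hi ih =>
        rw [Finset.sum_insert hi, hadd]
        exact mul_mem (hco i) ih
    exact this s
  · intro i hi
    have : ∀ g ∈ rootSpan b J, g m = 0 := by
      intro g hg
      induction hg using Submodule.span_induction with
      | mem g hg => obtain ⟨a, ha, rfl⟩ := hg; exact hmJ a ha
      | zero => rfl
      | add x z _ _ hx hz => simp [hx, hz]
      | smul c x _ hx => simp [hx]
    exact this _ hi
  · intro i hp hi
    obtain ⟨f, hf, e⟩ := exists_nat_comb b hp
    have hnn : ∀ c ∈ b.support, 0 ≤ (f c : ℝ) * R.root' c m := fun c hc => by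
      refine mul_nonneg (by exact_mod_cast hf c) ?_
      by_cases hcJ : (⟨c, hc⟩ : b.support) ∈ J
      · exact (hmJ _ hcJ).ge
      · exact (hnonJ _ hcJ).le
    rw [e]
    refine lt_of_le_of_ne (Finset.sum_nonneg hnn) fun h0 => hi ?_
    have hz := (Finset.sum_eq_zero_iff_of_nonneg hnn).1 h0.symm
    have : R.root' i = ∑ c ∈ b.support, (f c : ℝ) • R.root' c := by
      ext x
      rw [e]
      simp
    change R.root' i ∈ rootSpan b J
    rw [this]
    refine Submodule.sum_mem _ fun c hc => ?_
    by_cases hcJ : (⟨c, hc⟩ : b.support) ∈ J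
    · exact Submodule.smul_mem _ _ (Submodule.subset_span ⟨⟨c, hc⟩, hcJ, rfl⟩)
    · have h1 := (mul_eq_zero.1 (hz c hc)).resolve_right (hnonJ ⟨c, hc⟩ hcJ).ne'
      rw [h1, zero_smul]
      exact zero_mem _

end FiniteRoots

/-! ### Lengths in `W_J(1)` -/

section Lengths

variable {ι M N : Type*} [AddCommGroup M] [Module ℝ M] [AddCommGroup N] [Module ℝ N]
  [Finite ι] {R : RootPairing ι ℝ M N} [R.IsCrystallographic] [R.IsReduced] {b : R.Base}

theorem sep_subset_union {J : Set b.support} {x y z : N} (hy : Regular b y) :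
    sep b J x z ⊆ sep b J x y ∪ sep b J y z := by
  rintro f ⟨hf, h1, h2⟩
  rcases hy.pos_or_neg hf with h | h
  · exact Or.inr ⟨hf, h, h2⟩
  · exact Or.inl ⟨hf, h1, h⟩

theorem ncard_sep_le {J : Set b.support} {x y z : N} (hy : Regular b y) :
    (sep b J x z).ncard ≤ (sep b J x y).ncard + (sep b J y z).ncard :=
  (Set.ncard_le_ncard (sep_subset_union hy) ((sep_finite J x y).union (sep_finite J y z))).trans
    (Set.ncard_union_le _ _)

theorem ncard_sep_add {J : Set b.support} {x y z : N} (hx : Regular b x) (hy : Regular b y)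
    (h : ∀ f ∈ affRoots b J, 0 < f y → f x < 0 → 0 < f z) :
    (sep b J x z).ncard = (sep b J x y).ncard + (sep b J y z).ncard := by
  have hd : Disjoint (sep b J x y) (sep b J y z) := by
    rw [Set.disjoint_left]
    rintro f ⟨-, -, h1⟩ ⟨-, h2, -⟩
    exact lt_asymm h1 h2
  rw [← Set.ncard_union_eq hd (sep_finite J x y) (sep_finite J y z)]
  congr 1
  refine (sep_subset_union hy).antisymm ?_
  rintro f (⟨hf, h1, h2⟩ | ⟨hf, h1, h2⟩)
  · refine ⟨hf, h1, ?_⟩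
    have := h (-f) (neg_mem_affRoots hf) (by simpa using h2) (by simpa using h1)
    simpa using this
  · refine ⟨hf, ?_, h2⟩
    rcases hx.pos_or_neg hf with h3 | h3
    · exact h3
    · exact absurd (h f hf h1 h3) (not_lt.2 h2.le)

variable {W1 : Type*} [Group W1] (D : Datum b W1)

namespace Datum

/-- The image of the base point under `w ∈ W(1)`. -/
def pt (w : W1) : N := D.act1 w (basePoint b)

theorem proj_mem (w : W1) : D.proj w ∈ finWeyl b Set.univ := D.act_linear _

theorem mem_lev_univ (w : W1) : w ∈ D.lev Set.univ := D.proj_mem w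

theorem act1_mul_apply (v w : W1) (x : N) : D.act1 (v * w) x = D.act1 v (D.act1 w x) := by
  rw [map_mul]; rfl

theorem act1_inv_act1 (w : W1) (x : N) : D.act1 w⁻¹ (D.act1 w x) = x := by
  rw [← act1_mul_apply, inv_mul_cancel, map_one]; rfl

theorem act1_act1_inv (w : W1) (x : N) : D.act1 w (D.act1 w⁻¹ x) = x := by
  rw [← act1_mul_apply, mul_inv_cancel, map_one]; rfl

theorem pt_mul (v w : W1) : D.pt (v * w) = D.act1 v (D.pt w) := D.act1_mul_apply v w _

theorem pt_one : D.pt 1 = basePoint b := by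
  rw [pt, map_one]; rfl

theorem affRoot_comp_act1 (w : W1) {i j : ι} (h : MapsRoot R (D.proj w) i j) (k : ℤ) :
    ∃ l : ℤ, (R.root' j (D.act1 w 0) = l) ∧ affRoot R j k ∘ D.act1 w = affRoot R i (k + l) := by
  obtain ⟨l, hl⟩ := D.act_int (w : W1 ⧸ D.Zk) j
  change R.root' j (D.act1 w 0) = l at hl
  refine ⟨l, hl, ?_⟩
  funext x
  simp only [Function.comp_apply, affRoot]
  rw [act1_apply, map_add, h.2, hl]
  push_cast
  ring

theorem comp_mem {J : Set b.support} {w : W1} (hw : w ∈ D.lev J) {f : N → ℝ}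
    (hf : f ∈ affRoots b J) : f ∘ D.act1 w ∈ affRoots b J := by
  obtain ⟨j, hj, k, rfl⟩ := hf
  obtain ⟨i, hi⟩ := (exists_mapsRoot b hw).2 j
  obtain ⟨l, -, e⟩ := D.affRoot_comp_act1 w hi k
  rw [e]
  exact affRoot_mem ((hi.mem_levRoots_iff b hw).2 hj) _

theorem comp_mem_iff {J : Set b.support} {w : W1} (hw : w ∈ D.lev J) {f : N → ℝ} :
    f ∘ D.act1 w ∈ affRoots b J ↔ f ∈ affRoots b J := by
  refine ⟨fun h => ?_, D.comp_mem hw⟩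
  have := D.comp_mem (inv_mem hw) h
  rwa [show (f ∘ D.act1 w) ∘ D.act1 w⁻¹ = f from
    funext fun x => congrArg f (D.act1_act1_inv w x)] at this

theorem comp_mem_univ (w : W1) {f : N → ℝ} (hf : f ∈ affRoots b Set.univ) :
    f ∘ D.act1 w ∈ affRoots b Set.univ := D.comp_mem (D.mem_lev_univ w) hf

theorem regular_act1 (w : W1) {y : N} (hy : Regular b y) : Regular b (D.act1 w y) :=
  fun f hf => hy (f ∘ D.act1 w) (D.comp_mem_univ w hf)

theorem regular_pt (w : W1) : Regular b (D.pt w) := D.regular_act1 w (basePoint_regular b)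

theorem ncard_sep_act1 {J : Set b.support} {w : W1} (hw : w ∈ D.lev J) (y z : N) :
    (sep b J (D.act1 w y) (D.act1 w z)).ncard = (sep b J y z).ncard := by
  have hinj : Function.Injective fun f : N → ℝ => f ∘ D.act1 w :=
    (D.act1 w).surjective.injective_comp_right
  rw [← Set.ncard_image_of_injective _ hinj]
  congr 1
  ext f
  constructor
  · rintro ⟨f, ⟨hf, h1, h2⟩, rfl⟩
    exact ⟨D.comp_mem hw hf, h1, h2⟩
  · rintro ⟨hf, h1, h2⟩
    refine ⟨f ∘ D.act1 w⁻¹, ⟨D.comp_mem (inv_mem hw) hf, ?_, ?_⟩, ?_⟩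
    · rwa [Function.comp_apply, act1_inv_act1]
    · rwa [Function.comp_apply, act1_inv_act1]
    · funext x
      simp only [Function.comp_apply, act1_inv_act1]

theorem len_eq {J : Set b.support} {w : W1} (hw : w ∈ D.lev J) :
    D.len J w = (sep b J (basePoint b) (D.pt w)).ncard :=
  affLen_eq_ncard_sep J _ fun _ hf => D.comp_mem hw hf

theorem len_mul_eq {J : Set b.support} {v w : W1} (hv : v ∈ D.lev J) (hw : w ∈ D.lev J) :
    D.len J (v * w) = (sep b J (D.pt v⁻¹) (D.pt w)).ncard := by
  rw [D.len_eq (mul_mem hv hw), ← D.ncard_sep_act1 (inv_mem hv), pt_mul, act1_inv_act1]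
  rfl

theorem len_eq' {J : Set b.support} {w : W1} (hw : w ∈ D.lev J) :
    D.len J w = (sep b J (D.pt w⁻¹) (basePoint b)).ncard := by
  have := D.len_mul_eq hw (one_mem (D.lev J))
  rwa [mul_one, pt_one] at this

theorem len_mul_le {J : Set b.support} {v w : W1} (hv : v ∈ D.lev J) (hw : w ∈ D.lev J) :
    D.len J (v * w) ≤ D.len J v + D.len J w := by
  rw [D.len_mul_eq hv hw, D.len_eq' hv, D.len_eq hw]
  exact ncard_sep_le (basePoint_regular b)

/-- Lengths add if no affine root of `Σ_J` separates the fundamental alcove from both its images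
under `v⁻¹` and `w`. -/
theorem len_mul_eq_add {J : Set b.support} {v w : W1} (hv : v ∈ D.lev J) (hw : w ∈ D.lev J)
    (h : ∀ f ∈ affRoots b J, 0 < f (basePoint b) → f (D.pt v⁻¹) < 0 → 0 < f (D.pt w)) :
    D.len J (v * w) = D.len J v + D.len J w := by
  rw [D.len_mul_eq hv hw, D.len_eq' hv, D.len_eq hw]
  exact ncard_sep_add (D.regular_pt _) (basePoint_regular b) h

theorem len_eq_zero_iff {J : Set b.support} {w : W1} (hw : w ∈ D.lev J) :
    D.len J w = 0 ↔ ∀ f ∈ affRoots b J, 0 < f (basePoint b) → 0 < f (D.pt w) := by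
  rw [D.len_eq hw, Set.ncard_eq_zero (sep_finite _ _ _), Set.eq_empty_iff_forall_notMem]
  refine forall_congr' fun f => ⟨fun h hf h0 => ?_, fun h hf => ?_⟩
  · exact ((D.regular_pt w).pos_or_neg hf).resolve_right fun h1 => h ⟨hf, h0, h1⟩
  · exact lt_asymm hf.2.2 (h hf.1 hf.2.1)

/-- An element of length zero preserves the sign at the base point. -/
theorem pos_pt_iff_of_len_eq_zero {J : Set b.support} {w : W1} (hw : w ∈ D.lev J)
    (h : D.len J w = 0) {f : N → ℝ} (hf : f ∈ affRoots b J) :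
    0 < f (D.pt w) ↔ 0 < f (basePoint b) := by
  refine ⟨fun h1 => ?_, (D.len_eq_zero_iff hw).1 h f hf⟩
  by_contra h2
  rw [(basePoint_regular b).not_pos hf] at h2
  have := (D.len_eq_zero_iff hw).1 h (-f) (neg_mem_affRoots hf) (by simpa using h2)
  rw [Pi.neg_apply] at this
  linarith

theorem len_mul_of_len_eq_zero {J : Set b.support} {w u : W1} (hw : w ∈ D.lev J)
    (hu : u ∈ D.lev J) (h : D.len J u = 0) : D.len J (w * u) = D.len J w + D.len J u := by
  refine le_antisymm (D.len_mul_le hw hu) ?_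
  have := D.len_mul_le (mul_mem hw hu) (inv_mem hu)
  rw [mul_inv_cancel_right, D.len_inv hu, h] at this
  lia

theorem len_mul_of_len_eq_zero' {J : Set b.support} {w u : W1} (hw : w ∈ D.lev J)
    (hu : u ∈ D.lev J) (h : D.len J u = 0) : D.len J (u * w) = D.len J u + D.len J w := by
  refine le_antisymm (D.len_mul_le hu hw) ?_
  have := D.len_mul_le (inv_mem hu) (mul_mem hu hw)
  rw [inv_mul_cancel_left, D.len_inv hu, h] at this
  lia

/-! ### Simple affine roots -/

/-- `f` is the simple affine root of `Σ_J` attached to the lift `s` of a simple reflection. -/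
def SimpleRoot (J : Set b.support) (s : W1) (f : N → ℝ) : Prop :=
  ∃ i ∈ levRoots b J, ∃ k : ℤ, f = affRoot R i k ∧
    (s : W1 ⧸ D.Zk) = D.aff ⟨affRefl R i (-k), affRefl_mem i (-k)⟩ ∧
    sep b J (basePoint b) (D.pt s) = {f}

variable {D} in
theorem act1_eq_of_mk_eq {s : W1} {i : ι} {k : ℤ}
    (h : (s : W1 ⧸ D.Zk) = D.aff ⟨affRefl R i k, affRefl_mem i k⟩) : D.act1 s = affRefl R i k := by
  change D.act (s : W1 ⧸ D.Zk) = _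
  rw [h, D.act_aff]

theorem affRefl_neg_index (i : ι) (k : ℤ) :
    affRefl R (R.reflectionPerm i i) (-k) = affRefl R i k := by
  ext x
  rw [affRefl_apply, affRefl_apply, coroot_neg, root'_neg, LinearMap.neg_apply]
  push_cast
  module

theorem mem_lev_of_mem_refl {J : Set b.support} {s : W1} (hs : (s : W1 ⧸ D.Zk) ∈ D.refl J) :
    s ∈ D.lev J := by
  obtain ⟨i, hi, k, e⟩ := hs
  change AffineEquiv.linearHom (D.act1 s) ∈ finWeyl b J
  rw [act1_eq_of_mk_eq e]
  have : AffineEquiv.linearHom (affRefl R i k) = R.coreflection i := by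
    ext x
    have h := (affRefl R i k).map_vadd 0 x
    simp only [vadd_eq_add, add_zero, affRefl_apply, map_zero] at h
    change (affRefl R i k).linear x = _
    rw [RootPairing.coreflection_apply]
    have h2 : (affRefl R i k).linear x =
        x - (R.root' i x - k) • R.coroot i - (0 - (0 - (k : ℝ)) • R.coroot i) := by
      rw [h]; abel
    rw [h2]
    module
  rw [this]
  exact coreflection_mem_of_mem_levRoots hi

/-- A lift of a reflection, of length one, makes only one positive affine root of `Σ_J` negative, and
it lifts the reflection attached to this affine root. -/
theorem exists_simpleRoot {J : Set b.support} {s : W1} (hs : D.IsSimple J s) :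
    ∃ f, D.SimpleRoot J s f := by
  obtain ⟨i, hi, k, e⟩ := hs.1
  have hsJ := D.mem_lev_of_mem_refl hs.1
  have hlen := hs.2
  rw [D.len_eq hsJ, Set.ncard_eq_one] at hlen
  obtain ⟨g, hg⟩ := hlen
  have hact := act1_eq_of_mk_eq e
  have hrefl : ∀ f : N → ℝ, f ∘ affRefl R i k = -f → f (D.pt s) = -f (basePoint b) := fun f h => by
    rw [pt, hact]
    exact congrFun h _
  have h1 : affRoot R i (-k) ∘ affRefl R i k = -affRoot R i (-k) := by
    have := affRoot_comp_affRefl_self (R := R) i (-k)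
    rwa [neg_neg] at this
  have hf : affRoot R i (-k) ∈ affRoots b J := affRoot_mem hi _
  rcases (basePoint_regular b).pos_or_neg hf with h0 | h0
  · have : affRoot R i (-k) ∈ sep b J (basePoint b) (D.pt s) :=
      ⟨hf, h0, by rw [hrefl _ h1]; linarith⟩
    rw [hg, Set.mem_singleton_iff] at this
    refine ⟨g, i, hi, -k, this.symm, ?_, hg⟩
    simp only [neg_neg]
    exact e
  · have h2 := hrefl _ h1
    have : -affRoot R i (-k) ∈ sep b J (basePoint b) (D.pt s) :=
      ⟨neg_mem_affRoots hf, by simpa using h0, by rw [Pi.neg_apply, h2]; linarith⟩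
    rw [hg, Set.mem_singleton_iff] at this
    refine ⟨g, R.reflectionPerm i i, neg_mem_levRoots b hi, k, ?_, ?_, hg⟩
    · rw [← this, ← affRoot_neg, neg_neg]
    · rw [e]
      congr 2
      exact (affRefl_neg_index i k).symm

namespace SimpleRoot

variable {D} {J : Set b.support} {s : W1} {f : N → ℝ}

theorem mem (h : D.SimpleRoot J s f) : f ∈ affRoots b J := by
  obtain ⟨i, hi, k, rfl, -⟩ := h
  exact affRoot_mem hi k

theorem sep_eq (h : D.SimpleRoot J s f) : sep b J (basePoint b) (D.pt s) = {f} := by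
  obtain ⟨i, hi, k, -, -, e⟩ := h
  exact e

theorem pos (h : D.SimpleRoot J s f) : 0 < f (basePoint b) := by
  have : f ∈ sep b J (basePoint b) (D.pt s) := by rw [h.sep_eq]; rfl
  exact this.2.1

theorem refl_mem (h : D.SimpleRoot J s f) : (s : W1 ⧸ D.Zk) ∈ D.refl J := by
  obtain ⟨i, hi, k, -, e, -⟩ := h
  exact ⟨i, hi, -k, e⟩

theorem lev_mem (h : D.SimpleRoot J s f) : s ∈ D.lev J := D.mem_lev_of_mem_refl h.refl_mem

theorem isSimple (h : D.SimpleRoot J s f) : D.IsSimple J s :=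
  ⟨h.refl_mem, by rw [D.len_eq h.lev_mem, h.sep_eq, Set.ncard_singleton]⟩

theorem apply_act1 (h : D.SimpleRoot J s f) (x : N) : f (D.act1 s x) = -f x := by
  obtain ⟨i, hi, k, rfl, e, -⟩ := h
  rw [act1_eq_of_mk_eq e]
  exact congrFun (affRoot_comp_affRefl_self i k) x

theorem mk_inv (h : D.SimpleRoot J s f) : (s⁻¹ : W1 ⧸ D.Zk) = s := D.refl_inv h.refl_mem

theorem mul_self_mem (h : D.SimpleRoot J s f) : s * s ∈ D.Zk := by
  rw [← QuotientGroup.eq_one_iff, QuotientGroup.mk_mul]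
  nth_rewrite 1 [← h.mk_inv]
  rw [inv_mul_cancel]

theorem act1_inv (h : D.SimpleRoot J s f) : D.act1 s⁻¹ = D.act1 s := by
  change D.act ((s⁻¹ : W1) : W1 ⧸ D.Zk) = D.act (s : W1 ⧸ D.Zk)
  rw [QuotientGroup.mk_inv, h.mk_inv]

theorem inv (h : D.SimpleRoot J s f) : D.SimpleRoot J s⁻¹ f := by
  have h1 := h.mk_inv
  have h2 : D.pt s⁻¹ = D.pt s := by rw [pt, h.act1_inv, pt]
  obtain ⟨i, hi, k, e1, e, e2⟩ := h
  exact ⟨i, hi, k, e1, by rw [QuotientGroup.mk_inv, h1, e], by rw [h2, e2]⟩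

theorem apply_pt_mul (h : D.SimpleRoot J s f) (w : W1) : f (D.pt (s * w)) = -f (D.pt w) := by
  rw [pt_mul, h.apply_act1]

theorem len_mul_of_pos (h : D.SimpleRoot J s f) {w : W1} (hw : w ∈ D.lev J)
    (hp : 0 < f (D.pt w)) : D.len J (s * w) = D.len J w + 1 := by
  rw [D.len_mul_eq_add h.lev_mem hw, h.isSimple.2, add_comm]
  intro g hg h1 h2
  have : g ∈ sep b J (basePoint b) (D.pt s⁻¹) := ⟨hg, h1, h2⟩
  rw [h.inv.sep_eq, Set.mem_singleton_iff] at this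
  rwa [this]

theorem len_mul_of_neg (h : D.SimpleRoot J s f) {w : W1} (hw : w ∈ D.lev J)
    (hn : f (D.pt w) < 0) : D.len J w = D.len J (s * w) + 1 := by
  have h1 := h.len_mul_of_pos (mul_mem h.lev_mem hw) (by rw [h.apply_pt_mul]; linarith)
  rwa [← mul_assoc, show D.len J (s * s * w) = D.len J w from
    D.len_zk_mul J ⟨_, h.mul_self_mem⟩ w] at h1

theorem len_mul_iff (h : D.SimpleRoot J s f) {w : W1} (hw : w ∈ D.lev J) :
    D.len J w < D.len J (s * w) ↔ 0 < f (D.pt w) := by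
  rcases (D.regular_pt w).pos_or_neg h.mem with hp | hn
  · have := h.len_mul_of_pos hw hp
    exact ⟨fun _ => hp, fun _ => by lia⟩
  · have := h.len_mul_of_neg hw hn
    exact ⟨fun _ => by lia, fun h' => absurd h' (not_lt.2 hn.le)⟩

theorem len_mul_right (h : D.SimpleRoot J s f) {w : W1} (hw : w ∈ D.lev J) :
    D.len J (w * s) = D.len J (s⁻¹ * w⁻¹) := by
  rw [← mul_inv_rev, D.len_inv (mul_mem hw h.lev_mem)]

theorem len_mul_right_of_pos (h : D.SimpleRoot J s f) {w : W1} (hw : w ∈ D.lev J)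
    (hp : 0 < f (D.pt w⁻¹)) : D.len J (w * s) = D.len J w + 1 := by
  rw [h.len_mul_right hw, h.inv.len_mul_of_pos (inv_mem hw) hp, D.len_inv hw]

theorem len_mul_right_iff (h : D.SimpleRoot J s f) {w : W1} (hw : w ∈ D.lev J) :
    D.len J w < D.len J (w * s) ↔ 0 < f (D.pt w⁻¹) := by
  rw [h.len_mul_right hw, ← D.len_inv hw, h.inv.len_mul_iff (inv_mem hw)]

end SimpleRoot

/-- An element of positive length has a left descent. -/
theorem exists_simpleRoot_neg {J : Set b.support} {w : W1} (hw : w ∈ D.lev J)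
    (h : D.len J w ≠ 0) : ∃ s f, D.SimpleRoot J s f ∧ f (D.pt w) < 0 := by
  have hne : (sep b J (basePoint b) (D.pt w)).Nonempty := by
    rw [D.len_eq hw] at h
    exact Set.nonempty_of_ncard_ne_zero h
  obtain ⟨i, hi, k, hmem, hsep⟩ := exists_simple_mem_sep hne
  obtain ⟨s, hs⟩ := QuotientGroup.mk_surjective
    (D.aff ⟨affRefl R i (-k), affRefl_mem i (-k)⟩)
  refine ⟨s, affRoot R i k, ⟨i, hi, k, rfl, hs, ?_⟩, hmem.2.2⟩
  rw [pt, act1_eq_of_mk_eq hs, hsep]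

/-- The reflections of the affine Weyl group are permuted by `W` as the affine roots are. -/
theorem conj_aff_affRefl (w : W1) {i j : ι} {k l : ℤ}
    (h : affRoot R i k ∘ D.act1 w = affRoot R j l) :
    ((w : W1) : W1 ⧸ D.Zk)⁻¹ * D.aff ⟨affRefl R i (-k), affRefl_mem i (-k)⟩ * (w : W1 ⧸ D.Zk) =
      D.aff ⟨affRefl R j (-l), affRefl_mem j (-l)⟩ := by
  obtain ⟨j', hj'⟩ := (exists_mapsRoot b (D.proj_mem w)).2 i
  obtain ⟨l', -, e⟩ := D.affRoot_comp_act1 w hj' k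
  obtain ⟨rfl, rfl⟩ := affRoot_inj (h.symm.trans e)
  have hn := D.aff_normal.conj_mem _ ⟨⟨affRefl R i (-k), affRefl_mem i (-k)⟩, rfl⟩
    ((w : W1) : W1 ⧸ D.Zk)⁻¹
  rw [inv_inv] at hn
  obtain ⟨y, hy⟩ := hn
  rw [← hy]
  congr 1
  ext1
  have hact := congrArg D.act hy
  rw [D.act_aff, map_mul, map_mul, map_inv, D.act_aff] at hact
  rw [hact]
  change (D.act1 w)⁻¹ * affRefl R i (-k) * D.act1 w = affRefl R j (-(k + l'))
  rw [mul_assoc, inv_mul_eq_iff_eq_mul]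
  ext x
  change affRefl R i (-k) (D.act1 w x) = D.act1 w (affRefl R j (-(k + l')) x)
  have h1 := congrFun e x
  simp only [Function.comp_apply, affRoot] at h1
  rw [affRefl_apply, affRefl_apply]
  have h2 : R.root' i (D.act1 w x) - ((-k : ℤ) : ℝ) = R.root' j x - ((-(k + l') : ℤ) : ℝ) := by
    push_cast at h1 ⊢
    linarith
  rw [h2, D.act1_apply w (x - _), map_sub, map_smul, ← hj'.1, D.act1_apply w x]
  abel

/-- If `w` maps the simple affine root of `t` to that of `s`, up to sign, then `s w` and `w t`
agree up to `Z_κ`. -/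
theorem SimpleRoot.exchange {D : Datum b W1} {J : Set b.support} {s t w : W1} {f g : N → ℝ}
    (hs : D.SimpleRoot J s f) (ht : D.SimpleRoot J t g)
    (h : f ∘ D.act1 w = g ∨ f ∘ D.act1 w = -g) : ∃ z : D.Zk, s * w = z * (w * t) := by
  obtain ⟨i, hi, k, rfl, es, -⟩ := hs
  obtain ⟨j, hj, l, rfl, et, -⟩ := ht
  have key : ((w : W1) : W1 ⧸ D.Zk)⁻¹ * s * w = t := by
    rw [es, et]
    rcases h with h | h
    · exact D.conj_aff_affRefl w h
    · rw [← affRoot_neg] at h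
      rw [D.conj_aff_affRefl w h]
      congr 2
      exact affRefl_neg_index j (-l)
  have h2 : ((s * w : W1) : W1 ⧸ D.Zk) = (w * t : W1) := by
    rw [QuotientGroup.mk_mul, QuotientGroup.mk_mul, ← key]
    group
  have h3 := QuotientGroup.eq.1 h2.symm
  refine ⟨⟨s * w * (w * t)⁻¹, ?_⟩, (inv_mul_cancel_right _ _).symm⟩
  have := D.normal.conj_mem _ h3 (w * t)
  simpa [mul_assoc] using this

/-- If `w` does not map the simple affine root of `t` to plus or minus that of `s`, then the sign
of the latter does not change between `w` and `w t`. -/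
theorem SimpleRoot.pos_pt_mul_iff {D : Datum b W1} {J : Set b.support} {s t w : W1} {f g : N → ℝ}
    (hs : D.SimpleRoot J s f) (ht : D.SimpleRoot J t g) (hw : w ∈ D.lev J)
    (h : ¬ (f ∘ D.act1 w = g ∨ f ∘ D.act1 w = -g)) :
    0 < f (D.pt (w * t)) ↔ 0 < f (D.pt w) := by
  have hfw := D.comp_mem hw hs.mem
  have e1 : f (D.pt (w * t)) = (f ∘ D.act1 w) (D.pt t) := by rw [pt_mul]; rfl
  have e2 : f (D.pt w) = (f ∘ D.act1 w) (basePoint b) := rfl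
  rw [e1, e2]
  have hsep := ht.sep_eq
  constructor
  · intro h1
    by_contra h2
    rw [(basePoint_regular b).not_pos hfw] at h2
    have : -(f ∘ D.act1 w) ∈ sep b J (basePoint b) (D.pt t) :=
      ⟨neg_mem_affRoots hfw, by rw [Pi.neg_apply]; linarith, by rw [Pi.neg_apply]; linarith⟩
    rw [hsep, Set.mem_singleton_iff] at this
    exact h (Or.inr (by rw [← this, neg_neg]))
  · intro h1
    by_contra h2
    rw [(D.regular_pt t).not_pos hfw] at h2
    have : f ∘ D.act1 w ∈ sep b J (basePoint b) (D.pt t) := ⟨hfw, h1, h2⟩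
    rw [hsep, Set.mem_singleton_iff] at this
    exact h (Or.inl this)

end Datum

end Lengths

/-! ### Operators on the group algebra of `W_J(1)` -/

section Regular

variable {ι M N : Type*} [AddCommGroup M] [Module ℝ M] [AddCommGroup N] [Module ℝ N]
  [Finite ι] {R : RootPairing ι ℝ M N} [R.IsCrystallographic] [R.IsReduced] {b : R.Base}
  {W1 : Type*} [Group W1] {D : Datum b W1} {C : Type*} [CommRing C]

/-- The linear map `C[G] → X` with given values on the group elements. -/
def linExt {G X : Type*} [AddCommMonoid X] [Module C X] (f : G → X) : MonoidAlgebra C G →ₗ[C] X :=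
  Finsupp.linearCombination C f ∘ₗ (MonoidAlgebra.coeffLinearEquiv C).toLinearMap

theorem linExt_single {G X : Type*} [AddCommMonoid X] [Module C X] (f : G → X) (g : G) (a : C) :
    linExt f (MonoidAlgebra.single g a) = a • f g := by
  simp [linExt]

theorem zlin_eq_linExt {Z A : Type*} [Ring A] [Algebra C A] (f : Z → A) (x : MonoidAlgebra C Z) :
    zlin f x = linExt f x := rfl

theorem lhom_ext_single {G X : Type*} [AddCommMonoid X] [Module C X]
    {F F' : MonoidAlgebra C G →ₗ[C] X}
    (h : ∀ g, F (MonoidAlgebra.single g 1) = F' (MonoidAlgebra.single g 1)) : F = F' := by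
  refine LinearMap.ext fun x => ?_
  induction x using MonoidAlgebra.induction_linear with
  | zero => simp
  | add x y hx hy => rw [map_add, map_add, hx, hy]
  | single g a =>
    have : MonoidAlgebra.single g a = a • MonoidAlgebra.single g (1 : C) := by simp
    rw [this, map_smul, map_smul, h]

/-- The basis element of `C[W_J(1)]` attached to `w`. -/
abbrev vb (C : Type*) [CommRing C] {J : Set b.support} (w : D.lev J) : MonoidAlgebra C (D.lev J) :=
  MonoidAlgebra.single w 1

theorem vb_mul {J : Set b.support} (v w : D.lev J) : vb C v * vb C w = vb C (v * w) := by
  simp [MonoidAlgebra.single_mul_single]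

theorem Datum.conj_mem_refl (w : W1) {r : W1} (hr : (r : W1 ⧸ D.Zk) ∈ D.refl Set.univ) :
    ((w * r * w⁻¹ : W1) : W1 ⧸ D.Zk) ∈ D.refl Set.univ := by
  obtain ⟨i, hi, k, e⟩ := hr
  obtain ⟨j, hj⟩ := (exists_mapsRoot b (D.proj_mem w⁻¹)).2 i
  obtain ⟨l, -, e'⟩ := D.affRoot_comp_act1 _ hj (-k)
  have := D.conj_aff_affRefl _ e'
  refine ⟨j, (hj.mem_levRoots_iff b (D.proj_mem w⁻¹)).2 hi, -(-k + l), ?_⟩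
  rw [← this, QuotientGroup.mk_mul, QuotientGroup.mk_mul, e, QuotientGroup.mk_inv, inv_inv]
  congr 3
  simp

namespace Param

variable (p : Param D C) {J : Set b.support}

/-- The element `c_s`, in the group algebra of `W_J(1)`. -/
def cV (J : Set b.support) (s : W1) : MonoidAlgebra C (D.lev J) :=
  zlin (fun t => vb C (D.zin J t)) (p.c s)

theorem vb_mul_cV (x : D.lev J) {r : W1} (hr : (r : W1 ⧸ D.Zk) ∈ D.refl Set.univ) :
    vb C x * p.cV J r = p.cV J (x * r * (x : W1)⁻¹) * vb C x := by
  rw [cV, cV, p.c_conj r hr, zlin_mapDomain, zlin, zlin, Finsupp.mul_sum, Finsupp.sum_mul]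
  refine Finsupp.sum_congr fun t _ => ?_
  rw [mul_smul_comm, smul_mul_assoc, vb_mul, vb_mul]
  congr 2
  ext
  simp [Datum.zin, MulAut.conjNormal_apply]

theorem cV_zk_mul (z : D.Zk) {r : W1} (hr : (r : W1 ⧸ D.Zk) ∈ D.refl Set.univ) :
    p.cV J (z * r) = vb C (D.zin J z) * p.cV J r := by
  rw [cV, cV, p.c_mul r hr, zlin_eq_linExt, zlin_eq_linExt]
  generalize p.c r = x
  induction x using MonoidAlgebra.induction_linear with
  | zero => simp
  | add x y hx hy => rw [mul_add, map_add, map_add, mul_add, hx, hy]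
  | single t a =>
    rw [MonoidAlgebra.single_mul_single, linExt_single, linExt_single, mul_smul_comm, vb_mul,
      one_mul]
    rfl

open Classical in
/-- The left multiplication by `T_s`, `s` simple, in the regular representation on `C[W_J(1)]`, where
`w` stands for `T_w`. -/
def opL (J : Set b.support) (s : D.lev J) :
    MonoidAlgebra C (D.lev J) →ₗ[C] MonoidAlgebra C (D.lev J) :=
  linExt fun w => if D.len J w < D.len J (s * w : D.lev J) then vb C (s * w) else
    p.q (s : W1) • vb C (s * w) + p.cV J s * vb C w

open Classical in
/-- The right multiplication by `T_t`, `t` simple, in the regular representation. -/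
def opR (J : Set b.support) (t : D.lev J) :
    MonoidAlgebra C (D.lev J) →ₗ[C] MonoidAlgebra C (D.lev J) :=
  linExt fun w => if D.len J w < D.len J (w * t : D.lev J) then vb C (w * t) else
    p.q (t : W1) • vb C (w * t) + vb C w * p.cV J t

variable {p}

theorem opL_of_lt {s w : D.lev J} (h : D.len J w < D.len J (s * w : D.lev J)) :
    p.opL J s (vb C w) = vb C (s * w) := by
  rw [opL, linExt_single, if_pos h, one_smul]

theorem opL_of_not_lt {s w : D.lev J} (h : ¬ D.len J w < D.len J (s * w : D.lev J)) :
    p.opL J s (vb C w) = p.q (s : W1) • vb C (s * w) + p.cV J s * vb C w := by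
  rw [opL, linExt_single, if_neg h, one_smul]

theorem opR_of_lt {s w : D.lev J} (h : D.len J w < D.len J (w * s : D.lev J)) :
    p.opR J s (vb C w) = vb C (w * s) := by
  rw [opR, linExt_single, if_pos h, one_smul]

theorem opR_of_not_lt {s w : D.lev J} (h : ¬ D.len J w < D.len J (w * s : D.lev J)) :
    p.opR J s (vb C w) = p.q (s : W1) • vb C (w * s) + vb C w * p.cV J s := by
  rw [opR, linExt_single, if_neg h, one_smul]

theorem len_mul_of_len_zero {u w : D.lev J} (hu : D.len J u = 0) :
    D.len J (u * w : D.lev J) = D.len J w := by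
  have := D.len_mul_of_len_eq_zero' w.2 u.2 hu
  rwa [hu, zero_add] at this

theorem len_mul_of_len_zero' {u w : D.lev J} (hu : D.len J u = 0) :
    D.len J (w * u : D.lev J) = D.len J w := by
  have := D.len_mul_of_len_eq_zero w.2 u.2 hu
  rwa [hu, add_zero] at this

theorem opL_mul_vb (s : D.lev J) {u : D.lev J} (hu : D.len J u = 0)
    (x : MonoidAlgebra C (D.lev J)) : p.opL J s (x * vb C u) = p.opL J s x * vb C u := by
  suffices h : p.opL J s ∘ₗ LinearMap.mulRight C (vb C u) =
      LinearMap.mulRight C (vb C u) ∘ₗ p.opL J s from LinearMap.congr_fun h x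
  refine lhom_ext_single fun w => ?_
  simp only [LinearMap.comp_apply, LinearMap.mulRight_apply]
  rw [vb_mul]
  have h1 : D.len J (w * u : D.lev J) = D.len J w := len_mul_of_len_zero' hu
  have h2 : D.len J (s * (w * u) : D.lev J) = D.len J (s * w : D.lev J) := by
    rw [← mul_assoc]; exact len_mul_of_len_zero' hu
  by_cases h : D.len J w < D.len J (s * w : D.lev J)
  · rw [opL_of_lt h, opL_of_lt (by rwa [h1, h2]), vb_mul, mul_assoc]
  · rw [opL_of_not_lt h, opL_of_not_lt (by rwa [h1, h2]), add_mul, smul_mul_assoc, vb_mul,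
      mul_assoc, mul_assoc, vb_mul]

theorem opR_vb_mul (s : D.lev J) {u : D.lev J} (hu : D.len J u = 0)
    (x : MonoidAlgebra C (D.lev J)) : p.opR J s (vb C u * x) = vb C u * p.opR J s x := by
  suffices h : p.opR J s ∘ₗ LinearMap.mulLeft C (vb C u) =
      LinearMap.mulLeft C (vb C u) ∘ₗ p.opR J s from LinearMap.congr_fun h x
  refine lhom_ext_single fun w => ?_
  simp only [LinearMap.comp_apply, LinearMap.mulLeft_apply]
  rw [vb_mul]
  have h1 : D.len J (u * w : D.lev J) = D.len J w := len_mul_of_len_zero hu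
  have h2 : D.len J (u * w * s : D.lev J) = D.len J (w * s : D.lev J) := by
    rw [mul_assoc]; exact len_mul_of_len_zero hu
  by_cases h : D.len J w < D.len J (w * s : D.lev J)
  · rw [opR_of_lt h, opR_of_lt (by rwa [h1, h2]), vb_mul, mul_assoc]
  · rw [opR_of_not_lt h, opR_of_not_lt (by rwa [h1, h2]), mul_add, mul_smul_comm, vb_mul,
      mul_assoc u w s, ← vb_mul u w, mul_assoc]

theorem opL_mul_cV (s : D.lev J) (r : W1) (x : MonoidAlgebra C (D.lev J)) :
    p.opL J s (x * p.cV J r) = p.opL J s x * p.cV J r := by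
  rw [cV, zlin, Finsupp.mul_sum, Finsupp.mul_sum, Finsupp.sum, Finsupp.sum, map_sum]
  refine Finset.sum_congr rfl fun t _ => ?_
  rw [mul_smul_comm, map_smul, opL_mul_vb s (u := D.zin J t) (D.len_zk J t), mul_smul_comm]

theorem opR_cV_mul (s : D.lev J) (r : W1) (x : MonoidAlgebra C (D.lev J)) :
    p.opR J s (p.cV J r * x) = p.cV J r * p.opR J s x := by
  rw [cV, zlin, Finsupp.sum_mul, Finsupp.sum_mul, Finsupp.sum, Finsupp.sum, map_sum]
  refine Finset.sum_congr rfl fun t _ => ?_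
  rw [smul_mul_assoc, map_smul, opR_vb_mul s (u := D.zin J t) (D.len_zk J t), smul_mul_assoc]

theorem q_eq_of_exchange {s t w : W1} (ht : (t : W1 ⧸ D.Zk) ∈ D.refl Set.univ) {z : D.Zk}
    (h : s * w = z * (w * t)) : p.q s = p.q t := by
  rw [← p.q_conj _ ht (w : W1 ⧸ D.Zk)]
  congr 1
  rw [← QuotientGroup.mk_inv, ← QuotientGroup.mk_mul, ← QuotientGroup.mk_mul]
  rw [← mul_inv_eq_iff_eq_mul.2 (show s * w = s * w from rfl), h]
  have : ((z : W1) : W1 ⧸ D.Zk) = 1 := (QuotientGroup.eq_one_iff _).2 z.2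
  simp [QuotientGroup.mk_mul, this]

theorem cV_eq_of_exchange {s t w : D.lev J} (ht : ((t : W1) : W1 ⧸ D.Zk) ∈ D.refl Set.univ)
    {z : D.Zk} (h : s * w = D.zin J z * (w * t)) :
    vb C (s * w) * p.cV J t = p.cV J s * vb C (w * t) := by
  have hs : (s : W1) = z * ((w * t : D.lev J) * t * ((w * t : D.lev J) : W1)⁻¹) := by
    have h' := congrArg (Subtype.val) h
    change (s : W1) * w = z * (w * t) at h'
    rw [eq_mul_inv_of_mul_eq h']
    push_cast
    group
  have hr : ((((w * t : D.lev J) : W1) * t * ((w * t : D.lev J) : W1)⁻¹ : W1) : W1 ⧸ D.Zk) ∈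
      D.refl Set.univ := D.conj_mem_refl _ ht
  rw [h, ← vb_mul, mul_assoc, p.vb_mul_cV _ ht, ← mul_assoc, ← p.cV_zk_mul _ hr, ← hs]

/-- Left and right multiplications by simple elements commute. If `s w` and `w t` agree up to `Z_κ`,
then `q_s = q_t` and the values `c_s` and `c_t` correspond to each other; otherwise the two length
comparisons do not influence each other. -/
theorem opL_opR_comm {s t : D.lev J} (hs : D.IsSimple J s) (ht : D.IsSimple J t)
    (x : MonoidAlgebra C (D.lev J)) : p.opL J s (p.opR J t x) = p.opR J t (p.opL J s x) := by
  suffices h : p.opL J s ∘ₗ p.opR J t = p.opR J t ∘ₗ p.opL J s from LinearMap.congr_fun h x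
  refine lhom_ext_single fun w => ?_
  rw [LinearMap.comp_apply, LinearMap.comp_apply]
  obtain ⟨f, hf⟩ := D.exists_simpleRoot hs
  obtain ⟨g, hg⟩ := D.exists_simpleRoot ht
  have kL : ∀ y : D.lev J, D.len J y < D.len J (s * y : D.lev J) ↔ 0 < f (D.pt y) :=
    fun y => hf.len_mul_iff y.2
  have kR : ∀ y : D.lev J, D.len J y < D.len J (y * t : D.lev J) ↔ 0 < g (D.pt (y : W1)⁻¹) :=
    fun y => hg.len_mul_right_iff y.2
  by_cases hfg : f ∘ D.act1 (w : W1) = g ∨ f ∘ D.act1 (w : W1) = -g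
  · -- the exchange case: `s w` and `w t` agree up to `Z_κ`
    obtain ⟨z, hz⟩ := hf.exchange hg hfg
    have hq : p.q (s : W1) = p.q (t : W1) := q_eq_of_exchange (D.refl_univ ht.1) hz
    have hc : vb C (s * w) * p.cV J t = p.cV J s * vb C (w * t) :=
      cV_eq_of_exchange (D.refl_univ ht.1) (Subtype.ext hz)
    have e1 : f (D.pt (w * t : D.lev J)) = -f (D.pt w) := by
      have e1 : f (D.pt (w * t : D.lev J)) = (f ∘ D.act1 (w : W1)) (D.pt t) := by
        change f (D.pt ((w : W1) * t)) = _
        rw [D.pt_mul]; rfl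
      have e2 : f (D.pt w) = (f ∘ D.act1 (w : W1)) (basePoint b) := rfl
      have e3 : g (D.pt t) = -g (basePoint b) := hg.apply_act1 _
      rw [e1, e2]
      rcases hfg with h | h <;> rw [h] <;> simp [e3]
    have e2 : g (D.pt (w : W1)⁻¹) * f (D.pt w) > 0 := by
      have e2 : f (D.pt w) = (f ∘ D.act1 (w : W1)) (basePoint b) := rfl
      have e3 : f (basePoint b) = (f ∘ D.act1 (w : W1)) (D.pt (w : W1)⁻¹) :=
        (congrArg f (D.act1_act1_inv (w : W1) _)).symm
      have h1 := hf.pos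
      have h2 := hg.pos
      rcases hfg with h | h
      · rw [e3, h] at h1
        rw [e2, h]
        positivity
      · rw [e3, h, Pi.neg_apply] at h1
        rw [e2, h, Pi.neg_apply]
        nlinarith
    have e3 : g (D.pt ((s * w : D.lev J) : W1)⁻¹) = -g (D.pt (w : W1)⁻¹) := by
      have hz' : ((s * w : D.lev J) : W1)⁻¹ = (t : W1)⁻¹ * ((w : W1)⁻¹ * (z : W1)⁻¹) := by
        change ((s : W1) * w)⁻¹ = _
        rw [hz]; group
      have : D.pt ((w : W1)⁻¹ * (z : W1)⁻¹) = D.pt (w : W1)⁻¹ := by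
        rw [D.pt_mul, Datum.pt, Datum.pt]
        have := D.act1_zk z⁻¹
        rw [InvMemClass.coe_inv] at this
        rw [this]
        rfl
      rw [hz', hg.inv.apply_pt_mul, this]
    rcases lt_or_gt_of_ne ((D.regular_pt w) f (affRoots_mono (Set.subset_univ J) hf.mem)) with h | h
    · have h' : g (D.pt (w : W1)⁻¹) < 0 := by nlinarith
      have hL := opL_of_not_lt (p := p) (mt (kL w).1 (not_lt.2 h.le))
      have hR := opR_of_not_lt (p := p) (mt (kR w).1 (not_lt.2 h'.le))
      have hL' := opL_of_lt (p := p) ((kL (w * t)).2 (by rw [e1]; linarith))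
      have hR' := opR_of_lt (p := p) ((kR (s * w)).2 (by rw [e3]; linarith))
      rw [hL, hR, map_add, map_add, map_smul, map_smul, opL_mul_cV, opR_cV_mul, hL, hR, hL', hR',
        add_mul, mul_add, smul_mul_assoc, mul_smul_comm, hq, hc, mul_assoc, mul_assoc]
    · have h' : 0 < g (D.pt (w : W1)⁻¹) := by nlinarith
      have hL := opL_of_lt (p := p) ((kL w).2 h)
      have hR := opR_of_lt (p := p) ((kR w).2 h')
      have hL' := opL_of_not_lt (p := p) (mt (kL (w * t)).1 (by rw [e1]; linarith))
      have hR' := opR_of_not_lt (p := p) (mt (kR (s * w)).1 (by rw [e3]; linarith))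
      rw [hL, hR, hL', hR', hq, hc, mul_assoc]
  · have e1 : 0 < f (D.pt (w * t : D.lev J)) ↔ 0 < f (D.pt w) := hf.pos_pt_mul_iff hg w.2 hfg
    have e2 : 0 < g (D.pt ((s * w : D.lev J) : W1)⁻¹) ↔ 0 < g (D.pt (w : W1)⁻¹) := by
      have e3 : ((s * w : D.lev J) : W1)⁻¹ = (w : W1)⁻¹ * (s : W1)⁻¹ := mul_inv_rev (s : W1) w
      rw [e3]
      refine hg.pos_pt_mul_iff hf.inv (inv_mem w.2) fun h => hfg ?_
      have key : ∀ k : N → ℝ, g ∘ D.act1 (w : W1)⁻¹ = k → g = k ∘ D.act1 (w : W1) := by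
        rintro _ rfl
        funext x
        simp only [Function.comp_apply, D.act1_inv_act1]
      rcases h with h | h
      · exact Or.inl (key _ h).symm
      · right
        rw [key _ h]
        funext x
        simp
    rw [← kL, ← kL] at e1
    rw [← kR, ← kR] at e2
    by_cases h : D.len J w < D.len J (s * w : D.lev J) <;>
      by_cases h' : D.len J w < D.len J (w * t : D.lev J)
    · rw [opR_of_lt h', opL_of_lt h, opL_of_lt (e1.2 h), opR_of_lt (e2.2 h'), mul_assoc]
    · rw [opR_of_not_lt h', opL_of_lt h, map_add, map_smul, opL_mul_cV, opL_of_lt (e1.2 h),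
        opL_of_lt h, opR_of_not_lt (mt e2.1 h'), mul_assoc]
    · rw [opR_of_lt h', opL_of_not_lt h, map_add, map_smul, opR_cV_mul, opR_of_lt (e2.2 h'),
        opR_of_lt h', opL_of_not_lt (mt e1.1 h), mul_assoc]
    · rw [opR_of_not_lt h', opL_of_not_lt h, map_add, map_add, map_smul, map_smul, opL_mul_cV,
        opR_cV_mul, opL_of_not_lt (mt e1.1 h), opL_of_not_lt h, opR_of_not_lt (mt e2.1 h'),
        opR_of_not_lt h', smul_add, smul_add, add_mul, mul_add, smul_mul_assoc, mul_smul_comm,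
        smul_smul, smul_smul, mul_comm (p.q (s : W1)), mul_assoc, mul_assoc]
      abel

end Param

end Regular

/-! ### The regular representation -/

section Basis

variable {ι M N : Type*} [AddCommGroup M] [Module ℝ M] [AddCommGroup N] [Module ℝ N]
  [Finite ι] {R : RootPairing ι ℝ M N} [R.IsCrystallographic] [R.IsReduced] {b : R.Base}
  {W1 : Type*} [Group W1] {D : Datum b W1} {C : Type*} [CommRing C] {J : Set b.support}

theorem Datum.exists_simple_mul {w : D.lev J} (h : D.len J w ≠ 0) :
    ∃ s w' : D.lev J, D.IsSimple J s ∧ w = s * w' ∧ D.len J w = D.len J w' + 1 := by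
  obtain ⟨s, f, hs, hn⟩ := D.exists_simpleRoot_neg w.2 h
  refine ⟨⟨s⁻¹, inv_mem hs.lev_mem⟩, ⟨s, hs.lev_mem⟩ * w, hs.inv.isSimple, ?_, ?_⟩
  · ext; simp
  · exact hs.len_mul_of_neg w.2 hn

theorem Datum.exists_mul_simple {w : D.lev J} (h : D.len J w ≠ 0) :
    ∃ s w' : D.lev J, D.IsSimple J s ∧ w = w' * s ∧ D.len J w = D.len J w' + 1 := by
  rw [← D.len_inv w.2] at h
  obtain ⟨s, w', hs, e, hl⟩ := Datum.exists_simple_mul (w := w⁻¹) h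
  refine ⟨s⁻¹, w'⁻¹, D.isSimple_inv s.2 hs, by rw [← mul_inv_rev, ← e, inv_inv], ?_⟩
  rw [← D.len_inv w.2]
  exact hl.trans (by rw [InvMemClass.coe_inv, D.len_inv w'.2])

theorem Datum.len_lev_one : D.len J ((1 : D.lev J) : W1) = 0 := by
  have := D.len_zk J 1
  simpa using this

theorem Datum.len_lev_mul_le (v w : D.lev J) :
    D.len J (v * w : D.lev J) ≤ D.len J v + D.len J w := D.len_mul_le v.2 w.2

namespace Param

variable (p : Param D C)

/-- The operators that commute with right multiplication in the regular representation. -/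
def commutant (J : Set b.support) : Subalgebra C (Module.End C (MonoidAlgebra C (D.lev J))) :=
  Subalgebra.centralizer C ({F | ∃ t : D.lev J, D.IsSimple J t ∧ F = p.opR J t} ∪
    {F | ∃ u : D.lev J, D.len J u = 0 ∧ F = LinearMap.mulRight C (vb C u)})

theorem mem_commutant_iff {F : Module.End C (MonoidAlgebra C (D.lev J))} :
    F ∈ p.commutant J ↔
      (∀ t : D.lev J, D.IsSimple J t → ∀ x, F (p.opR J t x) = p.opR J t (F x)) ∧
      ∀ u : D.lev J, D.len J u = 0 → ∀ x, F (x * vb C u) = F x * vb C u := by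
  rw [commutant, Subalgebra.mem_centralizer_iff]
  constructor
  · intro h
    refine ⟨fun t ht x => ?_, fun u hu x => ?_⟩
    · exact (LinearMap.congr_fun (h _ (Or.inl ⟨t, ht, rfl⟩)) x).symm
    · exact (LinearMap.congr_fun (h _ (Or.inr ⟨u, hu, rfl⟩)) x).symm
  · rintro ⟨h1, h2⟩ _ (⟨t, ht, rfl⟩ | ⟨u, hu, rfl⟩)
    · exact LinearMap.ext fun x => (h1 t ht x).symm
    · exact LinearMap.ext fun x => (h2 u hu x).symm

theorem opL_mem_commutant {s : D.lev J} (hs : D.IsSimple J s) : p.opL J s ∈ p.commutant J :=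
  p.mem_commutant_iff.2 ⟨fun _ ht x => opL_opR_comm hs ht x, fun _ hu x => opL_mul_vb s hu x⟩

theorem mulLeft_mem_commutant {u : D.lev J} (hu : D.len J u = 0) :
    LinearMap.mulLeft C (vb C u) ∈ p.commutant J :=
  p.mem_commutant_iff.2 ⟨fun t _ x => (opR_vb_mul t hu x).symm, fun _ _ x => (mul_assoc _ x _).symm⟩

/-- The vector `v_1` generates the regular representation under right multiplication. -/
theorem commutant_ext {F G : Module.End C (MonoidAlgebra C (D.lev J))} (hF : F ∈ p.commutant J)
    (hG : G ∈ p.commutant J) (h : F (vb C 1) = G (vb C 1)) : F = G := by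
  rw [mem_commutant_iff] at hF hG
  refine lhom_ext_single fun w => ?_
  induction hn : D.len J w generalizing w with
  | zero =>
    have := hF.2 w hn (vb C 1)
    rw [h, ← hG.2 w hn, vb_mul, one_mul] at this
    exact this
  | succ n ih =>
    obtain ⟨s, w', hs, rfl, hl⟩ := Datum.exists_mul_simple (w := w) (by lia)
    have h1 : p.opR J s (vb C w') = vb C (w' * s) := opR_of_lt (by lia)
    change F (vb C (w' * s)) = G (vb C (w' * s))
    rw [← h1, hF.1 s hs, hG.1 s hs]
    exact congrArg _ (ih w' (by lia))

/-- Left multiplication by `T_v`, as the product of the left multiplications along a reduced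
decomposition of `v`. -/
theorem exists_commutant (v : D.lev J) : ∃ A ∈ p.commutant J, ∀ w : D.lev J,
    D.len J (v * w : D.lev J) = D.len J v + D.len J w → A (vb C w) = vb C (v * w) := by
  induction hn : D.len J v generalizing v with
  | zero => exact ⟨_, p.mulLeft_mem_commutant hn, fun w _ => vb_mul v w⟩
  | succ n ih =>
    obtain ⟨s, v', hs, rfl, hl⟩ := Datum.exists_simple_mul (w := v) (by lia)
    obtain ⟨A, hA, hA'⟩ := ih v' (by lia)
    refine ⟨p.opL J s * A, mul_mem (p.opL_mem_commutant hs) hA, fun w hw => ?_⟩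
    have h1 := Datum.len_lev_mul_le v' w
    have h2 := Datum.len_lev_mul_le s (v' * w)
    rw [hs.2, ← mul_assoc] at h2
    rw [Module.End.mul_apply, hA' w (by lia), opL_of_lt, mul_assoc]
    rw [← mul_assoc]
    lia

/-- The left multiplication by `T_v` in the regular representation, for arbitrary `v`. -/
def opA (v : D.lev J) : Module.End C (MonoidAlgebra C (D.lev J)) :=
  (p.exists_commutant v).choose

theorem opA_mem (v : D.lev J) : p.opA v ∈ p.commutant J := (p.exists_commutant v).choose_spec.1

theorem opA_vb {v w : D.lev J} (h : D.len J (v * w : D.lev J) = D.len J v + D.len J w) :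
    p.opA v (vb C w) = vb C (v * w) := (p.exists_commutant v).choose_spec.2 w h

theorem opA_vb_one (v : D.lev J) : p.opA v (vb C 1) = vb C v := by
  rw [opA_vb, mul_one]
  rw [mul_one, Datum.len_lev_one, add_zero]

theorem opA_of_isSimple {s : D.lev J} (hs : D.IsSimple J s) : p.opA s = p.opL J s := by
  refine p.commutant_ext (p.opA_mem s) (p.opL_mem_commutant hs) ?_
  rw [opA_vb_one, opL_of_lt, mul_one]
  rw [mul_one, Datum.len_lev_one, hs.2]
  exact zero_lt_one

theorem opA_of_len_eq_zero {u : D.lev J} (hu : D.len J u = 0) :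
    p.opA u = LinearMap.mulLeft C (vb C u) := by
  refine p.commutant_ext (p.opA_mem u) (p.mulLeft_mem_commutant hu) ?_
  rw [opA_vb_one, LinearMap.mulLeft_apply, vb_mul, mul_one]

theorem zlin_opA (x : MonoidAlgebra C D.Zk) (y : MonoidAlgebra C (D.lev J)) :
    zlin (fun t => p.opA (D.zin J t)) x y = zlin (fun t => vb C (D.zin J t)) x * y := by
  rw [zlin, zlin, Finsupp.sum, Finsupp.sum, LinearMap.sum_apply, Finset.sum_mul]
  refine Finset.sum_congr rfl fun t _ => ?_
  rw [LinearMap.smul_apply, p.opA_of_len_eq_zero (u := D.zin J t) (D.len_zk J t),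
    LinearMap.mulLeft_apply, smul_mul_assoc]

theorem zlin_opA_mem (x : MonoidAlgebra C D.Zk) :
    zlin (fun t => p.opA (D.zin J t)) x ∈ p.commutant J :=
  sum_mem fun _ _ => Subalgebra.smul_mem _ (p.opA_mem _) _

/-- The regular representation of `H_J`. The defining relations hold since elements of the commutant
are determined by their value at `v_1`. -/
def rep (J : Set b.support) : p.Hecke J →ₐ[C] Module.End C (MonoidAlgebra C (D.lev J)) :=
  p.lift J p.opA
    (p.commutant_ext (p.opA_mem 1) (one_mem _) (p.opA_vb_one 1))
    (fun v w h => p.commutant_ext (mul_mem (p.opA_mem v) (p.opA_mem w)) (p.opA_mem _) (by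
      rw [Module.End.mul_apply, opA_vb_one, opA_vb_one, opA_vb _ h]))
    (fun s hs => by
      refine p.commutant_ext (mul_mem (p.opA_mem s) (p.opA_mem s))
        (add_mem (Subalgebra.smul_mem _ (p.opA_mem _) _)
          (mul_mem (p.zlin_opA_mem _) (p.opA_mem s))) ?_
      rw [Module.End.mul_apply, opA_vb_one, p.opA_of_isSimple hs, opL_of_not_lt, LinearMap.add_apply,
        LinearMap.smul_apply, opA_vb_one, Module.End.mul_apply, ← p.opA_of_isSimple hs, opA_vb_one,
        zlin_opA]
      · rfl
      · have h1 : D.len J (s * s : D.lev J) = 0 := by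
          obtain ⟨f, hf⟩ := D.exists_simpleRoot hs
          exact D.len_zk J ⟨_, hf.mul_self_mem⟩
        lia)

theorem rep_T (v : D.lev J) : p.rep J (p.T J v) = p.opA v := p.lift_T J _ _ _ _ v

theorem rep_T_vb {v w : D.lev J} (h : D.len J (v * w : D.lev J) = D.len J v + D.len J w) :
    p.rep J (p.T J v) (vb C w) = vb C (v * w) := by rw [rep_T, opA_vb _ h]

theorem rep_T_isSimple {s : D.lev J} (hs : D.IsSimple J s) : p.rep J (p.T J s) = p.opL J s := by
  rw [rep_T, opA_of_isSimple _ hs]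

theorem rep_T_len_zero {u : D.lev J} (hu : D.len J u = 0) (x : MonoidAlgebra C (D.lev J)) :
    p.rep J (p.T J u) x = vb C u * x := by
  rw [rep_T, opA_of_len_eq_zero _ hu, LinearMap.mulLeft_apply]

/-! ### The elements `T_w` span the Hecke algebra -/

theorem T_induction {P : p.Hecke J → Prop} (hT : ∀ w, P (p.T J w))
    (hadd : ∀ x y, P x → P y → P (x + y)) (hmul : ∀ x y, P x → P y → P (x * y))
    (hC : ∀ a, P (algebraMap C _ a)) (x : p.Hecke J) : P x := by
  obtain ⟨x, rfl⟩ := RingQuot.mkAlgHom_surjective C (p.Rel J) x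
  induction x using FreeAlgebra.induction with
  | grade0 a => simpa using hC a
  | grade1 w => exact hT w
  | mul x y hx hy => rw [map_mul]; exact hmul _ _ hx hy
  | add x y hx hy => rw [map_add]; exact hadd _ _ hx hy

/-- `H_J` is generated by the `T_s`, `s` simple, and the `T_u` with `u` of length zero. -/
theorem simple_induction {P : p.Hecke J → Prop} (hs : ∀ s : D.lev J, D.IsSimple J s → P (p.T J s))
    (hu : ∀ u : D.lev J, D.len J u = 0 → P (p.T J u))
    (hadd : ∀ x y, P x → P y → P (x + y)) (hmul : ∀ x y, P x → P y → P (x * y))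
    (hC : ∀ a, P (algebraMap C _ a)) (x : p.Hecke J) : P x := by
  refine p.T_induction (fun w => ?_) hadd hmul hC x
  induction hn : D.len J w generalizing w with
  | zero => exact hu w hn
  | succ n ih =>
    obtain ⟨s, w', hs', rfl, hl⟩ := Datum.exists_simple_mul (w := w) (by lia)
    rw [← T_braid]
    · exact hmul _ _ (hs s hs') (ih w' (by lia))
    · rw [hl, hs'.2, add_comm]

theorem T_mul_of_lt {s w : D.lev J} (hs : D.IsSimple J s)
    (h : D.len J w < D.len J (s * w : D.lev J)) : p.T J s * p.T J w = p.T J (s * w) := by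
  refine p.T_braid J s w ?_
  obtain ⟨f, hf⟩ := D.exists_simpleRoot hs
  rw [hs.2, add_comm]
  exact hf.len_mul_of_pos w.2 ((hf.len_mul_iff w.2).1 h)

theorem T_mul_of_not_lt {s w : D.lev J} (hs : D.IsSimple J s)
    (h : ¬ D.len J w < D.len J (s * w : D.lev J)) :
    p.T J s * p.T J w = p.q (s : W1) • p.T J (s * w) + p.cT J s * p.T J w := by
  obtain ⟨f, hf⟩ := D.exists_simpleRoot hs
  have h1 : f (D.pt w) < 0 := by
    rw [← (D.regular_pt w).not_pos hf.mem, ← hf.len_mul_iff w.2]; exact h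
  have h2 : p.T J s * p.T J (s⁻¹ * w) = p.T J w := by
    rw [T_mul_of_lt _ hs, mul_inv_cancel_left]
    rw [mul_inv_cancel_left]
    have := hf.inv.len_mul_of_neg w.2 h1
    rw [this]
    exact Nat.lt_succ_self _
  have h3 : p.T J (s * s) * p.T J (s⁻¹ * w) = p.T J (s * w) := by
    have := p.T_zk_mul J ⟨_, hf.mul_self_mem⟩ (s⁻¹ * w)
    have e : D.zin J ⟨_, hf.mul_self_mem⟩ = s * s := rfl
    rw [e] at this
    rw [this, mul_assoc, mul_inv_cancel_left]
  rw [← h2, ← mul_assoc, p.T_quad J s hs, add_mul, smul_mul_assoc, h3, mul_assoc, h2]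

/-- The linear map `C[W_J(1)] → H_J`, `w ↦ T_w`. -/
def theta (J : Set b.support) : MonoidAlgebra C (D.lev J) →ₗ[C] p.Hecke J := linExt (p.T J)

theorem theta_vb (w : D.lev J) : p.theta J (vb C w) = p.T J w := by
  rw [theta, linExt_single, one_smul]

theorem theta_zin_mul (t : D.Zk) (x : MonoidAlgebra C (D.lev J)) :
    p.theta J (vb C (D.zin J t) * x) = p.T J (D.zin J t) * p.theta J x := by
  suffices h : p.theta J ∘ₗ LinearMap.mulLeft C (vb C (D.zin J t)) =
      LinearMap.mulLeft C (p.T J (D.zin J t)) ∘ₗ p.theta J from LinearMap.congr_fun h x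
  refine lhom_ext_single fun w => ?_
  simp only [LinearMap.comp_apply, LinearMap.mulLeft_apply]
  rw [vb_mul, theta_vb, theta_vb, T_zk_mul]

theorem theta_cV_mul (s : W1) (x : MonoidAlgebra C (D.lev J)) :
    p.theta J (p.cV J s * x) = p.cT J s * p.theta J x := by
  rw [cV, cT, zlin, zlin, Finsupp.sum_mul, Finsupp.sum_mul, Finsupp.sum, Finsupp.sum, map_sum]
  refine Finset.sum_congr rfl fun t _ => ?_
  rw [smul_mul_assoc, map_smul, theta_zin_mul, smul_mul_assoc]

theorem theta_rep (h : p.Hecke J) (x : MonoidAlgebra C (D.lev J)) :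
    p.theta J (p.rep J h x) = h * p.theta J x := by
  induction h using p.simple_induction generalizing x with
  | hs s hs =>
    rw [rep_T_isSimple _ hs]
    suffices h : p.theta J ∘ₗ p.opL J s = LinearMap.mulLeft C (p.T J s) ∘ₗ p.theta J from
      LinearMap.congr_fun h x
    refine lhom_ext_single fun w => ?_
    simp only [LinearMap.comp_apply, LinearMap.mulLeft_apply]
    by_cases h : D.len J w < D.len J (s * w : D.lev J)
    · rw [opL_of_lt h, theta_vb, theta_vb, T_mul_of_lt _ hs h]
    · rw [opL_of_not_lt h, map_add, map_smul, theta_cV_mul, theta_vb, theta_vb,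
        T_mul_of_not_lt _ hs h]
  | hu u hu =>
    rw [rep_T_len_zero _ hu]
    suffices h : p.theta J ∘ₗ LinearMap.mulLeft C (vb C u) =
        LinearMap.mulLeft C (p.T J u) ∘ₗ p.theta J from LinearMap.congr_fun h x
    refine lhom_ext_single fun w => ?_
    simp only [LinearMap.comp_apply, LinearMap.mulLeft_apply]
    rw [vb_mul, theta_vb, theta_vb, T_braid]
    exact D.len_mul_of_len_eq_zero' w.2 u.2 hu
  | hadd y z hy hz => rw [map_add, LinearMap.add_apply, map_add, hy, hz, add_mul]
  | hmul y z hy hz => rw [map_mul, Module.End.mul_apply, hy, hz, mul_assoc]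
  | hC a => rw [AlgHom.commutes, Module.algebraMap_end_apply, map_smul, Algebra.smul_def]

/-- The regular representation is generated by `v_1`, with inverse `theta`. -/
theorem theta_rep_one (h : p.Hecke J) : p.theta J (p.rep J h (vb C 1)) = h := by
  rw [theta_rep, theta_vb, T_one, mul_one]

/-- The `T_w` span `H_J`. -/
theorem hecke_lhom_ext {X : Type*} [AddCommMonoid X] [Module C X] {F G : p.Hecke J →ₗ[C] X}
    (h : ∀ w, F (p.T J w) = G (p.T J w)) : F = G := by
  refine LinearMap.ext fun x => ?_
  rw [← p.theta_rep_one x]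
  have : F ∘ₗ p.theta J = G ∘ₗ p.theta J :=
    lhom_ext_single fun w => by simp only [LinearMap.comp_apply, theta_vb, h]
  exact LinearMap.congr_fun this _

end Param

end Basis

/-! ### The elements `T_w^*` -/

section Star

variable {ι M N : Type*} [AddCommGroup M] [Module ℝ M] [AddCommGroup N] [Module ℝ N]
  [Finite ι] {R : RootPairing ι ℝ M N} [R.IsCrystallographic] [R.IsReduced] {b : R.Base}
  {W1 : Type*} [Group W1] {D : Datum b W1} {C : Type*} [CommRing C] {J : Set b.support}

theorem mapDomain_neg {G G' : Type*} (f : G → G') (x : MonoidAlgebra C G) :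
    MonoidAlgebra.mapDomain f (-x) = -MonoidAlgebra.mapDomain f x :=
  eq_neg_of_add_eq_zero_left (by
    rw [← MonoidAlgebra.mapDomain_add, neg_add_cancel, MonoidAlgebra.mapDomain_zero])

namespace Param

theorem exists_isReduced (w : D.lev J) : ∃ s u, IsReduced J w s u := by
  induction hn : D.len J w generalizing w with
  | zero => exact ⟨[], w, by simp, hn.symm, hn, by simp⟩
  | succ n ih =>
    obtain ⟨a, w', ha, rfl, hl⟩ := Datum.exists_simple_mul (w := w) (by lia)
    obtain ⟨s, u, h1, h2, h3, rfl⟩ := ih w' (by lia)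
    refine ⟨a :: s, u, ?_, ?_, h3, ?_⟩
    · rintro x (_ | ⟨_, hx⟩)
      exacts [ha, h1 x hx]
    · rw [List.length_cons, h2, hl]
    · rw [List.prod_cons, mul_assoc]

theorem len_prod_mul_le {s : List (D.lev J)} (hs : ∀ x ∈ s, D.IsSimple J x) {u : D.lev J}
    (hu : D.len J u = 0) : D.len J (s.prod * u : D.lev J) ≤ s.length := by
  induction s with
  | nil => simp [hu]
  | cons a s ih =>
    have h1 := ih fun x hx => hs x (List.mem_cons_of_mem _ hx)
    have h2 := Datum.len_lev_mul_le a (s.prod * u)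
    rw [(hs a List.mem_cons_self).2] at h2
    rw [List.prod_cons, List.length_cons, mul_assoc]
    lia

theorem IsReduced.of_cons {w a u : D.lev J} {s : List (D.lev J)} (h : IsReduced J w (a :: s) u) :
    D.IsSimple J a ∧ ∃ w', w = a * w' ∧ IsReduced J w' s u ∧ D.len J w = D.len J w' + 1 := by
  obtain ⟨h1, h2, h3, rfl⟩ := h
  have h4 : ∀ x ∈ s, D.IsSimple J x := fun x hx => h1 x (List.mem_cons_of_mem _ hx)
  have h5 := len_prod_mul_le h4 h3
  have ha := h1 a List.mem_cons_self
  have h6 := Datum.len_lev_mul_le a (s.prod * u)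
  rw [ha.2, ← mul_assoc, ← List.prod_cons, ← h2, List.length_cons] at h6
  refine ⟨ha, s.prod * u, by rw [List.prod_cons, mul_assoc], ⟨h4, by lia, h3, rfl⟩, ?_⟩
  rw [← h2, List.length_cons]
  lia

variable (p : Param D C)

/-- The element `T_s^* = T_s - c_s`. -/
def Ts (s : D.lev J) : p.Hecke J := p.T J s - p.cT J s

/-- The product `(T_{s₁} - c_{s₁}) ⋯ (T_{s_l} - c_{s_l}) T_u`. -/
def word (s : List (D.lev J)) (u : D.lev J) : p.Hecke J := (s.map p.Ts).prod * p.T J u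

theorem word_nil (u : D.lev J) : p.word [] u = p.T J u := by simp [word]

theorem word_cons (a : D.lev J) (s : List (D.lev J)) (u : D.lev J) :
    p.word (a :: s) u = p.Ts a * p.word s u := by simp [word, mul_assoc]

theorem Ts_mul_T {s : D.lev J} (hs : D.IsSimple J s) :
    p.Ts s * p.T J s = p.q (s : W1) • p.T J (s * s) := by
  rw [Ts, sub_mul, p.T_quad J s hs, add_sub_cancel_right]

theorem T_mul_Ts {s : D.lev J} (hs : D.IsSimple J s) :
    p.T J s * p.Ts s = p.q (s : W1) • p.T J (s * s) := by
  rw [Ts, mul_sub, p.T_quad J s hs, p.cT_comm J s hs, add_sub_cancel_right]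

theorem T_mul_sq_inv {s w : D.lev J} (hs : D.IsSimple J s) :
    p.T J w * p.T J (s * s)⁻¹ = p.T J (w * (s * s)⁻¹) := by
  obtain ⟨f, hf⟩ := D.exists_simpleRoot hs
  exact p.T_mul_zk J ⟨_, inv_mem hf.mul_self_mem⟩ w

theorem sq_inv_mul_T {s w : D.lev J} (hs : D.IsSimple J s) :
    p.T J (s * s)⁻¹ * p.T J w = p.T J ((s * s)⁻¹ * w) := by
  obtain ⟨f, hf⟩ := D.exists_simpleRoot hs
  exact p.T_zk_mul J ⟨_, inv_mem hf.mul_self_mem⟩ w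

theorem Ts_mul_T_inv {s : D.lev J} (hs : D.IsSimple J s) :
    p.Ts s * p.T J s⁻¹ = p.q (s : W1) • 1 := by
  have e : (s : D.lev J)⁻¹ = s * (s * s)⁻¹ := by group
  rw [e, ← p.T_mul_sq_inv hs, ← mul_assoc, p.Ts_mul_T hs, smul_mul_assoc, p.T_mul_sq_inv hs,
    mul_inv_cancel, T_one]

theorem T_inv_mul_Ts {s : D.lev J} (hs : D.IsSimple J s) :
    p.T J s⁻¹ * p.Ts s = p.q (s : W1) • 1 := by
  have e : (s : D.lev J)⁻¹ = (s * s)⁻¹ * s := by group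
  rw [e, ← p.sq_inv_mul_T hs, mul_assoc, p.T_mul_Ts hs, mul_smul_comm, p.sq_inv_mul_T hs,
    inv_mul_cancel, T_one]

/-- The products attached to `w` are inverse to `T_{w⁻¹}`, up to the product of the `q_s`. -/
theorem T_inv_mul_word {w u : D.lev J} {s : List (D.lev J)} (h : IsReduced J w s u) :
    p.T J w⁻¹ * p.word s u = (s.map fun x : D.lev J => p.q (x : W1)).prod • 1 ∧
      p.word s u * p.T J w⁻¹ = (s.map fun x : D.lev J => p.q (x : W1)).prod • 1 := by
  induction s generalizing w with
  | nil =>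
    obtain ⟨-, -, hu, rfl⟩ := h
    rw [word_nil, List.prod_nil, one_mul, List.map_nil, List.prod_nil, one_smul]
    have h1 : D.len J ((u⁻¹ : D.lev J) : W1) = 0 := (D.len_inv u.2).trans hu
    constructor
    · rw [T_braid, inv_mul_cancel, T_one]
      rw [inv_mul_cancel, Datum.len_lev_one, hu, h1]
    · rw [T_braid, mul_inv_cancel, T_one]
      rw [mul_inv_cancel, Datum.len_lev_one, hu, h1]
  | cons a s ih =>
    obtain ⟨ha, w', rfl, h', hl⟩ := h.of_cons
    obtain ⟨h1, h2⟩ := ih h'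
    have e : p.T J (a * w')⁻¹ = p.T J w'⁻¹ * p.T J a⁻¹ := by
      rw [T_braid, mul_inv_rev]
      rw [← mul_inv_rev, InvMemClass.coe_inv, InvMemClass.coe_inv, InvMemClass.coe_inv,
        D.len_inv (a * w').2, D.len_inv w'.2, D.len_inv a.2, hl, ha.2]
    rw [word_cons, e, List.map_cons, List.prod_cons]
    constructor
    · rw [mul_assoc, ← mul_assoc (p.T J a⁻¹), p.T_inv_mul_Ts ha, smul_one_mul, mul_smul_comm, h1,
        smul_smul]
    · rw [mul_assoc, ← mul_assoc (p.word s u), h2, smul_one_mul, mul_smul_comm, p.Ts_mul_T_inv ha,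
        smul_smul, mul_comm]

/-- The product of the parameters `q` along a reduced decomposition does not depend on the
decomposition. -/
theorem prod_q_unique {w u u' : D.lev J} {s s' : List (D.lev J)} (h : IsReduced J w s u)
    (h' : IsReduced J w s' u') :
    (s.map fun x : D.lev J => p.q (x : W1)).prod = (s'.map fun x : D.lev J => p.q (x : W1)).prod := by
  -- for the parameters `(q, 0)`, both are the value of `T_{w⁻¹} T_w`
  let p₀ : Param D C :=
    { q := p.q
      c := fun _ => 0
      q_conj := p.q_conj
      c_conj := fun _ _ _ => by simp
      c_mul := fun _ _ _ => by simp
      c_inv := fun _ _ => by simp }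
  have hT : ∀ x : D.lev J, p₀.Ts x = p₀.T J x := fun x => by
    have : p₀.cT J x = 0 := by
      change zlin _ (0 : MonoidAlgebra C D.Zk) = 0
      simp [zlin]
    rw [Ts, this, sub_zero]
  have key : ∀ (s : List (D.lev J)) (w u : D.lev J), IsReduced J w s u →
      p₀.word s u = p₀.T J w := by
    intro s
    induction s with
    | nil => rintro w u ⟨-, -, -, rfl⟩; rw [word_nil, List.prod_nil, one_mul]
    | cons a s ih =>
      intro w u h
      obtain ⟨ha, w', rfl, h', hl⟩ := h.of_cons
      rw [word_cons, ih w' u h', hT, T_braid]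
      rw [hl, ha.2, add_comm]
  have h1 := (p₀.T_inv_mul_word h).1
  have h2 := (p₀.T_inv_mul_word h').1
  rw [key _ _ _ h] at h1
  rw [key _ _ _ h', h1] at h2
  have h3 := congrArg (fun x => (p₀.rep J x (vb C 1)).coeff 1) h2
  simpa using h3

/-- If the `q_s` are not zero divisors, the product `T_w^*` is pinned down by `T_{w⁻¹} T_w^*` being a
scalar, which can be cancelled since `H_J` embeds into a free module. -/
theorem word_unique_of_isRegular (hq : ∀ r, IsRegular (p.q r)) {w u u' : D.lev J}
    {s s' : List (D.lev J)} (h : IsReduced J w s u) (h' : IsReduced J w s' u') :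
    p.word s u = p.word s' u' := by
  have h1 := (p.T_inv_mul_word h).2
  have h2 := (p.T_inv_mul_word h').1
  have h3 : (s.map fun x : D.lev J => p.q (x : W1)).prod • p.word s u =
      (s.map fun x : D.lev J => p.q (x : W1)).prod • p.word s' u' := by
    rw [p.prod_q_unique h h', ← mul_smul_one, ← h2, ← mul_assoc, h1, smul_one_mul,
      p.prod_q_unique h h']
  have hr : IsRegular (s.map fun x : D.lev J => p.q (x : W1)).prod := by
    clear * - hq
    induction s with
    | nil => simpa using isRegular_one
    | cons a s ih => rw [List.map_cons, List.prod_cons]; exact (hq _).mul ih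
  rw [← p.theta_rep_one (p.word s u), ← p.theta_rep_one (p.word s' u')]
  congr 1
  ext x
  have h4 := congrArg (fun x => p.rep J x (vb C 1)) h3
  simp only [map_smul, LinearMap.smul_apply] at h4
  have h5 := congrArg (fun y => MonoidAlgebra.coeff y x) h4
  simp only [MonoidAlgebra.coeff_smul, Finsupp.smul_apply, smul_eq_mul] at h5
  exact hr.left h5

open Polynomial in
/-- The parameters `(q + X, c)` over `C[X]`, whose `q` takes regular values. -/
def deform : Param D C[X] where
  q r := Polynomial.C (p.q r) + X
  c s := MonoidAlgebra.mapRingHom D.Zk Polynomial.C (p.c s)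
  q_conj r hr w := by rw [p.q_conj r hr w]
  c_conj r hr w := by
    rw [p.c_conj r hr w]
    generalize p.c r = x
    induction x using MonoidAlgebra.induction_linear with
    | zero => simp
    | add x y hx hy => simp only [map_add, MonoidAlgebra.mapDomain_add, hx, hy]
    | single t a => simp
  c_mul r hr t := by rw [p.c_mul r hr t]; simp
  c_inv r hr := by
    rw [p.c_inv r hr]
    generalize p.c r = x
    induction x using MonoidAlgebra.induction_linear with
    | zero => simp
    | add x y hx hy => simp only [map_add, MonoidAlgebra.mapDomain_add, hx, hy]
    | single t a => simp

open Polynomial in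
/-- The specialization `X ↦ 0` of the deformed Hecke algebra. -/
theorem exists_specialize (J : Set b.support) : ∃ F : p.deform.Hecke J →+* p.Hecke J,
    (∀ w, F (p.deform.T J w) = p.T J w) ∧ ∀ s, F (p.deform.cT J s) = p.cT J s := by
  let _ : Algebra C[X] (p.Hecke J) := Algebra.compHom _ (Polynomial.evalRingHom 0)
  have hsm : ∀ (a : C[X]) (x : p.Hecke J), a • x = a.eval 0 • x := fun a x => rfl
  have hz : ∀ (f : D.Zk → p.Hecke J) (x : MonoidAlgebra C D.Zk),
      zlin f (MonoidAlgebra.mapRingHom D.Zk (Polynomial.C : C →+* C[X]) x) = zlin f x := by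
    intro f x
    rw [zlin_eq_linExt, zlin_eq_linExt]
    induction x using MonoidAlgebra.induction_linear with
    | zero => simp
    | add x y hx hy => rw [map_add, map_add, map_add, hx, hy]
    | single t a => simp [linExt_single, hsm]
  let F : p.deform.Hecke J →ₐ[C[X]] p.Hecke J := p.deform.lift J (p.T J) (p.T_one J) (p.T_braid J)
    (fun s hs => by
      rw [p.T_quad J s hs]
      change _ = (Polynomial.C (p.q s) + X : C[X]) • _ + zlin _ (MonoidAlgebra.mapRingHom D.Zk
        (Polynomial.C : C →+* C[X]) (p.c s)) * _
      rw [hz, hsm]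
      simp [cT])
  have hF : ∀ w, F (p.deform.T J w) = p.T J w := fun w => p.deform.lift_T J _ _ _ _ w
  refine ⟨F, hF, fun s => ?_⟩
  change F _ = _
  rw [cT, zlin_map]
  simp only [hF]
  exact hz _ _

/-- The element `T_w^*` does not depend on the decomposition: this holds for the deformed parameters,
and specializes. -/
theorem word_unique {w u u' : D.lev J} {s s' : List (D.lev J)} (h : IsReduced J w s u)
    (h' : IsReduced J w s' u') : p.word s u = p.word s' u' := by
  obtain ⟨F, hT, hc⟩ := p.exists_specialize J
  have hF : ∀ (s : List (D.lev J)) u, F (p.deform.word s u) = p.word s u := by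
    intro s u
    induction s with
    | nil => rw [word_nil, word_nil, hT]
    | cons a s ih => rw [word_cons, word_cons, map_mul, ih, Ts, Ts, map_sub, hT, hc]
  rw [← hF, ← hF, p.deform.word_unique_of_isRegular (fun r => ?_) h h']
  change IsRegular (Polynomial.C (p.q r) + Polynomial.X)
  rw [add_comm]
  exact (Polynomial.monic_X_add_C _).isRegular

theorem Tstar_eq {w u : D.lev J} {s : List (D.lev J)} (h : IsReduced J w s u) :
    p.Tstar J w = p.word s u := by
  obtain ⟨s', u', h', e⟩ := Classical.epsilon_spec (p := fun X => ∃ s u, IsReduced J w s u ∧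
    X = (s.map fun x => p.T J x - p.cT J x).prod * p.T J u) ⟨_, s, u, h, rfl⟩
  exact e.trans (p.word_unique h' h)

theorem Tstar_of_len_eq_zero {u : D.lev J} (hu : D.len J u = 0) : p.Tstar J u = p.T J u := by
  rw [p.Tstar_eq (s := []) (u := u) ⟨by simp, hu.symm, hu, by simp⟩, word_nil]

theorem Tstar_one : p.Tstar J 1 = 1 := by
  rw [Tstar_of_len_eq_zero _ Datum.len_lev_one, T_one]

theorem Tstar_simple_mul {s w : D.lev J} (hs : D.IsSimple J s)
    (h : D.len J (s * w : D.lev J) = D.len J w + 1) :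
    p.Tstar J (s * w) = p.Ts s * p.Tstar J w := by
  obtain ⟨l, u, hr⟩ := exists_isReduced w
  rw [p.Tstar_eq hr, ← word_cons]
  obtain ⟨h1, h2, h3, rfl⟩ := hr
  refine p.Tstar_eq ⟨?_, ?_, h3, ?_⟩
  · rintro x (_ | ⟨_, hx⟩)
    exacts [hs, h1 x hx]
  · rw [List.length_cons, h2, h]
  · rw [List.prod_cons, mul_assoc]

theorem Tstar_of_isSimple {s : D.lev J} (hs : D.IsSimple J s) : p.Tstar J s = p.Ts s := by
  have := p.Tstar_simple_mul (w := 1) hs (by rw [mul_one, hs.2, Datum.len_lev_one])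
  rwa [mul_one, Tstar_one, mul_one] at this

theorem isSimple_conj {u s : D.lev J} (hu : D.len J u = 0) (hs : D.IsSimple J s) :
    D.IsSimple J (u * s * u⁻¹ : D.lev J) := by
  obtain ⟨i, hi, k, e⟩ := hs.1
  obtain ⟨j, hj⟩ := (exists_mapsRoot b (inv_mem u.2)).2 i
  have hj' := (hj.mem_levRoots_iff b (inv_mem u.2)).2 hi
  rw [← map_inv] at hj
  obtain ⟨l, -, e'⟩ := D.affRoot_comp_act1 _ hj (-k)
  have h := D.conj_aff_affRefl _ e'
  refine ⟨⟨j, hj', -(-k + l), ?_⟩, ?_⟩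
  · rw [← h]
    change ((u * s * (u : W1)⁻¹ : W1) : W1 ⧸ D.Zk) = _
    rw [QuotientGroup.mk_mul, QuotientGroup.mk_mul, e, QuotientGroup.mk_inv, inv_inv]
    congr 3
    simp
  · rw [len_mul_of_len_zero' (by rw [InvMemClass.coe_inv, D.len_inv u.2, hu]),
      len_mul_of_len_zero hu, hs.2]

theorem T_mul_cT (u : D.lev J) {s : W1}
    (hs : (s : W1 ⧸ D.Zk) ∈ D.refl Set.univ) :
    p.T J u * p.cT J s = p.cT J (u * s * (u : W1)⁻¹) * p.T J u := by
  rw [cT, cT, p.c_conj s hs, zlin_mapDomain, zlin, zlin, Finsupp.mul_sum, Finsupp.sum_mul]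
  refine Finsupp.sum_congr fun t _ => ?_
  rw [mul_smul_comm, smul_mul_assoc, T_mul_zk, T_zk_mul]
  congr 2
  ext
  simp [Datum.zin, MulAut.conjNormal_apply]

theorem T_mul_Ts_conj {u s : D.lev J} (hu : D.len J u = 0) (hs : D.IsSimple J s) :
    p.T J u * p.Ts s = p.Ts (u * s * u⁻¹) * p.T J u := by
  rw [Ts, Ts, mul_sub, sub_mul, p.T_mul_cT u (D.refl_univ hs.1), T_braid, T_braid,
    inv_mul_cancel_right]
  · rfl
  · rw [inv_mul_cancel_right, hu, len_mul_of_len_zero hu, (isSimple_conj hu hs).2, hs.2]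
  · rw [len_mul_of_len_zero hu, hu, zero_add]

theorem Tstar_len_zero_mul {u w : D.lev J} (hu : D.len J u = 0) :
    p.Tstar J (u * w) = p.T J u * p.Tstar J w := by
  induction hn : D.len J w generalizing w with
  | zero =>
    rw [p.Tstar_of_len_eq_zero hn, Tstar_of_len_eq_zero, T_braid]
    · rw [len_mul_of_len_zero hu, hu, zero_add]
    · rw [len_mul_of_len_zero hu, hn]
  | succ n ih =>
    obtain ⟨s, w', hs, rfl, hl⟩ := Datum.exists_simple_mul (w := w) (by lia)
    have e : u * (s * w') = u * s * u⁻¹ * (u * w') := by group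
    have h1 : D.len J (u * w' : D.lev J) = D.len J w' := len_mul_of_len_zero hu
    rw [e, p.Tstar_simple_mul (isSimple_conj hu hs), ih (by lia), p.Tstar_simple_mul hs hl,
      ← mul_assoc, ← mul_assoc, p.T_mul_Ts_conj hu hs]
    rw [← e, len_mul_of_len_zero hu, hl, h1]

/-- The `T_w^*` satisfy the braid relations. -/
theorem Tstar_mul {v w : D.lev J} (h : D.len J (v * w : D.lev J) = D.len J v + D.len J w) :
    p.Tstar J (v * w) = p.Tstar J v * p.Tstar J w := by
  induction hn : D.len J v generalizing v with
  | zero => rw [p.Tstar_of_len_eq_zero hn, p.Tstar_len_zero_mul hn]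
  | succ n ih =>
    obtain ⟨s, v', hs, rfl, hl⟩ := Datum.exists_simple_mul (w := v) (by lia)
    have h1 := Datum.len_lev_mul_le v' w
    have h2 := Datum.len_lev_mul_le s (v' * w)
    rw [hs.2, ← mul_assoc] at h2
    rw [p.Tstar_simple_mul hs hl, mul_assoc, p.Tstar_simple_mul hs (by rw [← mul_assoc]; lia),
      ih (by lia) (by lia), mul_assoc]

theorem zeta_Ts {s : D.lev J} (hs : D.IsSimple J s) : p.zeta J (p.Ts s) = op (p.Ts s⁻¹) := by
  rw [Ts, Ts, map_sub, zeta_T, op_sub]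
  congr 1
  rw [cT, zlin_map]
  simp only [zeta_T]
  have hc : p.c ((s⁻¹ : D.lev J) : W1) = _ := p.c_inv s (D.refl_univ hs.1)
  rw [cT, hc, zlin_mapDomain, zlin, zlin, Finsupp.sum, Finsupp.sum, ← opAddEquiv_apply, map_sum]
  rfl

theorem zeta_Tstar (w : D.lev J) : p.zeta J (p.Tstar J w) = op (p.Tstar J w⁻¹) := by
  induction hn : D.len J w generalizing w with
  | zero =>
    rw [p.Tstar_of_len_eq_zero hn, zeta_T, Tstar_of_len_eq_zero]
    rw [InvMemClass.coe_inv, D.len_inv w.2, hn]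
  | succ n ih =>
    obtain ⟨s, w', hs, rfl, hl⟩ := Datum.exists_simple_mul (w := w) (by lia)
    have hs' : D.IsSimple J (s⁻¹ : D.lev J) := D.isSimple_inv s.2 hs
    rw [p.Tstar_simple_mul hs hl, map_mul, p.zeta_Ts hs, ih w' (by lia), mul_inv_rev, Tstar_mul,
      p.Tstar_of_isSimple hs', op_mul]
    rw [← mul_inv_rev, InvMemClass.coe_inv, D.len_inv (s * w').2, hl, hs'.2, InvMemClass.coe_inv,
      D.len_inv w'.2]

theorem conjHom_Ts {s : D.lev (opp b J)} (hs : D.IsSimple (opp b J) s) :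
    p.conjHom J (p.Ts s) = p.Ts (D.conj J s) := by
  rw [Ts, Ts, map_sub, conjHom_T]
  congr 1
  rw [cT, zlin_map]
  simp only [conjHom_T]
  have hc := p.c_conj s (D.refl_univ hs.1) (D.nGP J)⁻¹
  rw [inv_inv] at hc
  change p.c (D.conj J s : W1) = _ at hc
  rw [cT, hc, zlin_mapDomain]
  congr 1
  funext t
  congr 1
  ext
  simp [Datum.conj, Datum.zin]

theorem _root_.ProPIwahori.Datum.conj_mul (v w : D.lev (opp b J)) :
    D.conj J (v * w) = D.conj J v * D.conj J w := by
  ext; simp [Datum.conj, mul_assoc]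

theorem conjHom_Tstar (w : D.lev (opp b J)) :
    p.conjHom J (p.Tstar (opp b J) w) = p.Tstar J (D.conj J w) := by
  induction hn : D.len (opp b J) w generalizing w with
  | zero =>
    rw [p.Tstar_of_len_eq_zero hn, conjHom_T, Tstar_of_len_eq_zero]
    rw [D.len_conj, hn]
  | succ n ih =>
    obtain ⟨s, w', hs, rfl, hl⟩ := Datum.exists_simple_mul (w := w) (by lia)
    rw [p.Tstar_simple_mul hs hl, map_mul, p.conjHom_Ts hs, ih w' (by lia), Datum.conj_mul,
      p.Tstar_simple_mul (D.conj_isSimple J s hs)]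
    rw [← Datum.conj_mul, D.len_conj, D.len_conj, hl]

/-! ### The Iwahori–Matsumoto involution -/

/-- `p'` is `(q, -c)` if `p` is `(q, c)`. A symmetric relation, so that `negParam` need not be
iterated. -/
def IsNeg (p p' : Param D C) : Prop := p'.q = p.q ∧ ∀ s, p'.c s = -p.c s

/-- The parameters `(q, -c)`. -/
def negParam : Param D C where
  q := p.q
  c s := -p.c s
  q_conj := p.q_conj
  c_conj r hr w := by rw [p.c_conj r hr w, mapDomain_neg]
  c_mul r hr t := by rw [p.c_mul r hr t, mul_neg]
  c_inv r hr := by rw [p.c_inv r hr, mapDomain_neg]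

theorem isNeg_negParam : p.IsNeg p.negParam := ⟨rfl, fun _ => rfl⟩

variable {p} {p' : Param D C}

theorem IsNeg.symm (h : p.IsNeg p') : p'.IsNeg p :=
  ⟨h.1.symm, fun s => by rw [h.2, neg_neg]⟩

theorem IsNeg.zlin {A : Type*} [Ring A] [Algebra C A] (h : p.IsNeg p') (f : D.Zk → A) (s : W1) :
    zlin f (p'.c s) = -zlin f (p.c s) := by
  rw [h.2, zlin_eq_linExt, map_neg]
  rfl

theorem zlin_Tstar (s : W1) : zlin (fun t => p.Tstar J (D.zin J t)) (p.c s) = p.cT J s := by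
  rw [cT]
  congr 1
  funext t
  exact p.Tstar_of_len_eq_zero (u := D.zin J t) (D.len_zk J t)

/-- The Iwahori–Matsumoto homomorphism `T_w ↦ T_w^*`, from the algebra with parameters `(q, -c)` to
the algebra with parameters `(q, c)`. -/
def kappa (J : Set b.support) (h : p.IsNeg p') : p'.Hecke J →ₐ[C] p.Hecke J :=
  p'.lift J (p.Tstar J) p.Tstar_one (fun _ _ hl => (p.Tstar_mul hl).symm) (fun s hs => by
    obtain ⟨f, hf⟩ := D.exists_simpleRoot hs
    have h1 : D.len J (s * s : D.lev J) = 0 := D.len_zk J ⟨_, hf.mul_self_mem⟩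
    rw [p.Tstar_of_isSimple hs, p.Tstar_of_len_eq_zero h1, h.zlin, zlin_Tstar, h.1,
      ← p.T_mul_Ts hs]
    nth_rewrite 1 [Ts]
    rw [sub_mul]
    exact (sub_eq_add_neg _ _).trans (congrArg _ (neg_mul _ _).symm))

theorem kappa_T (h : p.IsNeg p') (w : D.lev J) : kappa J h (p'.T J w) = p.Tstar J w :=
  p'.lift_T J _ _ _ _ w

theorem kappa_Ts (h : p.IsNeg p') {s : D.lev J} (hs : D.IsSimple J s) :
    kappa J h (p'.Ts s) = p.T J s := by
  rw [Ts, map_sub, kappa_T, p.Tstar_of_isSimple hs, cT, zlin_map]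
  simp only [kappa_T]
  rw [h.zlin, zlin_Tstar, Ts, sub_neg_eq_add, sub_add_cancel]

theorem kappa_Tstar (h : p.IsNeg p') (w : D.lev J) : kappa J h (p'.Tstar J w) = p.T J w := by
  induction hn : D.len J w generalizing w with
  | zero => rw [p'.Tstar_of_len_eq_zero hn, kappa_T, p.Tstar_of_len_eq_zero hn]
  | succ n ih =>
    obtain ⟨s, w', hs, rfl, hl⟩ := Datum.exists_simple_mul (w := w) (by lia)
    rw [p'.Tstar_simple_mul hs hl, map_mul, kappa_Ts h hs, ih w' (by lia), T_mul_of_lt _ hs]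
    rw [hl]
    exact Nat.lt_succ_self _

theorem kappa_kappa (h : p.IsNeg p') (x : p'.Hecke J) : kappa J h.symm (kappa J h x) = x := by
  have : (kappa J h.symm).toLinearMap ∘ₗ (kappa J h).toLinearMap = LinearMap.id :=
    p'.hecke_lhom_ext fun w => by
      simp only [LinearMap.comp_apply, AlgHom.toLinearMap_apply, LinearMap.id_apply]
      rw [kappa_T, kappa_Tstar]
  exact LinearMap.congr_fun this x

/-- The Iwahori–Matsumoto isomorphism, which exchanges the `T_w` and the `T_w^*`. -/
def kappaEquiv (J : Set b.support) (h : p.IsNeg p') : p'.Hecke J ≃ₐ[C] p.Hecke J :=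
  AlgEquiv.ofAlgHom (kappa J h) (kappa J h.symm)
    (AlgHom.ext fun x => kappa_kappa h.symm x) (AlgHom.ext fun x => kappa_kappa h x)

theorem zeta_kappa (h : p.IsNeg p') (x : p'.Hecke J) :
    p.zeta J (kappa J h x) = op (kappa J h (p'.zeta J x).unop) := by
  have : (p.zeta J).toLinearMap ∘ₗ (kappa J h).toLinearMap =
      (AlgHom.op (kappa J h)).toLinearMap ∘ₗ (p'.zeta J).toLinearMap :=
    p'.hecke_lhom_ext fun w => by
      simp only [LinearMap.comp_apply, AlgHom.toLinearMap_apply]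
      rw [kappa_T, zeta_T, zeta_Tstar]
      change _ = op (kappa J h (p'.T J w⁻¹))
      rw [kappa_T]
  exact LinearMap.congr_fun this x

theorem conjHom_kappa (h : p.IsNeg p') (x : p'.Hecke (opp b J)) :
    p.conjHom J (kappa _ h x) = kappa J h (p'.conjHom J x) := by
  have : (p.conjHom J).toLinearMap ∘ₗ (kappa _ h).toLinearMap =
      (kappa J h).toLinearMap ∘ₗ (p'.conjHom J).toLinearMap :=
    p'.hecke_lhom_ext fun w => by
      simp only [LinearMap.comp_apply, AlgHom.toLinearMap_apply]
      rw [kappa_T, conjHom_T, conjHom_Tstar, kappa_T]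
  exact LinearMap.congr_fun this x

end Param

end Star

section Cosets

variable {ι M N : Type*} [AddCommGroup M] [Module ℝ M] [AddCommGroup N] [Module ℝ N]
  [Finite ι] {R : RootPairing ι ℝ M N} [R.IsCrystallographic] [R.IsReduced] {b : R.Base}

theorem pos_basePoint_iff (i : ι) (k : ℤ) :
    0 < affRoot R i k (basePoint b) ↔ (b.IsPos i ∧ 0 ≤ k) ∨ (¬ b.IsPos i ∧ 1 ≤ k) := by
  have h := mem_alcove_pos_iff (basePoint_mem b Set.univ) (mem_levRoots_univ b i) k
  by_cases hi : b.IsPos i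
  · simp [hi, (h.1 hi).1]
  · simp [hi, (h.2 hi).1]

theorem notMem_levRoots_neg {J : Set b.support} {i : ι} (hi : i ∉ levRoots b J) :
    R.reflectionPerm i i ∉ levRoots b J := fun h => hi (by
  have := neg_mem_levRoots b h
  rwa [neg_neg_root] at this)

variable {W1 : Type*} [Group W1] (D : Datum b W1) {J : Set b.support}

namespace Datum

/-! ### The dominant translation -/

theorem exists_shift (J : Set b.support) : ∃ (μ : W1) (m : N), (∀ x, D.act1 μ x = m + x) ∧
    (∀ i ∈ levRoots b J, R.root' i m = 0) ∧
    ∀ i, b.IsPos i → i ∉ levRoots b J → 0 < R.root' i m := by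
  obtain ⟨m, hm, h1, h2⟩ := exists_dominant (b := b) J
  obtain ⟨μ, hμ⟩ := QuotientGroup.mk_surjective (D.aff ⟨_, hm⟩)
  refine ⟨μ, m, fun x => ?_, h1, h2⟩
  change D.act (μ : W1 ⧸ D.Zk) x = _
  rw [hμ, D.act_aff]
  rfl

/-- A lift to `W(1)` of a translation by a vector which is orthogonal to the roots of `Σ_J` and
positive on the other positive roots. -/
def shift (J : Set b.support) : W1 := (D.exists_shift J).choose

/-- The vector by which `shift J` translates. -/
def shiftVec (J : Set b.support) : N := (D.exists_shift J).choose_spec.choose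

theorem shift_spec (J : Set b.support) : (∀ x, D.act1 (D.shift J) x = D.shiftVec J + x) ∧
    (∀ i ∈ levRoots b J, R.root' i (D.shiftVec J) = 0) ∧
    ∀ i, b.IsPos i → i ∉ levRoots b J → 0 < R.root' i (D.shiftVec J) :=
  (D.exists_shift J).choose_spec.choose_spec

theorem act1_shift_pow (r : ℕ) (x : N) :
    D.act1 (D.shift J ^ r) x = (r : ℝ) • D.shiftVec J + x := by
  induction r with
  | zero => simp
  | succ r ih =>
    rw [pow_succ', act1_mul_apply, ih, (D.shift_spec J).1]
    push_cast
    module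

theorem shift_pow_mem (r : ℕ) : D.shift J ^ r ∈ D.lev J := by
  refine pow_mem ?_ r
  have : D.proj (D.shift J) = 1 := by
    ext x
    have h1 := D.act1_apply (D.shift J) x
    rw [(D.shift_spec J).1, (D.shift_spec J).1, add_zero, add_comm] at h1
    exact (add_right_cancel h1).symm
  change D.proj _ ∈ finWeyl b J
  rw [this]
  exact one_mem _

theorem affRoot_shift (i : ι) (k : ℤ) (r : ℕ) (x : N) :
    affRoot R i k (D.act1 (D.shift J ^ r) x) =
      affRoot R i k x + r * R.root' i (D.shiftVec J) := by
  rw [act1_shift_pow, affRoot, affRoot, map_add, map_smul, smul_eq_mul]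
  ring

theorem apply_shift_of_mem {f : N → ℝ} (hf : f ∈ affRoots b J) (r : ℕ) (x : N) :
    f (D.act1 (D.shift J ^ r) x) = f x := by
  obtain ⟨i, hi, k, rfl⟩ := hf
  have : R.root' i (D.shiftVec J) = 0 := (D.shift_spec J).2.1 i hi
  rw [affRoot_shift, this, mul_zero, add_zero]

theorem len_shift_pow (r : ℕ) : D.len J (D.shift J ^ r) = 0 := by
  rw [D.len_eq_zero_iff (D.shift_pow_mem r)]
  intro f hf h
  rwa [pt, D.apply_shift_of_mem hf]

/-- The affine root `f` is positive far out in the direction of the dominant translation. -/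
def EvPos (J : Set b.support) (f : N → ℝ) : Prop :=
  ∀ᶠ r : ℕ in Filter.atTop, 0 < f (D.pt (D.shift J ^ r))

theorem evPos_of_mem {f : N → ℝ} (hf : f ∈ affRoots b J) :
    D.EvPos J f ↔ 0 < f (basePoint b) := by
  simp only [EvPos, pt, D.apply_shift_of_mem hf, Filter.eventually_const]

theorem eventually_affine_pos (a : ℝ) {c : ℝ} (hc : 0 < c) :
    ∀ᶠ r : ℕ in Filter.atTop, 0 < a + r * c := by
  have h : Filter.Tendsto (fun r : ℕ => (r : ℝ) * c) Filter.atTop Filter.atTop :=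
    tendsto_natCast_atTop_atTop.atTop_mul_const hc
  filter_upwards [h.eventually_gt_atTop (-a)] with r hr
  linarith

theorem evPos_of_isPos {i : ι} (hi : i ∉ levRoots b J) (hp : b.IsPos i) (k : ℤ) :
    D.EvPos J (affRoot R i k) := by
  have := eventually_affine_pos (affRoot R i k (basePoint b)) ((D.shift_spec J).2.2 i hp hi)
  filter_upwards [this] with r hr
  rwa [pt, affRoot_shift]

theorem evPos_or_evPos_neg {f : N → ℝ} (hf : f ∈ affRoots b Set.univ) :
    D.EvPos J f ∨ D.EvPos J (-f) := by
  by_cases hJ : f ∈ affRoots b J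
  · rw [D.evPos_of_mem hJ, D.evPos_of_mem (neg_mem_affRoots hJ), Pi.neg_apply, neg_pos]
    exact (basePoint_regular b).pos_or_neg hf
  · obtain ⟨i, -, k, rfl⟩ := hf
    rw [affRoot_mem_iff] at hJ
    by_cases hp : b.IsPos i
    · exact Or.inl (D.evPos_of_isPos hJ hp k)
    · right
      rw [← affRoot_neg]
      exact D.evPos_of_isPos (notMem_levRoots_neg hJ) ((isPos_neg_iff b i).2 hp) _

theorem not_evPos_iff {f : N → ℝ} (hf : f ∈ affRoots b Set.univ) :
    ¬ D.EvPos J f ↔ D.EvPos J (-f) := by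
  refine ⟨fun h => (D.evPos_or_evPos_neg hf).resolve_left h, fun h h' => ?_⟩
  obtain ⟨r, h1, h2⟩ := (h.and h').exists
  rw [Pi.neg_apply] at h1
  linarith

theorem evPos_iff_isPos {i : ι} (hi : i ∉ levRoots b J) (k : ℤ) :
    D.EvPos J (affRoot R i k) ↔ b.IsPos i := by
  refine ⟨fun h => ?_, fun h => D.evPos_of_isPos hi h k⟩
  by_contra hp
  have := D.evPos_of_isPos (notMem_levRoots_neg hi) ((isPos_neg_iff b i).2 hp) (-k)
  rw [affRoot_neg, ← D.not_evPos_iff (affRoot_mem (mem_levRoots_univ b i) k)] at this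
  exact this h

/-- For roots outside `Σ_J`, eventual positivity is not affected by `W_J(1)`. -/
theorem evPos_comp_iff {f : N → ℝ} (hf : f ∈ affRoots b Set.univ) (hJ : f ∉ affRoots b J) {x : W1}
    (hx : x ∈ D.lev J) : D.EvPos J (f ∘ D.act1 x) ↔ D.EvPos J f := by
  obtain ⟨i, -, k, rfl⟩ := hf
  rw [affRoot_mem_iff] at hJ
  obtain ⟨j, hj⟩ := (exists_mapsRoot b (D.proj_mem x)).2 i
  obtain ⟨l, -, e⟩ := D.affRoot_comp_act1 x hj k
  have hj' : j ∉ levRoots b J := fun h => hJ ((hj.mem_levRoots_iff b hx).1 h)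
  rw [e, D.evPos_iff_isPos hj', D.evPos_iff_isPos hJ]
  exact isPos_iff_of_notMem hx j i hj' hj

/-! ### Negative elements -/

theorem act1_n (v : finWeyl b Set.univ) : D.act1 (D.n v) = (v : N ≃ₗ[ℝ] N).toAffineEquiv := by
  change D.act ((D.n v : W1) : W1 ⧸ D.Zk) = _
  rw [D.n_spec, D.act_aff]

theorem proj_n (v : finWeyl b Set.univ) : D.proj (D.n v) = v := by
  change AffineEquiv.linearHom (D.act1 (D.n v)) = _
  rw [D.act1_n]
  rfl

/-- `W_J^-(1)` consists of the elements of `W_J(1)` whose translation part is non-negative on the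
positive roots outside `Σ_J`. -/
theorem isNeg_iff {w : W1} : D.IsNeg J w ↔ w ∈ D.lev J ∧
    ∀ i, b.IsPos i → i ∉ levRoots b J → 0 ≤ R.root' i (D.act1 w 0) := by
  constructor
  · rintro ⟨v, hv, l, hl, rfl, h⟩
    have hp : D.proj (D.n v * l) = v := by
      rw [map_mul, D.proj_n, show D.proj l = 1 from hl, mul_one]
    refine ⟨?_, fun i hi hJ => ?_⟩
    · change D.proj _ ∈ finWeyl b J
      rwa [hp]
    · obtain ⟨j, hj⟩ := (exists_mapsRoot b hv).2 i
      have hjJ : j ∉ levRoots b J := fun h => hJ ((hj.mem_levRoots_iff b hv).1 h)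
      rw [act1_mul_apply, D.act1_n]
      change 0 ≤ R.root' i ((v : N ≃ₗ[ℝ] N) (D.nu l))
      rw [hj.2]
      exact h j ((isPos_iff_of_notMem hv j i hjJ hj).2 hi) hjJ
  · rintro ⟨hw, h⟩
    have hv : D.proj w ∈ finWeyl b J := hw
    refine ⟨⟨D.proj w, D.proj_mem w⟩, hv, (D.n ⟨D.proj w, D.proj_mem w⟩)⁻¹ * w, ?_, by group,
      fun i hi hJ => ?_⟩
    · change D.proj _ = 1
      rw [map_mul, map_inv, D.proj_n, inv_mul_cancel]
    · obtain ⟨j, hj⟩ := (exists_mapsRoot b hv).1 i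
      have hjJ : j ∉ levRoots b J := fun h => hJ ((hj.mem_levRoots_iff b hv).2 h)
      have : R.root' i (D.nu ((D.n ⟨D.proj w, D.proj_mem w⟩)⁻¹ * w)) = R.root' j (D.act1 w 0) := by
        rw [← hj.2, nu, act1_mul_apply]
        congr 1
        have := D.act1_act1_inv (D.n ⟨D.proj w, D.proj_mem w⟩) (D.act1 w 0)
        rw [D.act1_n] at this
        exact this
      rw [this]
      exact h j ((isPos_iff_of_notMem hv i j hJ hj).1 hi) hjJ

theorem isNeg_mul_shift {y : W1} (hy : D.IsNeg J y) (r : ℕ) : D.IsNeg J (y * D.shift J ^ r) := by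
  rw [isNeg_iff] at hy ⊢
  refine ⟨mul_mem hy.1 (D.shift_pow_mem r), fun i hi hJ => ?_⟩
  obtain ⟨j, hj⟩ := (exists_mapsRoot b (D.proj_mem y)).2 i
  have hjJ : j ∉ levRoots b J := fun h => hJ ((hj.mem_levRoots_iff b hy.1).1 h)
  have hjp := (isPos_iff_of_notMem hy.1 j i hjJ hj).2 hi
  rw [act1_mul_apply, act1_shift_pow, add_zero, act1_apply, map_add, hj.2, map_smul, smul_eq_mul]
  have := (D.shift_spec J).2.2 j hjp hjJ
  have := hy.2 i hi hJ
  positivity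

theorem eventually_isNeg {x : W1} (hx : x ∈ D.lev J) :
    ∀ᶠ r : ℕ in Filter.atTop, D.IsNeg J (x * D.shift J ^ r) := by
  have key : ∀ i, ∀ᶠ r : ℕ in Filter.atTop, b.IsPos i → i ∉ levRoots b J →
      0 ≤ R.root' i (D.act1 (x * D.shift J ^ r) 0) := by
    intro i
    by_cases hi : b.IsPos i ∧ i ∉ levRoots b J
    · obtain ⟨hi, hJ⟩ := hi
      obtain ⟨j, hj⟩ := (exists_mapsRoot b (D.proj_mem x)).2 i
      have hjJ : j ∉ levRoots b J := fun h => hJ ((hj.mem_levRoots_iff b hx).1 h)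
      have hjp := (isPos_iff_of_notMem hx j i hjJ hj).2 hi
      filter_upwards [eventually_affine_pos (R.root' i (D.act1 x 0))
        ((D.shift_spec J).2.2 j hjp hjJ)] with r hr _ _
      rw [act1_mul_apply, act1_shift_pow, add_zero, act1_apply, map_add, hj.2, map_smul,
        smul_eq_mul]
      linarith
    · exact Filter.Eventually.of_forall fun r h1 h2 => absurd ⟨h1, h2⟩ hi
  filter_upwards [Filter.eventually_all.2 key] with r hr
  exact D.isNeg_iff.2 ⟨mul_mem hx (D.shift_pow_mem r), hr⟩

theorem isNeg_one : D.IsNeg J 1 :=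
  D.isNeg_iff.2 ⟨one_mem _, fun i _ _ => by rw [map_one]; exact (map_zero (R.root' i)).ge⟩

theorem len_mul_shift {y : W1} (hy : D.IsNeg J y) (r : ℕ) :
    D.len Set.univ (y * D.shift J ^ r) = D.len Set.univ y + D.len Set.univ (D.shift J ^ r) := by
  refine D.len_mul_eq_add (D.mem_lev_univ _) (D.mem_lev_univ _) fun f hf h1 h2 => ?_
  rw [isNeg_iff] at hy
  by_cases hJ : f ∈ affRoots b J
  · rwa [pt, D.apply_shift_of_mem hJ]
  obtain ⟨i, hi, k, rfl⟩ := hf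
  rw [affRoot_mem_iff] at hJ
  by_cases hp : b.IsPos i
  · rw [pt, affRoot_shift]
    have := (D.shift_spec J).2.2 i hp hJ
    positivity
  · -- such a root does not separate the alcove from its image under `y⁻¹`
    exfalso
    obtain ⟨j, hj⟩ := (exists_mapsRoot b (D.proj_mem y)).1 i
    have hjJ : j ∉ levRoots b J := fun h => hJ ((hj.mem_levRoots_iff b hy.1).2 h)
    have hjp : ¬ b.IsPos j := fun h => hp ((isPos_iff_of_notMem hy.1 i j hJ hj).2 h)
    have h3 := hy.2 _ ((isPos_neg_iff b j).2 hjp) (notMem_levRoots_neg hjJ)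
    rw [root'_neg, LinearMap.neg_apply] at h3
    have h4 : R.root' j (basePoint b) = R.root' i (D.pt y⁻¹) + R.root' j (D.act1 y 0) := by
      rw [← D.act1_act1_inv y (basePoint b), act1_apply, map_add, hj.2]
      rfl
    rw [pos_basePoint_iff] at h1
    have h5 : 0 < affRoot R j k (basePoint b) := by
      rw [pos_basePoint_iff]
      exact Or.inr ⟨hjp, (h1.resolve_left fun h => hp h.1).2⟩
    simp only [affRoot] at h2 h5
    linarith

/-! ### Minimal representatives of cosets -/

/-- `d⁻¹` maps the fundamental alcove into the alcove of `Σ_J`. Such elements represent every coset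
`w W_J(1)`, uniquely up to elements of `ℓ_J`-length zero. -/
def IsMin (J : Set b.support) (d : W1) : Prop :=
  ∀ f ∈ affRoots b J, 0 < f (basePoint b) ↔ 0 < f (D.pt d⁻¹)

theorem isMin_one : D.IsMin J 1 := fun f _ => by rw [inv_one, pt_one]

theorem isMin_n {v : finWeyl b Set.univ} (hv : IsMinRep b J v) : D.IsMin J (D.n v) := by
  rintro _ ⟨i, hi, k, rfl⟩
  obtain ⟨j, hj⟩ := (exists_mapsRoot b v.2).1 i
  have h1 : b.IsPos i ↔ b.IsPos j := by
    refine ⟨fun h => hv i hi h j hj, fun h => ?_⟩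
    by_contra hp
    have := hv _ (neg_mem_levRoots b hi) ((isPos_neg_iff b i).2 hp) _ hj.neg
    rw [isPos_neg_iff] at this
    exact this h
  have h2 : affRoot R i k (D.pt (D.n v)⁻¹) = affRoot R j k (basePoint b) := by
    rw [← D.act1_act1_inv (D.n v) (basePoint b), D.act1_n]
    simp only [affRoot]
    congr 1
    exact (hj.2 _).symm
  rw [h2, pos_basePoint_iff, pos_basePoint_iff, h1]

theorem act1_n_zero (v : finWeyl b Set.univ) : D.act1 (D.n v) 0 = 0 := by
  rw [D.act1_n]
  exact map_zero (v : N ≃ₗ[ℝ] N)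

/-- Minimal elements `d` with `d 0 = 0` satisfy `T_{d y} = T_d T_y` for `y ∈ W_J^-(1)`. -/
theorem len_mul_isNeg {d y : W1} (hd : D.IsMin J d) (hd0 : D.act1 d 0 = 0) (hy : D.IsNeg J y) :
    D.len Set.univ (d * y) = D.len Set.univ d + D.len Set.univ y := by
  refine D.len_mul_eq_add (D.mem_lev_univ _) (D.mem_lev_univ _) fun f hf h1 h2 => ?_
  rw [isNeg_iff] at hy
  have hJ : f ∉ affRoots b J := fun h => by
    have := (hd f h).1 h1
    linarith
  obtain ⟨i, hi, k, rfl⟩ := hf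
  rw [affRoot_mem_iff] at hJ
  have hk : b.IsPos i ∧ 0 ≤ k := by
    obtain ⟨j, hj⟩ := (exists_mapsRoot b (D.proj_mem d)).1 i
    have h3 : affRoot R i k (D.pt d⁻¹) = affRoot R j k (basePoint b) := by
      rw [← D.act1_act1_inv d (basePoint b), act1_apply, hd0, add_zero]
      simp only [affRoot]
      congr 1
      exact (hj.2 _).symm
    have h4 : ¬ 0 < affRoot R j k (basePoint b) := by rw [← h3]; linarith
    rw [pos_basePoint_iff] at h1 h4
    refine h1.resolve_right fun h => h4 ?_
    by_cases hp : b.IsPos j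
    · exact Or.inl ⟨hp, by lia⟩
    · exact Or.inr ⟨hp, h.2⟩
  obtain ⟨j, hj⟩ := (exists_mapsRoot b (D.proj_mem y)).2 i
  have hjJ : j ∉ levRoots b J := fun h => hJ ((hj.mem_levRoots_iff b hy.1).1 h)
  have hjp := (isPos_iff_of_notMem hy.1 j i hjJ hj).2 hk.1
  have h5 : 0 < affRoot R j 0 (basePoint b) := (pos_basePoint_iff j 0).2 (Or.inl ⟨hjp, le_rfl⟩)
  have h6 := hy.2 i hk.1 hJ
  have h7 : (0 : ℝ) ≤ k := by exact_mod_cast hk.2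
  rw [pt, affRoot, act1_apply, map_add, hj.2]
  simp only [affRoot] at h5
  push_cast at h5
  linarith

theorem IsMin.len_eq_zero {D : Datum b W1} {d e : W1} (hd : D.IsMin J d) (he : D.IsMin J e)
    (h : d⁻¹ * e ∈ D.lev J) : D.len J (d⁻¹ * e) = 0 := by
  rw [D.len_eq_zero_iff h]
  intro f hf h0
  have h1 : f ∘ D.act1 (d⁻¹ * e) ∈ affRoots b J := D.comp_mem h hf
  have h2 := he _ h1
  rw [Function.comp_apply, Function.comp_apply, pt, ← act1_mul_apply, mul_inv_cancel_right] at h2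
  exact h2.2 ((hd f hf).1 h0)

theorem IsMin.len_zero_mul {D : Datum b W1} {u d : W1} (hd : D.IsMin J d)
    (hu : D.len Set.univ u = 0) : D.IsMin J (u * d) := by
  intro f hf
  have h1 : f ∘ D.act1 d⁻¹ ∈ affRoots b Set.univ := D.comp_mem_univ _ (affRoots_univ hf)
  have h2 := D.pos_pt_iff_of_len_eq_zero (D.mem_lev_univ u⁻¹)
    (by rw [D.len_inv (D.mem_lev_univ u), hu]) h1
  rw [hd f hf, mul_inv_rev, pt_mul]
  exact h2.symm

/-- If the simple affine root of `s` does not come from `Σ_J` via `d`, then `s d` is again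
minimal. -/
theorem IsMin.simple_mul {D : Datum b W1} {s d : W1} {f : N → ℝ} (hd : D.IsMin J d)
    (hs : D.SimpleRoot Set.univ s f) (hf : f ∘ D.act1 d ∉ affRoots b J) : D.IsMin J (s * d) := by
  intro g hg
  rw [hd g hg, mul_inv_rev, pt_mul]
  have h1 : g ∘ D.act1 d⁻¹ ∈ affRoots b Set.univ := D.comp_mem_univ _ (affRoots_univ hg)
  have h2 : (g ∘ D.act1 d⁻¹) ∘ D.act1 d = g := by
    funext x
    simp only [Function.comp_apply, D.act1_inv_act1]
  have h3 : g ∘ D.act1 d⁻¹ ≠ f := fun h => hf (by rwa [← h, h2])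
  have h4 : -(g ∘ D.act1 d⁻¹) ≠ f := fun h => hf (by
    rw [← h]
    have : (-(g ∘ D.act1 d⁻¹)) ∘ D.act1 d = -g := by
      funext x
      simp only [Function.comp_apply, Pi.neg_apply, D.act1_inv_act1]
    rw [this]
    exact neg_mem_affRoots hg)
  have hsep := hs.inv.sep_eq
  change 0 < (g ∘ D.act1 d⁻¹) (basePoint b) ↔ 0 < (g ∘ D.act1 d⁻¹) (D.pt s⁻¹)
  constructor
  · intro h
    refine ((D.regular_pt s⁻¹).pos_or_neg h1).resolve_right fun h' => h3 ?_
    have : g ∘ D.act1 d⁻¹ ∈ sep b Set.univ (basePoint b) (D.pt s⁻¹) := ⟨h1, h, h'⟩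
    rwa [hsep] at this
  · intro h
    refine ((basePoint_regular b).pos_or_neg h1).resolve_right fun h' => h4 ?_
    have : -(g ∘ D.act1 d⁻¹) ∈ sep b Set.univ (basePoint b) (D.pt s⁻¹) :=
      ⟨neg_mem_affRoots h1, by rw [Pi.neg_apply]; linarith, by rw [Pi.neg_apply]; linarith⟩
    rwa [hsep] at this

theorem conj_mk_of_simpleRoot {s d : W1} {i : ι} {k : ℤ} {f : N → ℝ}
    (hs : D.SimpleRoot Set.univ s f) (h : f ∘ D.act1 d = affRoot R i k) :
    ((d⁻¹ * s * d : W1) : W1 ⧸ D.Zk) = D.aff ⟨affRefl R i (-k), affRefl_mem i (-k)⟩ := by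
  obtain ⟨j, -, l, rfl, e, -⟩ := hs
  rw [← D.conj_aff_affRefl d h, ← e]
  rfl

/-- If the simple affine root of `s` comes from `Σ_J` via the minimal element `d`, then `d⁻¹ s d` is
a lift of a simple reflection for `Σ_J`. -/
theorem IsMin.simpleRoot_conj {D : Datum b W1} {s d : W1} {f : N → ℝ} (hd : D.IsMin J d)
    (hs : D.SimpleRoot Set.univ s f) (hf : f ∘ D.act1 d ∈ affRoots b J) :
    D.SimpleRoot J (d⁻¹ * s * d) (f ∘ D.act1 d) := by
  have hf' := hf
  obtain ⟨i, hi, k, e⟩ := hf'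
  have hmk := D.conj_mk_of_simpleRoot hs e
  refine ⟨i, hi, k, e, hmk, ?_⟩
  have ht : d⁻¹ * s * d ∈ D.lev J := D.mem_lev_of_mem_refl ⟨i, hi, -k, hmk⟩
  have hpos : 0 < (f ∘ D.act1 d) (basePoint b) := by
    rw [hd _ hf, Function.comp_apply, pt, act1_act1_inv]
    exact hs.pos
  ext g
  rw [Set.mem_singleton_iff]
  constructor
  · rintro ⟨hg, h1, h2⟩
    have h3 : 0 < (g ∘ D.act1 (d⁻¹ * s * d)) (basePoint b) ↔
        0 < (g ∘ D.act1 d⁻¹) (D.pt s) := by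
      rw [hd _ (D.comp_mem ht hg), Function.comp_apply, pt, ← act1_mul_apply,
        mul_inv_cancel_right, act1_mul_apply]
      rfl
    have hu : g ∘ D.act1 d⁻¹ ∈ affRoots b Set.univ := D.comp_mem_univ _ (affRoots_univ hg)
    have h4 : (g ∘ D.act1 d⁻¹) (D.pt s) < 0 := by
      rw [← (D.regular_pt s).not_pos hu, ← h3]
      exact not_lt.2 h2.le
    have : g ∘ D.act1 d⁻¹ ∈ sep b Set.univ (basePoint b) (D.pt s) := ⟨hu, (hd g hg).1 h1, h4⟩
    rw [hs.sep_eq, Set.mem_singleton_iff] at this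
    rw [← this]
    funext x
    simp only [Function.comp_apply, D.act1_inv_act1]
  · rintro rfl
    refine ⟨hf, hpos, ?_⟩
    have : (f ∘ D.act1 d) (D.pt (d⁻¹ * s * d)) = -(f ∘ D.act1 d) (basePoint b) := by
      rw [Function.comp_apply, pt, ← act1_mul_apply]
      have e : d * (d⁻¹ * s * d) = s * d := by group
      rw [e, act1_mul_apply, hs.apply_act1]
      rfl
    rw [this]
    linarith

/-- A conjugate of a reflection lies in `W_J(1)` only if its root lies in `Σ_J`. -/
theorem comp_mem_of_conj_mem {s d : W1} {f : N → ℝ} (hs : D.SimpleRoot Set.univ s f)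
    (h : d⁻¹ * s * d ∈ D.lev J) : f ∘ D.act1 d ∈ affRoots b J := by
  have hu := D.comp_mem_univ d hs.mem
  have hu' := hu
  obtain ⟨i, -, k, e⟩ := hu'
  have e' : f ∘ D.act1 d = affRoot R i k := e
  have hact := act1_eq_of_mk_eq (D.conj_mk_of_simpleRoot hs e')
  rw [e', affRoot_mem_iff]
  have hp : D.proj (d⁻¹ * s * d) ∈ finWeyl b J := h
  have h1 := comp_sub_mem b hp (R.root' i)
  have h2 : R.root' i ∘ₗ (D.proj (d⁻¹ * s * d) : N →ₗ[ℝ] N) - R.root' i = (-2 : ℝ) • R.root' i := by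
    ext x
    have h3 := D.act1_apply (d⁻¹ * s * d) x
    rw [hact, affRefl_apply, affRefl_apply] at h3
    have h4 := congrArg (R.root' i) h3
    simp only [map_sub, map_add, map_smul, map_zero, RootPairing.root'_coroot_eq_pairing,
      RootPairing.pairing_same, smul_eq_mul] at h4
    simp only [LinearMap.sub_apply, LinearMap.comp_apply, LinearMap.smul_apply, smul_eq_mul]
    change R.root' i (D.proj (d⁻¹ * s * d) x) - _ = _
    linarith
  rw [h2] at h1
  have h3 := Submodule.smul_mem _ (-2 : ℝ)⁻¹ h1
  rwa [smul_smul, inv_mul_cancel₀ (by norm_num), one_smul] at h3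

end Datum

end Cosets

/-! ### The limit action -/

section Limit

variable {ι M N : Type*} [AddCommGroup M] [Module ℝ M] [AddCommGroup N] [Module ℝ N]
  [Finite ι] {R : RootPairing ι ℝ M N} [R.IsCrystallographic] [R.IsReduced] {b : R.Base}
  {W1 : Type*} [Group W1] {D : Datum b W1} {C : Type*} [CommRing C] {J : Set b.support}

variable (D) in
/-- `W(1)` as the group attached to the set of all simple roots. -/
def Datum.up : W1 →* D.lev Set.univ where
  toFun w := ⟨w, D.mem_lev_univ w⟩
  map_one' := rfl
  map_mul' _ _ := rfl

theorem Datum.up_coe (w : D.lev Set.univ) : D.up (w : W1) = w := rfl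

theorem vb_up_mul (v w : W1) : vb C (D.up v) * vb C (D.up w) = vb C (D.up (v * w)) := by
  rw [vb_mul, map_mul]

/-- Two linear maps on the regular representation agree if they agree on the basis. -/
theorem lhom_ext_up {X : Type*} [AddCommMonoid X] [Module C X]
    {F F' : MonoidAlgebra C (D.lev Set.univ) →ₗ[C] X}
    (h : ∀ w, F (vb C (D.up w)) = F' (vb C (D.up w))) : F = F' :=
  lhom_ext_single fun w => h w

namespace Param

variable (p : Param D C)

/-- `v' · μ^r = h (v · μ^r)` for `r ≫ 0`, where `μ` is the dominant translation. -/
def IsLim (J : Set b.support) (h : p.Hecke Set.univ) (v v' : MonoidAlgebra C (D.lev Set.univ)) :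
    Prop :=
  ∀ᶠ r : ℕ in Filter.atTop, p.rep Set.univ h (v * vb C (D.up (D.shift J ^ r))) =
    v' * vb C (D.up (D.shift J ^ r))

variable {p}

theorem mul_vb_injective (w : W1) :
    Function.Injective fun v : MonoidAlgebra C (D.lev Set.univ) => v * vb C (D.up w) := by
  intro v v' h
  have := congrArg (· * vb C (D.up w⁻¹)) h
  simp only [mul_assoc, vb_up_mul, mul_inv_cancel, map_one] at this
  rwa [vb, ← MonoidAlgebra.one_def, mul_one, mul_one] at this

theorem IsLim.unique {h : p.Hecke Set.univ} {v v' v'' : MonoidAlgebra C (D.lev Set.univ)}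
    (h1 : p.IsLim J h v v') (h2 : p.IsLim J h v v'') : v' = v'' := by
  obtain ⟨r, e1, e2⟩ := (h1.and h2).exists
  exact mul_vb_injective _ (e1.symm.trans e2)

theorem IsLim.add {h : p.Hecke Set.univ} {v v' w w' : MonoidAlgebra C (D.lev Set.univ)}
    (h1 : p.IsLim J h v v') (h2 : p.IsLim J h w w') : p.IsLim J h (v + w) (v' + w') := by
  filter_upwards [h1, h2] with r e1 e2
  rw [add_mul, map_add, e1, e2, add_mul]

theorem IsLim.smul {h : p.Hecke Set.univ} {v v' : MonoidAlgebra C (D.lev Set.univ)} (a : C)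
    (h1 : p.IsLim J h v v') : p.IsLim J h (a • v) (a • v') := by
  filter_upwards [h1] with r e1
  rw [smul_mul_assoc, map_smul, e1, smul_mul_assoc]

theorem IsLim.add_left {h h' : p.Hecke Set.univ} {v v' v'' : MonoidAlgebra C (D.lev Set.univ)}
    (h1 : p.IsLim J h v v') (h2 : p.IsLim J h' v v'') : p.IsLim J (h + h') v (v' + v'') := by
  filter_upwards [h1, h2] with r e1 e2
  rw [map_add, LinearMap.add_apply, e1, e2, add_mul]

theorem IsLim.mul {h h' : p.Hecke Set.univ} {v v' v'' : MonoidAlgebra C (D.lev Set.univ)}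
    (h1 : p.IsLim J h' v v') (h2 : p.IsLim J h v' v'') : p.IsLim J (h * h') v v'' := by
  filter_upwards [h1, h2] with r e1 e2
  rw [map_mul (p.rep _), Module.End.mul_apply, e1, e2]

theorem isLim_algebraMap (a : C) (v : MonoidAlgebra C (D.lev Set.univ)) :
    p.IsLim J (algebraMap C _ a) v (a • v) :=
  Filter.Eventually.of_forall fun r => by
    rw [AlgHom.commutes, Module.algebraMap_end_apply, smul_mul_assoc]

theorem isLim_of_rep {h : p.Hecke Set.univ} {a : MonoidAlgebra C (D.lev Set.univ)}
    (ha : ∀ x, p.rep Set.univ h x = a * x) (v : MonoidAlgebra C (D.lev Set.univ)) :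
    p.IsLim J h v (a * v) :=
  Filter.Eventually.of_forall fun r => by rw [ha, mul_assoc]

theorem len_up_lt_iff {s : W1} {f : N → ℝ} (hs : D.SimpleRoot Set.univ s f) (w : W1) :
    D.len Set.univ (D.up w) < D.len Set.univ (D.up s * D.up w : D.lev Set.univ) ↔
      0 < f (D.pt w) := hs.len_mul_iff (D.mem_lev_univ w)

theorem isLim_simple_of_evPos {s : W1} {f : N → ℝ} (hs : D.SimpleRoot Set.univ s f) {w : W1}
    (h : D.EvPos J (f ∘ D.act1 w)) :
    p.IsLim J (p.T Set.univ (D.up s)) (vb C (D.up w)) (vb C (D.up (s * w))) := by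
  filter_upwards [h] with r hr
  rw [vb_up_mul, vb_up_mul, rep_T_isSimple _ hs.isSimple, opL_of_lt, ← map_mul, mul_assoc]
  rw [len_up_lt_iff hs, D.pt_mul]
  exact hr

theorem isLim_simple_of_not_evPos {s : W1} {f : N → ℝ} (hs : D.SimpleRoot Set.univ s f) {w : W1}
    (h : ¬ D.EvPos J (f ∘ D.act1 w)) :
    p.IsLim J (p.T Set.univ (D.up s)) (vb C (D.up w))
      (p.q (s : W1) • vb C (D.up (s * w)) + p.cV Set.univ s * vb C (D.up w)) := by
  rw [D.not_evPos_iff (D.comp_mem_univ w hs.mem)] at h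
  filter_upwards [h] with r hr
  rw [vb_up_mul, rep_T_isSimple _ hs.isSimple, opL_of_not_lt, add_mul, smul_mul_assoc, vb_up_mul,
    mul_assoc (p.cV _ _), vb_up_mul, ← map_mul, mul_assoc]
  · rfl
  · rw [len_up_lt_iff hs, D.pt_mul]
    rw [Pi.neg_apply, Function.comp_apply] at hr
    linarith

/-- The limit exists: for `T_s` and a basis vector `w`, the case distinction in `opL` becomes constant
along `w μ^r`, according to the sign of the simple affine root far out. -/
theorem exists_isLim (h : p.Hecke Set.univ) (v : MonoidAlgebra C (D.lev Set.univ)) :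
    ∃ v', p.IsLim J h v v' := by
  induction h using p.simple_induction generalizing v with
  | hs s hs =>
    obtain ⟨f, hf⟩ := D.exists_simpleRoot hs
    induction v using MonoidAlgebra.induction_linear with
    | zero => exact ⟨0, Filter.Eventually.of_forall fun r => by rw [zero_mul, map_zero]⟩
    | add x y hx hy =>
      obtain ⟨x', hx⟩ := hx
      obtain ⟨y', hy⟩ := hy
      exact ⟨_, hx.add hy⟩
    | single w a =>
      have e : MonoidAlgebra.single w a = a • vb C (D.up (w : W1)) := by
        rw [Datum.up_coe]; simp
      rw [e]
      by_cases hp : D.EvPos J (f ∘ D.act1 (w : W1))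
      · exact ⟨_, (isLim_simple_of_evPos hf hp).smul a⟩
      · exact ⟨_, (isLim_simple_of_not_evPos hf hp).smul a⟩
  | hu u hu => exact ⟨_, isLim_of_rep (p.rep_T_len_zero hu) v⟩
  | hadd x y hx hy =>
    obtain ⟨v', h1⟩ := hx v
    obtain ⟨v'', h2⟩ := hy v
    exact ⟨_, h1.add_left h2⟩
  | hmul x y hx hy =>
    obtain ⟨v', h1⟩ := hy v
    obtain ⟨v'', h2⟩ := hx v'
    exact ⟨_, h1.mul h2⟩
  | hC a => exact ⟨_, isLim_algebraMap a v⟩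

variable (p)

/-- The limit action of `H` on `C[W(1)]`: the limit of the conjugates of the regular representation
by right multiplication with the powers of the dominant translation. -/
def star (J : Set b.support) :
    p.Hecke Set.univ →ₐ[C] Module.End C (MonoidAlgebra C (D.lev Set.univ)) :=
  AlgHom.ofLinearMap
    { toFun := fun h =>
        { toFun := fun v => (exists_isLim (J := J) h v).choose
          map_add' := fun v w => (exists_isLim h (v + w)).choose_spec.unique
            ((exists_isLim h v).choose_spec.add (exists_isLim h w).choose_spec)
          map_smul' := fun a v => (exists_isLim h (a • v)).choose_spec.unique
            ((exists_isLim h v).choose_spec.smul a) }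
      map_add' := fun h h' => LinearMap.ext fun v => (exists_isLim (h + h') v).choose_spec.unique
        ((exists_isLim h v).choose_spec.add_left (exists_isLim h' v).choose_spec)
      map_smul' := fun a h => LinearMap.ext fun v => (exists_isLim (a • h) v).choose_spec.unique (by
        rw [Algebra.smul_def]
        exact (exists_isLim h v).choose_spec.mul (isLim_algebraMap a _)) }
    (LinearMap.ext fun v => (exists_isLim 1 v).choose_spec.unique (by
      have := isLim_algebraMap (p := p) (J := J) 1 v
      rwa [map_one, one_smul] at this))
    (fun h h' => LinearMap.ext fun v => (exists_isLim (h * h') v).choose_spec.unique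
      ((exists_isLim h' v).choose_spec.mul (exists_isLim h _).choose_spec))

theorem isLim_star (h : p.Hecke Set.univ) (v : MonoidAlgebra C (D.lev Set.univ)) :
    p.IsLim J h v (p.star J h v) := (exists_isLim h v).choose_spec

variable {p}

theorem star_eq {h : p.Hecke Set.univ} {v v' : MonoidAlgebra C (D.lev Set.univ)}
    (e : p.IsLim J h v v') : p.star J h v = v' := (p.isLim_star h v).unique e

theorem star_T_len_zero {u : W1} (hu : D.len Set.univ u = 0)
    (v : MonoidAlgebra C (D.lev Set.univ)) :
    p.star J (p.T Set.univ (D.up u)) v = vb C (D.up u) * v :=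
  star_eq (isLim_of_rep (p.rep_T_len_zero (u := D.up u) hu) v)

theorem rep_cT (s : W1) (x : MonoidAlgebra C (D.lev J)) :
    p.rep J (p.cT J s) x = p.cV J s * x := by
  rw [cT, zlin_map, cV]
  simp only [rep_T]
  exact p.zlin_opA _ x

theorem star_cT (s : W1) (v : MonoidAlgebra C (D.lev Set.univ)) :
    p.star J (p.cT Set.univ s) v = p.cV Set.univ s * v :=
  star_eq (isLim_of_rep (rep_cT s) v)

/-- For `d` minimal with `d 0 = 0`, and `y ∈ W_J^-(1)`, the limit operator of `T_{d y}` maps `v_1`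
to `v_{d y}`. -/
theorem star_T_vb_one {d y : W1} (hd : D.IsMin J d) (hd0 : D.act1 d 0 = 0) (hy : D.IsNeg J y) :
    p.star J (p.T Set.univ (D.up (d * y))) (vb C (D.up 1)) = vb C (D.up (d * y)) := by
  refine star_eq (Filter.Eventually.of_forall fun r => ?_)
  rw [vb_up_mul, vb_up_mul, one_mul, rep_T_vb, ← map_mul]
  change D.len Set.univ (d * y * D.shift J ^ r) = D.len Set.univ (d * y) +
    D.len Set.univ (D.shift J ^ r)
  rw [mul_assoc, D.len_mul_isNeg hd hd0 (D.isNeg_mul_shift hy r), D.len_mul_shift hy,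
    D.len_mul_isNeg hd hd0 hy, add_assoc]

theorem T_mul_isNeg {d y : W1} (hd : D.IsMin J d) (hd0 : D.act1 d 0 = 0) (hy : D.IsNeg J y) :
    p.T Set.univ (D.up (d * y)) = p.T Set.univ (D.up d) * p.T Set.univ (D.up y) := by
  rw [T_braid, map_mul]
  exact D.len_mul_isNeg hd hd0 hy

/-! ### Equivariant maps and the limit action -/

section Equivariant

variable {X : Type*} [AddCommGroup X] [Module C X] {σ : RightMod C (p.Hecke J) X}

theorem act_mul (σ : RightMod C (p.Hecke J) X) (a a' : p.Hecke J) (x : X) :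
    σ (op (a * a')) x = σ (op a') (σ (op a) x) := by
  rw [op_mul, map_mul, Module.End.mul_apply]

/-- The linear maps `Φ` with `Φ(v_{d x}) = Φ(v_d) T_x` for `d` minimal and `x ∈ W_J(1)`. -/
def IsEquivariant (σ : RightMod C (p.Hecke J) X)
    (Φ : MonoidAlgebra C (D.lev Set.univ) →ₗ[C] X) : Prop :=
  ∀ d, D.IsMin J d → ∀ x : D.lev J,
    Φ (vb C (D.up (d * x))) = σ (op (p.T J x)) (Φ (vb C (D.up d)))

namespace IsEquivariant

variable {Φ Φ' : MonoidAlgebra C (D.lev Set.univ) →ₗ[C] X}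

theorem add (h : IsEquivariant σ Φ) (h' : IsEquivariant σ Φ') : IsEquivariant σ (Φ + Φ') :=
  fun d hd x => by simp only [LinearMap.add_apply, h d hd, h' d hd, map_add]

theorem smul (h : IsEquivariant σ Φ) (a : C) : IsEquivariant σ (a • Φ) :=
  fun d hd x => by simp only [LinearMap.smul_apply, h d hd, map_smul]

theorem mul_left (h : IsEquivariant σ Φ) {u : W1} (hu : D.len Set.univ u = 0) :
    IsEquivariant σ (Φ ∘ₗ LinearMap.mulLeft C (vb C (D.up u))) := fun d hd x => by
  simp only [LinearMap.comp_apply, LinearMap.mulLeft_apply, vb_up_mul]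
  rw [← mul_assoc, h _ (hd.len_zero_mul hu)]

theorem cV_mul (h : IsEquivariant σ Φ) (s : W1) {d : W1} (hd : D.IsMin J d) (x : D.lev J) :
    Φ (p.cV Set.univ s * vb C (D.up (d * x))) =
      σ (op (p.T J x)) (Φ (p.cV Set.univ s * vb C (D.up d))) := by
  rw [cV, zlin, Finsupp.sum_mul, Finsupp.sum_mul, Finsupp.sum, Finsupp.sum, map_sum, map_sum,
    map_sum]
  refine Finset.sum_congr rfl fun t _ => ?_
  rw [smul_mul_assoc, smul_mul_assoc, map_smul, map_smul, map_smul]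
  congr 1
  exact h.mul_left (D.len_zk Set.univ t) d hd x

theorem mul_cV_mul (h : IsEquivariant σ Φ) (t : W1) {d : W1} (hd : D.IsMin J d) (x : D.lev J) :
    Φ (vb C (D.up d) * p.cV Set.univ t * vb C (D.up x)) =
      σ (op (p.cT J t * p.T J x)) (Φ (vb C (D.up d))) := by
  rw [cV, cT, zlin, zlin, Finsupp.mul_sum, Finsupp.sum_mul, Finsupp.sum_mul, Finsupp.sum,
    Finsupp.sum, map_sum, ← opAddEquiv_apply, map_sum, map_sum, LinearMap.sum_apply]
  refine Finset.sum_congr rfl fun z _ => ?_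
  rw [mul_smul_comm, smul_mul_assoc, smul_mul_assoc, T_zk_mul, map_smul, opAddEquiv_apply, op_smul,
    map_smul, LinearMap.smul_apply, ← h d hd]
  congr 2
  change vb C (D.up d) * vb C (D.up (z : W1)) * vb C (D.up (x : W1)) = _
  rw [vb_up_mul, vb_up_mul, mul_assoc]
  rfl

/-- In the case of a simple reflection whose root comes from `Σ_J`, the limit operator of `T_s` acts
as `T_t`, `t = d⁻¹ s d`. -/
theorem apply_star_of_mem (h : IsEquivariant σ Φ) {s d : W1} {f : N → ℝ}
    (hs : D.SimpleRoot Set.univ s f) (hd : D.IsMin J d) (hf : f ∘ D.act1 d ∈ affRoots b J)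
    (x : D.lev J) :
    Φ (p.star J (p.T Set.univ (D.up s)) (vb C (D.up (d * x)))) =
      σ (op (p.T J ⟨d⁻¹ * s * d, (hd.simpleRoot_conj hs hf).lev_mem⟩ * p.T J x))
        (Φ (vb C (D.up d))) := by
  have ht := hd.simpleRoot_conj hs hf
  set t : D.lev J := ⟨d⁻¹ * s * d, ht.lev_mem⟩ with ht'
  have e1 : s * (d * x) = d * (t * x : D.lev J) := by
    rw [ht']; push_cast; group
  have e2 : f ∘ D.act1 (d * x) = (f ∘ D.act1 d) ∘ D.act1 x := by
    funext y
    simp only [Function.comp_apply, D.act1_mul_apply]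
  have e3 : D.EvPos J (f ∘ D.act1 (d * x)) ↔ D.len J x < D.len J (t * x : D.lev J) := by
    rw [e2, D.evPos_of_mem (D.comp_mem x.2 hf)]
    exact (ht.len_mul_iff x.2).symm
  by_cases hp : D.EvPos J (f ∘ D.act1 (d * x))
  · rw [star_eq (isLim_simple_of_evPos hs hp), e1, h d hd, T_mul_of_lt _ ht.isSimple (e3.1 hp)]
  · have hq : p.q (t : W1) = p.q (s : W1) := by
      refine (q_eq_of_exchange (z := 1) (w := d) (D.refl_univ ht.refl_mem) ?_).symm
      push_cast; group
    have hc : p.cV Set.univ s * vb C (D.up (d * x)) =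
        vb C (D.up d) * p.cV Set.univ t * vb C (D.up x) := by
      have := p.vb_mul_cV (D.up d) (D.refl_univ ht.refl_mem)
      rw [this, mul_assoc, vb_up_mul]
      congr 2
      change s = d * (d⁻¹ * s * d) * d⁻¹
      group
    rw [star_eq (isLim_simple_of_not_evPos hs hp), T_mul_of_not_lt _ ht.isSimple (mt e3.2 hp),
      map_add, map_smul, e1, h d hd, hc, h.mul_cV_mul _ hd, hq, op_add, map_add,
      LinearMap.add_apply, op_smul, map_smul, LinearMap.smul_apply]

theorem comp_star_simple (h : IsEquivariant σ Φ) {s : W1} {f : N → ℝ}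
    (hs : D.SimpleRoot Set.univ s f) :
    IsEquivariant σ (Φ ∘ₗ p.star J (p.T Set.univ (D.up s))) := by
  intro d hd x
  rw [LinearMap.comp_apply, LinearMap.comp_apply]
  by_cases hf : f ∘ D.act1 d ∈ affRoots b J
  · have h1 := h.apply_star_of_mem hs hd hf 1
    rw [T_one, mul_one] at h1
    change Φ (p.star J _ (vb C (D.up (d * 1)))) = _ at h1
    rw [mul_one] at h1
    rw [h.apply_star_of_mem hs hd hf x, h1, act_mul]
  · have e2 : f ∘ D.act1 (d * x) = (f ∘ D.act1 d) ∘ D.act1 x := by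
      funext y
      simp only [Function.comp_apply, D.act1_mul_apply]
    have e3 : D.EvPos J (f ∘ D.act1 (d * x)) ↔ D.EvPos J (f ∘ D.act1 d) := by
      rw [e2, D.evPos_comp_iff (D.comp_mem_univ d hs.mem) hf x.2]
    by_cases hp : D.EvPos J (f ∘ D.act1 d)
    · rw [star_eq (isLim_simple_of_evPos hs (e3.2 hp)), star_eq (isLim_simple_of_evPos hs hp),
        ← mul_assoc, h _ (hd.simple_mul hs hf)]
    · rw [star_eq (isLim_simple_of_not_evPos hs (mt e3.1 hp)),
        star_eq (isLim_simple_of_not_evPos hs hp), map_add, map_add, map_add, map_smul, map_smul,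
        map_smul, ← mul_assoc, h _ (hd.simple_mul hs hf), h.cV_mul s hd]

/-- The limit action preserves equivariance. -/
theorem comp_star (h : IsEquivariant σ Φ) (a : p.Hecke Set.univ) :
    IsEquivariant σ (Φ ∘ₗ p.star J a) := by
  induction a using p.simple_induction generalizing Φ with
  | hs s hs =>
    obtain ⟨f, hf⟩ := D.exists_simpleRoot hs
    exact h.comp_star_simple hf
  | hu u hu =>
    have : p.star J (p.T Set.univ u) = LinearMap.mulLeft C (vb C (D.up (u : W1))) :=
      LinearMap.ext fun v => star_T_len_zero hu v
    rw [this]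
    exact h.mul_left hu
  | hadd x y hx hy =>
    rw [map_add, LinearMap.comp_add]
    exact (hx h).add (hy h)
  | hmul x y hx hy =>
    rw [map_mul]
    exact hy (hx h)
  | hC a =>
    rw [AlgHom.commutes]
    have : Φ ∘ₗ (algebraMap C (Module.End C (MonoidAlgebra C (D.lev Set.univ))) a) = a • Φ := by
      refine LinearMap.ext fun v => ?_
      simp
    rw [this]
    exact h.smul a

end IsEquivariant

end Equivariant

end Param

end Limit

section Walk

variable {ι M N : Type*} [AddCommGroup M] [Module ℝ M] [AddCommGroup N] [Module ℝ N]
  [Finite ι] {R : RootPairing ι ℝ M N} [R.IsCrystallographic] [R.IsReduced] {b : R.Base}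
  {W1 : Type*} [Group W1] {D : Datum b W1} {C : Type*} [CommRing C] {J : Set b.support}

namespace Datum

/-! ### Representatives of the cosets -/

variable (D)

theorem isMin_nGP (J : Set b.support) : D.IsMin J (D.nGP J) := D.isMin_n (isMinRep_wGP J)

theorem act1_nGP_zero (J : Set b.support) : D.act1 (D.nGP J) 0 = 0 := D.act1_n_zero _

theorem exists_drep (q : W1 ⧸ D.lev J) :
    ∃ d : W1, D.IsMin J d ∧ D.act1 d 0 = 0 ∧ (d : W1 ⧸ D.lev J) = q := by
  obtain ⟨w, rfl⟩ := QuotientGroup.mk_surjective q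
  obtain ⟨x, hx, h⟩ := exists_isMinRep J (D.proj_mem w)
  have hv : D.proj w * x ∈ finWeyl b Set.univ :=
    mul_mem (D.proj_mem w) (finWeyl_mono b (Set.subset_univ J) hx)
  refine ⟨D.n ⟨_, hv⟩, D.isMin_n h, D.act1_n_zero _, ?_⟩
  rw [eq_comm, QuotientGroup.eq]
  change D.proj _ ∈ finWeyl b J
  rw [map_mul, map_inv, D.proj_n, inv_mul_cancel_left]
  exact hx

/-- A minimal representative, in the image of `v ↦ n_v`, of a coset of `W_J(1)`. -/
def drep (q : W1 ⧸ D.lev J) : W1 := (D.exists_drep q).choose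

theorem drep_spec (q : W1 ⧸ D.lev J) : D.IsMin J (D.drep q) ∧ D.act1 (D.drep q) 0 = 0 ∧
    (D.drep q : W1 ⧸ D.lev J) = q := (D.exists_drep q).choose_spec

theorem drep_inv_mul_mem (w : W1) : (D.drep (w : W1 ⧸ D.lev J))⁻¹ * w ∈ D.lev J :=
  QuotientGroup.eq.1 (D.drep_spec _).2.2

theorem mul_drep_mem (z : W1) : z * D.drep ((z⁻¹ : W1) : W1 ⧸ D.lev J) ∈ D.lev J := by
  have := inv_mem (D.drep_inv_mul_mem (J := J) z⁻¹)
  rwa [mul_inv_rev, inv_inv, inv_inv] at this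

theorem finite_quotient (J : Set b.support) : Finite (W1 ⧸ D.lev J) := by
  have := finite_finWeyl b
  refine Finite.of_injective
    (fun q : W1 ⧸ D.lev J => (⟨D.proj (D.drep q), D.proj_mem _⟩ : finWeyl b Set.univ))
    fun q q' h => ?_
  rw [← (D.drep_spec q).2.2, ← (D.drep_spec q').2.2, QuotientGroup.eq]
  change D.proj _ ∈ finWeyl b J
  have h' : D.proj (D.drep q) = D.proj (D.drep q') := congrArg Subtype.val h
  rw [map_mul, map_inv, h', inv_mul_cancel]
  exact one_mem _

end Datum

namespace Param

variable {p : Param D C} {X : Type*} [AddCommGroup X] [Module C X]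

/-- The equivariant map with given values on the chosen representatives. -/
def equivExt (σ : RightMod C (p.Hecke J) X) (g : W1 ⧸ D.lev J → X) :
    MonoidAlgebra C (D.lev Set.univ) →ₗ[C] X :=
  linExt fun w => σ (op (p.T J ⟨_, D.drep_inv_mul_mem (w : W1)⟩)) (g ((w : W1) : W1 ⧸ D.lev J))

theorem equivExt_vb (σ : RightMod C (p.Hecke J) X) (g : W1 ⧸ D.lev J → X) (w : W1) :
    equivExt σ g (vb C (D.up w)) =
      σ (op (p.T J ⟨_, D.drep_inv_mul_mem w⟩)) (g (w : W1 ⧸ D.lev J)) := by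
  rw [equivExt, linExt_single, one_smul]
  rfl

theorem isEquivariant_equivExt (σ : RightMod C (p.Hecke J) X) (g : W1 ⧸ D.lev J → X) :
    IsEquivariant σ (equivExt σ g) := by
  intro d hd x
  rw [equivExt_vb, equivExt_vb, ← act_mul]
  have hq : ((d * x : W1) : W1 ⧸ D.lev J) = (d : W1) := QuotientGroup.mk_mul_of_mem d x.2
  have h0 := (D.drep_spec (d : W1 ⧸ D.lev J)).1.len_eq_zero hd (D.drep_inv_mul_mem d)
  rw [T_braid]
  · congr 4
    · ext
      change (D.drep ((d * x : W1) : W1 ⧸ D.lev J))⁻¹ * (d * x) =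
        (D.drep (d : W1 ⧸ D.lev J))⁻¹ * d * x
      rw [hq, mul_assoc]
  · rw [h0, zero_add]
    exact len_mul_of_len_zero h0

/-! ### Elements of the induced module -/

/-- The element `h ↦ Φ(h ⋆ v_1)` of the induced module attached to an equivariant map, where `⋆` is
the limit action. -/
def toInd {σ : RightMod C (p.Hecke J) X} {Φ : MonoidAlgebra C (D.lev Set.univ) →ₗ[C] X}
    (hΦ : IsEquivariant σ Φ) :
    coind (fun w : D.negSet J => p.T J w) (fun w : D.negSet J => p.T Set.univ (D.incl J w)) σ :=
  ⟨Φ ∘ₗ LinearMap.applyₗ (vb C (D.up 1)) ∘ₗ (p.star J).toLinearMap, fun h y => by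
    have h1 := star_T_vb_one (p := p) D.isMin_one (by rw [map_one]; rfl)
      (show D.IsNeg J (y : D.lev J) from y.2)
    rw [one_mul] at h1
    have h2 := (hΦ.comp_star h) 1 D.isMin_one y
    rw [one_mul] at h2
    simp only [LinearMap.comp_apply, AlgHom.toLinearMap_apply, LinearMap.applyₗ_apply_apply] at h2 ⊢
    rw [map_mul, Module.End.mul_apply]
    change Φ (p.star J h (p.star J (p.T Set.univ (D.up ((y : D.lev J) : W1))) _)) = _
    rw [h1, h2]⟩

theorem toInd_apply {σ : RightMod C (p.Hecke J) X}
    {Φ : MonoidAlgebra C (D.lev Set.univ) →ₗ[C] X} (hΦ : IsEquivariant σ Φ) (h : p.Hecke Set.univ) :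
    (toInd hΦ : p.Hecke Set.univ →ₗ[C] X) h = Φ (p.star J h (vb C (D.up 1))) := rfl

theorem toInd_T {σ : RightMod C (p.Hecke J) X} {Φ : MonoidAlgebra C (D.lev Set.univ) →ₗ[C] X}
    (hΦ : IsEquivariant σ Φ) {d : W1} (hd : D.IsMin J d) (hd0 : D.act1 d 0 = 0) :
    (toInd hΦ : p.Hecke Set.univ →ₗ[C] X) (p.T Set.univ (D.up d)) = Φ (vb C (D.up d)) := by
  have h1 := star_T_vb_one (p := p) hd hd0 D.isNeg_one
  rw [mul_one] at h1
  rw [toInd_apply, h1]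

/-- An element of the induced module that vanishes on the `T_d`, for minimal representatives `d` of
all the cosets, is zero. -/
theorem coind_ext {σ : RightMod C (p.Hecke J) X} {φ : p.Hecke Set.univ →ₗ[C] X}
    (hφ : φ ∈ coind (fun w : D.negSet J => p.T J w)
      (fun w : D.negSet J => p.T Set.univ (D.incl J w)) σ) {S : Set W1}
    (hS : ∀ d ∈ S, D.IsMin J d ∧ D.act1 d 0 = 0) (hS' : ∀ w, ∃ d ∈ S, d⁻¹ * w ∈ D.lev J)
    (h0 : ∀ d ∈ S, φ (p.T Set.univ (D.up d)) = 0) : φ = 0 := by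
  have hφ' : ∀ (h : p.Hecke Set.univ) (y : D.lev J), D.IsNeg J y →
      φ (h * p.T Set.univ (D.up y)) = σ (op (p.T J y)) (φ h) := fun h y hy => hφ h ⟨y, hy⟩
  -- after a dominant translation, every basis element is `T_d T_y` with `y ∈ W_J^-(1)`
  have key : ∀ v : MonoidAlgebra C (D.lev Set.univ), ∀ᶠ r : ℕ in Filter.atTop,
      φ (p.theta Set.univ (v * vb C (D.up (D.shift J ^ r)))) = 0 := by
    intro v
    induction v using MonoidAlgebra.induction_linear with
    | zero => exact Filter.Eventually.of_forall fun r => by rw [zero_mul, map_zero, map_zero]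
    | add x y hx hy =>
      filter_upwards [hx, hy] with r h1 h2
      rw [add_mul, map_add, map_add, h1, h2, add_zero]
    | single w a =>
      obtain ⟨d, hd, hw⟩ := hS' (w : W1)
      filter_upwards [D.eventually_isNeg hw] with r hr
      have e : MonoidAlgebra.single w a = a • vb C (D.up (w : W1)) := by
        rw [Datum.up_coe]; simp
      have e1 : (w : W1) * D.shift J ^ r = d * (d⁻¹ * w * D.shift J ^ r) := by group
      rw [e, smul_mul_assoc, map_smul, map_smul, vb_up_mul, theta_vb, e1,
        T_mul_isNeg (hS d hd).1 (hS d hd).2 hr,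
        hφ' _ ⟨d⁻¹ * w * D.shift J ^ r, mul_mem hw (D.shift_pow_mem r)⟩ hr, h0 d hd, map_zero,
        smul_zero]
  refine LinearMap.ext fun h => ?_
  obtain ⟨r, h1, h2⟩ := ((p.isLim_star (J := J) h (vb C (D.up 1))).and (key _)).exists
  rw [← h1, theta_rep, vb_up_mul, one_mul, theta_vb] at h2
  set μ : D.lev J := ⟨D.shift J ^ r, D.shift_pow_mem r⟩ with hμ
  have hneg : D.IsNeg J μ := by
    have := D.isNeg_mul_shift (J := J) D.isNeg_one r
    rwa [one_mul] at this
  have h3 := hφ' h μ hneg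
  rw [show D.up (μ : W1) = D.up (D.shift J ^ r) from rfl, h2] at h3
  -- the dominant translation has `ℓ_J`-length zero, so that it acts invertibly on `σ`
  have h4 : p.T J μ * p.T J μ⁻¹ = 1 := by
    have h5 : D.len J μ = 0 := D.len_shift_pow r
    rw [T_braid, mul_inv_cancel, T_one]
    rw [len_mul_of_len_zero h5, h5, zero_add]
  have h5 := congrArg (σ (op (p.T J μ⁻¹))) h3
  rw [← act_mul, h4, map_zero, op_one, map_one] at h5
  exact h5.symm

/-! ### Walking through the alcoves -/

open Classical in
/-- The equivariant map which is concentrated on the coset `z⁻¹ W_J(1)`, on which it takes the value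
`x T_{z d}^*` at minimal elements `d`. -/
def walk (σ : RightMod C (p.Hecke J) X) (x : X) (z : W1) :
    MonoidAlgebra C (D.lev Set.univ) →ₗ[C] X :=
  equivExt σ fun q => if q = ((z⁻¹ : W1) : W1 ⧸ D.lev J) then
    σ (op (p.Tstar J ⟨_, D.mul_drep_mem z⟩)) x else 0

theorem isEquivariant_walk (σ : RightMod C (p.Hecke J) X) (x : X) (z : W1) :
    IsEquivariant σ (walk σ x z) := isEquivariant_equivExt σ _

theorem walk_vb_of_notMem (σ : RightMod C (p.Hecke J) X) (x : X) {z w : W1}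
    (h : z * w ∉ D.lev J) : walk σ x z (vb C (D.up w)) = 0 := by
  rw [walk, equivExt_vb, if_neg, map_zero]
  rw [eq_comm, QuotientGroup.eq, inv_inv]
  exact h

theorem walk_vb_of_mem (σ : RightMod C (p.Hecke J) X) (x : X) {z d : W1} (hd : D.IsMin J d)
    (h : z * d ∈ D.lev J) :
    walk σ x z (vb C (D.up d)) = σ (op (p.Tstar J ⟨z * d, h⟩)) x := by
  have hq : (d : W1 ⧸ D.lev J) = (z⁻¹ : W1) := by
    rw [eq_comm, QuotientGroup.eq, inv_inv]
    exact h
  rw [walk, equivExt_vb, if_pos hq, ← act_mul]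
  have h0 := (D.drep_spec (d : W1 ⧸ D.lev J)).1.len_eq_zero hd (D.drep_inv_mul_mem d)
  rw [← p.Tstar_of_len_eq_zero (u := ⟨_, D.drep_inv_mul_mem d⟩) h0, ← Tstar_mul]
  · congr 4
    ext
    change z * D.drep ((z⁻¹ : W1) : W1 ⧸ D.lev J) * ((D.drep (d : W1 ⧸ D.lev J))⁻¹ * d) = z * d
    rw [hq]
    group
  · have h1 : D.len J ((⟨_, D.drep_inv_mul_mem d⟩ : D.lev J) : W1) = 0 := h0
    rw [h1, add_zero]
    exact len_mul_of_len_zero' h1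

theorem walk_cV_mul (σ : RightMod C (p.Hecke J) X) (x : X) (s : W1) {z w : W1}
    (h : z * w ∉ D.lev J) : walk σ x z (p.cV Set.univ s * vb C (D.up w)) = 0 := by
  rw [cV, zlin, Finsupp.sum_mul, Finsupp.sum, map_sum]
  refine Finset.sum_eq_zero fun t _ => ?_
  rw [smul_mul_assoc, map_smul]
  change _ • walk σ x z (vb C (D.up (t : W1)) * _) = 0
  rw [vb_up_mul, walk_vb_of_notMem, smul_zero]
  intro h1
  have h2 : z * t * z⁻¹ ∈ D.lev J := D.zk_le_lev J (D.normal.conj_mem _ t.2 z)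
  have h3 := mul_mem (inv_mem h2) h1
  rw [show (z * t * z⁻¹)⁻¹ * (z * (t * w)) = z * w by group] at h3
  exact h h3

/-- A walk is characterized by its support and by its value at one minimal element. -/
theorem eq_walk {σ : RightMod C (p.Hecke J) X} {Φ : MonoidAlgebra C (D.lev Set.univ) →ₗ[C] X}
    (hΦ : IsEquivariant σ Φ) {x : X} {z d : W1} (hd : D.IsMin J d) (h : z * d ∈ D.lev J)
    (h1 : Φ (vb C (D.up d)) = σ (op (p.Tstar J ⟨z * d, h⟩)) x)
    (h2 : ∀ w, z * w ∉ D.lev J → Φ (vb C (D.up w)) = 0) : Φ = walk σ x z := by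
  refine lhom_ext_up fun w => ?_
  by_cases hw : z * w ∈ D.lev J
  · have h3 := mul_mem (inv_mem h) hw
    rw [show (z * d)⁻¹ * (z * w) = d⁻¹ * w by group] at h3
    have e1 : w = d * (⟨d⁻¹ * w, h3⟩ : D.lev J) := (mul_inv_cancel_left d w).symm
    rw [e1, hΦ d hd, isEquivariant_walk σ x z d hd, h1, walk_vb_of_mem σ x hd h]
  · rw [h2 w hw, walk_vb_of_notMem σ x hw]

theorem star_Ts_of_evPos {s : W1} {f : N → ℝ} (hs : D.SimpleRoot Set.univ s f) {w : W1}
    (h : D.EvPos J (f ∘ D.act1 w)) :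
    p.star J (p.Ts (D.up s)) (vb C (D.up w)) =
      vb C (D.up (s * w)) - p.cV Set.univ s * vb C (D.up w) := by
  rw [Ts, map_sub, LinearMap.sub_apply, star_eq (isLim_simple_of_evPos hs h), star_cT]
  rfl

theorem star_Ts_of_not_evPos {s : W1} {f : N → ℝ} (hs : D.SimpleRoot Set.univ s f) {w : W1}
    (h : ¬ D.EvPos J (f ∘ D.act1 w)) :
    p.star J (p.Ts (D.up s)) (vb C (D.up w)) = p.q (s : W1) • vb C (D.up (s * w)) := by
  rw [Ts, map_sub, LinearMap.sub_apply, star_eq (isLim_simple_of_not_evPos hs h), star_cT]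
  exact add_sub_cancel_right _ _

theorem walk_comp_star_len_zero (σ : RightMod C (p.Hecke J) X) (x : X) (z : W1) {u : W1}
    (hu : D.len Set.univ u = 0) :
    walk σ x z ∘ₗ p.star J (p.T Set.univ (D.up u)) = walk σ x (z * u) := by
  have hd := (D.drep_spec ((z⁻¹ : W1) : W1 ⧸ D.lev J)).1
  have hu' : D.len Set.univ u⁻¹ = 0 := by rw [D.len_inv (D.mem_lev_univ u), hu]
  have e : z * u * (u⁻¹ * D.drep ((z⁻¹ : W1) : W1 ⧸ D.lev J)) =
    z * D.drep ((z⁻¹ : W1) : W1 ⧸ D.lev J) := by group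
  have hst : ∀ w, (walk σ x z ∘ₗ p.star J (p.T Set.univ (D.up u))) (vb C (D.up w)) =
      walk σ x z (vb C (D.up (u * w))) := fun w => by
    rw [LinearMap.comp_apply, star_T_len_zero hu, vb_up_mul]
  refine eq_walk ((isEquivariant_walk σ x z).comp_star _) (hd.len_zero_mul hu')
    (by rw [e]; exact D.mul_drep_mem z) ?_ fun w hw => ?_
  · rw [hst, mul_inv_cancel_left, walk_vb_of_mem σ x hd (D.mul_drep_mem z)]
    simp only [e]
  · rw [hst, walk_vb_of_notMem]
    rwa [← mul_assoc]

/-- A step inside the coset: the simple affine root of `s` comes from `Σ_J` and is crossed in the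
lengthening direction. -/
theorem walk_comp_star_of_mem (σ : RightMod C (p.Hecke J) X) (x : X) {z s d : W1} {f : N → ℝ}
    (hs : D.SimpleRoot Set.univ s f) (hd : D.IsMin J d) (hz : z * d ∈ D.lev J)
    (hf : f ∘ D.act1 d ∈ affRoots b J) (hpos : 0 < (f ∘ D.act1 d) (D.pt (z * d)⁻¹)) :
    walk σ x z ∘ₗ p.star J (p.Ts (D.up s)) = walk σ x (z * s) := by
  have ht := hd.simpleRoot_conj hs hf
  have e : z * s * d = z * d * (d⁻¹ * s * d) := by group
  have hw := isEquivariant_walk σ x z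
  refine eq_walk (hw.comp_star _) hd (by rw [e]; exact mul_mem hz ht.lev_mem) ?_ fun w hw' => ?_
  · set t : D.lev J := ⟨d⁻¹ * s * d, ht.lev_mem⟩ with ht'
    have h1 := hw.apply_star_of_mem hs hd hf 1
    rw [T_one, mul_one] at h1
    change walk σ x z (p.star J _ (vb C (D.up (d * 1)))) = _ at h1
    rw [mul_one] at h1
    have h2 := hw.mul_cV_mul (t : W1) hd 1
    rw [T_one, mul_one] at h2
    have hc : vb C (D.up d) * p.cV Set.univ t * vb C (D.up ((1 : D.lev J) : W1)) =
        p.cV Set.univ s * vb C (D.up d) := by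
      change _ * vb C (1 : D.lev Set.univ) = _
      rw [show vb C (1 : D.lev Set.univ) = 1 from rfl, mul_one,
        p.vb_mul_cV (D.up d) (D.refl_univ ht.refl_mem)]
      congr 2
      change d * (d⁻¹ * s * d) * d⁻¹ = s
      group
    rw [hc] at h2
    rw [LinearMap.comp_apply, Ts, map_sub, LinearMap.sub_apply, star_cT, map_sub, h1]
    change _ - walk σ x z (p.cV Set.univ s * _) = _
    have hts : p.Tstar J t = p.T J t - p.cT J t := p.Tstar_of_isSimple ht.isSimple
    rw [h2, ← LinearMap.sub_apply, ← map_sub, ← op_sub, ← hts, walk_vb_of_mem σ x hd hz,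
      ← act_mul, ← Tstar_mul]
    · congr 4
      ext
      exact e.symm
    · have := ht.len_mul_right_of_pos hz hpos
      rw [show D.len J t = 1 from ht.isSimple.2]
      exact this
  · have h1 : z * w ∉ D.lev J := fun h => hw' (by
      have h2 : z * d * (d⁻¹ * s * d) * (z * d)⁻¹ ∈ D.lev J :=
        mul_mem (mul_mem hz ht.lev_mem) (inv_mem hz)
      have h3 := mul_mem h2 h
      rwa [show z * d * (d⁻¹ * s * d) * (z * d)⁻¹ * (z * w) = z * s * w by group] at h3)
    rw [LinearMap.comp_apply]
    have h2 : walk σ x z (vb C (D.up (s * w))) = 0 :=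
      walk_vb_of_notMem σ x (by rwa [← mul_assoc])
    by_cases hp : D.EvPos J (f ∘ D.act1 w)
    · rw [star_Ts_of_evPos hs hp, map_sub, h2, walk_cV_mul σ x s h1, sub_zero]
    · rw [star_Ts_of_not_evPos hs hp, map_smul, h2, smul_zero]

/-- A step to another coset, against the direction of the dominant translation: here no `c_s`
survives. -/
theorem walk_comp_star_of_notMem (σ : RightMod C (p.Hecke J) X) (x : X) {z s d : W1} {f : N → ℝ}
    (hs : D.SimpleRoot Set.univ s f) (hd : D.IsMin J d) (hz : z * d ∈ D.lev J)
    (hf : f ∘ D.act1 d ∉ affRoots b J) (hneg : ¬ D.EvPos J (f ∘ D.act1 d)) :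
    walk σ x z ∘ₗ p.star J (p.Ts (D.up s)) = walk σ x (z * s) := by
  have e : z * s * (s⁻¹ * d) = z * d := by group
  have hfd := D.comp_mem_univ d hs.mem
  refine eq_walk ((isEquivariant_walk σ x z).comp_star _) (hd.simple_mul hs.inv hf)
    (by rwa [e]) ?_ fun w hw => ?_
  · have h1 : f ∘ D.act1 (s⁻¹ * d) = -(f ∘ D.act1 d) := by
      funext y
      rw [Function.comp_apply, D.act1_mul_apply, hs.inv.apply_act1]
      rfl
    have h2 : z * (s⁻¹ * d) ∉ D.lev J := fun h => hf (by
      have h3 := mul_mem (inv_mem hz) h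
      rw [show (z * d)⁻¹ * (z * (s⁻¹ * d)) = (d⁻¹ * s * d)⁻¹ by group, inv_mem_iff] at h3
      exact D.comp_mem_of_conj_mem hs h3)
    rw [LinearMap.comp_apply, star_Ts_of_evPos hs (by rwa [h1, ← D.not_evPos_iff hfd]), map_sub,
      walk_cV_mul σ x s h2, sub_zero, mul_inv_cancel_left, walk_vb_of_mem σ x hd hz]
    simp only [e]
  · have h1 : walk σ x z (vb C (D.up (s * w))) = 0 :=
      walk_vb_of_notMem σ x (by rwa [← mul_assoc])
    rw [LinearMap.comp_apply]
    by_cases hp : D.EvPos J (f ∘ D.act1 w)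
    · have h2 : z * w ∉ D.lev J := fun h => hneg (by
        have h3 := mul_mem (inv_mem hz) h
        rw [show (z * d)⁻¹ * (z * w) = d⁻¹ * w by group] at h3
        rw [← D.evPos_comp_iff hfd hf h3]
        have e2 : (f ∘ D.act1 d) ∘ D.act1 (d⁻¹ * w) = f ∘ D.act1 w := by
          funext y
          simp only [Function.comp_apply]
          rw [← D.act1_mul_apply, mul_inv_cancel_left]
        rwa [e2])
      rw [star_Ts_of_evPos hs hp, map_sub, h1, walk_cV_mul σ x s h2, sub_zero]
    · rw [star_Ts_of_not_evPos hs hp, map_smul, h1, smul_zero]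

end Param

/-! ### The walk of an element that crosses no forbidden wall -/

/-- `w` makes no affine root with negative gradient outside `Σ_J` negative that is positive on the
fundamental alcove. -/
def Datum.NoCross (D : Datum b W1) (J : Set b.support) (w : W1) : Prop :=
  ∀ i, ¬ b.IsPos i → i ∉ levRoots b J → ∀ k : ℤ, 0 < affRoot R i k (basePoint b) →
    0 < affRoot R i k (D.pt w)

/-- The condition passes to the initial parts of a reduced decomposition. -/
theorem Datum.NoCross.of_mul {w s : W1} {f : N → ℝ} (h : D.NoCross J (w * s))
    (hs : D.SimpleRoot Set.univ s f) (hp : 0 < f (D.pt w⁻¹)) : D.NoCross J w := by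
  intro i hi hJ k h0
  have h1 := h i hi hJ k h0
  have hm : affRoot R i k ∈ affRoots b Set.univ := affRoot_mem (mem_levRoots_univ b i) k
  refine ((D.regular_pt w).pos_or_neg hm).resolve_right fun h2 => ?_
  have h3 : -(affRoot R i k ∘ D.act1 w) ∈ sep b Set.univ (basePoint b) (D.pt s) := by
    refine ⟨neg_mem_affRoots (D.comp_mem_univ w hm), ?_, ?_⟩
    · rw [Pi.neg_apply, Left.neg_pos_iff]; exact h2
    · rw [Pi.neg_apply, Left.neg_neg_iff, Function.comp_apply, ← D.pt_mul]; exact h1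
  rw [hs.sep_eq, Set.mem_singleton_iff] at h3
  rw [← h3, Pi.neg_apply, Function.comp_apply, pt, D.act1_act1_inv] at hp
  linarith

theorem Datum.comp_nGP_mem_iff {a : N → ℝ} (ha : a ∈ affRoots b Set.univ) :
    a ∘ D.act1 (D.nGP J) ∈ affRoots b J ↔ a ∈ affRoots b (opp b J) := by
  obtain ⟨i, -, k, rfl⟩ := ha
  obtain ⟨j, hj⟩ := (exists_mapsRoot b (wGP_mem b J)).2 i
  have e : (fun x => affRoot R i k x) ∘ D.act1 (D.nGP J) = affRoot R j k := by
    funext x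
    rw [D.act1_nGP]
    simp only [Function.comp_apply, affRoot]
    congr 1
    exact hj.2 x
  have e' : affRoot R i k ∘ D.act1 (D.nGP J) = affRoot R j k := e
  change affRoot R i k ∘ D.act1 (D.nGP J) ∈ _ ↔ affRoot R i k ∈ _
  rw [e', affRoot_mem_iff, affRoot_mem_iff]
  exact wGP_mem_levRoots b hj

theorem Datum.evPos_comp_nGP {i : ι} (hi : i ∉ levRoots b (opp b J)) (k : ℤ) :
    D.EvPos J (affRoot R i k ∘ D.act1 (D.nGP J)) ↔ ¬ b.IsPos i := by
  obtain ⟨j, hj⟩ := (exists_mapsRoot b (wGP_mem b J)).2 i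
  have e : affRoot R i k ∘ D.act1 (D.nGP J) = affRoot R j k := by
    funext x
    rw [D.act1_nGP]
    simp only [Function.comp_apply, affRoot]
    congr 1
    exact hj.2 x
  have hj' : j ∉ levRoots b J := fun h => hi ((wGP_mem_levRoots b hj).1 h)
  rw [e, D.evPos_iff_isPos hj', wGP_isPos_iff_of_notMem hj' hj, not_not]

/-- The walk along a reduced decomposition of `w`, starting at `n⁻¹`, meets only the steps described
in `walk_comp_star_of_mem` and `walk_comp_star_of_notMem`. -/
theorem Param.walk_nGP_comp_star {p : Param D C} {X : Type*} [AddCommGroup X] [Module C X]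
    (σ : RightMod C (p.Hecke J) X) (x : X) {w : W1} (hw : D.NoCross (opp b J) w) :
    walk σ x (D.nGP J)⁻¹ ∘ₗ p.star J (p.Tstar Set.univ (D.up w)) =
      walk σ x ((D.nGP J)⁻¹ * w) := by
  induction hn : D.len Set.univ w generalizing w with
  | zero =>
    rw [p.Tstar_of_len_eq_zero (u := D.up w) hn, walk_comp_star_len_zero σ x _ hn]
  | succ n ih =>
    obtain ⟨s, w', hs, e, hl⟩ := Datum.exists_mul_simple (J := Set.univ) (w := D.up w)
      (by change D.len Set.univ w ≠ 0; lia)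
    obtain ⟨f, hf⟩ := D.exists_simpleRoot hs
    obtain rfl : w = w' * s := congrArg Subtype.val e
    have hl' : D.len Set.univ ((w' : W1) * s) = D.len Set.univ (w' : W1) + 1 := hl
    have hp : 0 < f (D.pt (w' : W1)⁻¹) := by
      rw [← hf.len_mul_right_iff (D.mem_lev_univ (w' : W1)), hl']
      exact Nat.lt_succ_self _
    have hw' := hw.of_mul hf hp
    have hm : p.Tstar Set.univ (D.up ((w' : W1) * s)) =
        p.Tstar Set.univ (D.up (w' : W1)) * p.Ts (D.up (s : W1)) := by
      rw [map_mul, Tstar_mul, Datum.up_coe, Datum.up_coe, p.Tstar_of_isSimple hs]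
      change D.len Set.univ ((w' : W1) * s) = D.len Set.univ (w' : W1) + D.len Set.univ (s : W1)
      rw [hl', hs.2]
    rw [hm, map_mul, Module.End.mul_eq_comp, ← LinearMap.comp_assoc, ih hw' (by lia), ← mul_assoc]
    -- the affine root crossed by the last step
    set a : N → ℝ := f ∘ D.act1 (w' : W1)⁻¹ with ha
    have ham : a ∈ affRoots b Set.univ := D.comp_mem_univ _ hf.mem
    have ha0 : 0 < a (basePoint b) := hp
    have haw : a (D.pt ((w' : W1) * s)) < 0 := by
      rw [ha, Function.comp_apply, D.pt_mul, D.act1_inv_act1, Datum.pt, hf.apply_act1]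
      have := hf.pos
      linarith
    set z := (D.nGP J)⁻¹ * (w' : W1) with hz
    have hd := (D.drep_spec ((z⁻¹ : W1) : W1 ⧸ D.lev J)).1
    have hzd := D.mul_drep_mem (J := J) z
    set d := D.drep ((z⁻¹ : W1) : W1 ⧸ D.lev J) with hdd
    have ed : f ∘ D.act1 d = (a ∘ D.act1 (D.nGP J)) ∘ D.act1 (z * d) := by
      funext y
      simp only [ha, hz, Function.comp_apply, ← D.act1_mul_apply]
      congr 3
      group
    by_cases hJ : a ∈ affRoots b (opp b J)
    · have han : a ∘ D.act1 (D.nGP J) ∈ affRoots b J := (Datum.comp_nGP_mem_iff ham).2 hJ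
      refine walk_comp_star_of_mem σ x hf hd hzd (by rw [ed]; exact D.comp_mem hzd han) ?_
      rw [ed, Function.comp_apply, Datum.pt, D.act1_act1_inv, D.isMin_nGP J _ han,
        Function.comp_apply, Datum.pt, D.act1_act1_inv]
      exact ha0
    · have han : a ∘ D.act1 (D.nGP J) ∉ affRoots b J := fun h =>
        hJ ((Datum.comp_nGP_mem_iff ham).1 h)
      have hanu := D.comp_mem_univ (D.nGP J) ham
      refine walk_comp_star_of_notMem σ x hf hd hzd (by rwa [ed, D.comp_mem_iff hzd]) ?_
      rw [ed, D.evPos_comp_iff hanu han hzd]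
      obtain ⟨i, -, k, hik⟩ := ham
      have hik' : a = affRoot R i k := hik
      rw [hik', affRoot_mem_iff] at hJ
      rw [hik', Datum.evPos_comp_nGP hJ]
      intro hi
      rw [hik'] at ha0 haw
      have := hw i hi hJ k ha0
      linarith

theorem Datum.noCross_of_isNeg_inv {w : W1} (h : D.IsNeg J w⁻¹) : D.NoCross J w := by
  rw [Datum.isNeg_iff] at h
  have hw : w ∈ D.lev J := by simpa using inv_mem h.1
  intro i hi hJ k h0
  obtain ⟨j, hj⟩ := (exists_mapsRoot b (D.proj_mem w)).2 i
  have hjJ : j ∉ levRoots b J := fun h' => hJ ((hj.mem_levRoots_iff b hw).1 h')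
  have hjp : ¬ b.IsPos j := fun h' => hi ((isPos_iff_of_notMem hw j i hjJ hj).1 h')
  have h1 := h.2 _ ((isPos_neg_iff b j).2 hjp) (notMem_levRoots_neg hjJ)
  rw [root'_neg, LinearMap.neg_apply] at h1
  have h2 : R.root' j (D.act1 w⁻¹ 0) + R.root' i (D.act1 w 0) = 0 := by
    rw [← hj.2, ← map_add, ← D.act1_apply, D.act1_act1_inv, map_zero]
  rw [pos_basePoint_iff] at h0
  have h3 : 0 < affRoot R j k (basePoint b) := (pos_basePoint_iff j k).2
    (Or.inr ⟨hjp, (h0.resolve_left fun h' => hi h'.1).2⟩)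
  rw [affRoot, Datum.pt, D.act1_apply, map_add, hj.2]
  simp only [affRoot] at h3
  linarith

theorem Datum.noCross_of_fix {w : W1} (h : D.act1 w 0 = 0) : D.NoCross J w := by
  intro i hi hJ k h0
  obtain ⟨j, hj⟩ := (exists_mapsRoot b (D.proj_mem w)).2 i
  rw [affRoot, Datum.pt, D.act1_apply, h, add_zero, hj.2]
  rw [pos_basePoint_iff] at h0
  change 0 < affRoot R j k (basePoint b)
  rw [pos_basePoint_iff]
  have hk := (h0.resolve_left fun h' => hi h'.1).2
  by_cases hp : b.IsPos j
  · exact Or.inl ⟨hp, by lia⟩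
  · exact Or.inr ⟨hp, hk⟩

end Walk

section Duality

variable {ι M N : Type*} [AddCommGroup M] [Module ℝ M] [AddCommGroup N] [Module ℝ N]
  [Finite ι] {R : RootPairing ι ℝ M N} [R.IsCrystallographic] [R.IsReduced] {b : R.Base}
  {W1 : Type*} [Group W1] {D : Datum b W1} {C : Type*} [CommRing C] {J : Set b.support}

/-! ### Isomorphisms of right modules -/

namespace RightMod

variable {A B A' B' V V' V'' : Type*} [Ring A] [Algebra C A] [Ring B] [Algebra C B]
  [Ring A'] [Algebra C A'] [Ring B'] [Algebra C B']
  [AddCommMonoid V] [Module C V] [AddCommMonoid V'] [Module C V'] [AddCommMonoid V''] [Module C V'']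

theorem Iso.symm {π : RightMod C A V} {π' : RightMod C A V'} (h : π.Iso π') : π'.Iso π := by
  obtain ⟨e, he⟩ := h
  refine ⟨e.symm, fun x v => ?_⟩
  rw [LinearEquiv.symm_apply_eq, he, e.apply_symm_apply]

theorem Iso.trans {π : RightMod C A V} {π' : RightMod C A V'} {π'' : RightMod C A V''}
    (h : π.Iso π') (h' : π'.Iso π'') : π.Iso π'' := by
  obtain ⟨e, he⟩ := h
  obtain ⟨e', he'⟩ := h'
  exact ⟨e.trans e', fun x v => by rw [LinearEquiv.trans_apply, he, he', LinearEquiv.trans_apply]⟩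

theorem Iso.dual {π : RightMod C A V} {π' : RightMod C A V'} (ζ : A →ₐ[C] Aᵐᵒᵖ) (h : π.Iso π') :
    (RightMod.dual ζ π').Iso (RightMod.dual ζ π) := by
  obtain ⟨e, he⟩ := h
  refine ⟨e.dualMap, fun x f => LinearMap.ext fun v => ?_⟩
  change f (π' (ζ x) (e v)) = f (e (π (ζ x) v))
  have := he (ζ x).unop v
  rw [op_unop] at this
  rw [this]

theorem Iso.of_pullback {κ : A' →ₐ[C] A} (hκ : Function.Surjective κ) {π : RightMod C A V}
    {π' : RightMod C A V'} (h : (RightMod.pullback κ π).Iso (RightMod.pullback κ π')) :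
    π.Iso π' := by
  obtain ⟨e, he⟩ := h
  refine ⟨e, fun x v => ?_⟩
  obtain ⟨y, rfl⟩ := hκ x
  exact he y v

theorem dual_pullback {κ : A' →ₐ[C] A} {ζ : A →ₐ[C] Aᵐᵒᵖ} {ζ' : A' →ₐ[C] A'ᵐᵒᵖ}
    (h : ∀ x, ζ (κ x) = op (κ (ζ' x).unop)) (π : RightMod C A V) :
    RightMod.dual ζ' (RightMod.pullback κ π) = RightMod.pullback κ (RightMod.dual ζ π) := by
  refine AlgHom.ext fun x => LinearMap.ext fun f => LinearMap.ext fun v => ?_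
  change f (π (op (κ (ζ' x.unop).unop)) v) = f (π (ζ (κ x.unop)) v)
  rw [h]

theorem coindMod_pullback_iso {I : Type*} (κ : A' ≃ₐ[C] A) (κ' : B' →ₐ[C] B) {f : I → B} {g : I → A}
    {f' : I → B'} {g' : I → A'} (hf : ∀ i, κ' (f' i) = f i) (hg : ∀ i, κ (g' i) = g i)
    (σ : RightMod C B V) :
    (RightMod.pullback (κ : A' →ₐ[C] A) (coindMod f g σ)).Iso
      (coindMod f' g' (RightMod.pullback κ' σ)) := by
  have h1 : ∀ φ ∈ coind f g σ,
      φ ∘ₗ (κ : A' →ₐ[C] A).toLinearMap ∈ coind f' g' (RightMod.pullback κ' σ) := by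
    intro φ hφ X i
    change φ (κ (X * g' i)) = σ (op (κ' (f' i))) (φ (κ X))
    rw [map_mul, hg, hf]
    exact hφ _ _
  have h2 : ∀ φ ∈ coind f' g' (RightMod.pullback κ' σ),
      φ ∘ₗ (κ.symm : A →ₐ[C] A').toLinearMap ∈ coind f g σ := by
    intro φ hφ X i
    have h3 : κ.symm (g i) = g' i := by rw [← hg, κ.symm_apply_apply]
    have h4 := hφ (κ.symm X) i
    change φ (κ.symm (X * g i)) = σ (op (f i)) (φ (κ.symm X))
    rw [map_mul, h3, h4, ← hf]
    rfl
  refine ⟨⟨⟨⟨fun φ => ⟨_, h1 φ φ.2⟩, fun _ _ => rfl⟩, fun _ _ => rfl⟩, fun φ => ⟨_, h2 φ φ.2⟩,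
    fun φ => ?_, fun φ => ?_⟩, fun X φ => ?_⟩
  · refine Subtype.ext (LinearMap.ext fun X => ?_)
    change (φ : A →ₗ[C] V) (κ (κ.symm X)) = _
    rw [κ.apply_symm_apply]
  · refine Subtype.ext (LinearMap.ext fun X => ?_)
    change (φ : A' →ₗ[C] V) (κ.symm (κ X)) = _
    rw [κ.symm_apply_apply]
  · refine Subtype.ext (LinearMap.ext fun Y => ?_)
    change (φ : A →ₗ[C] V) (κ X * κ Y) = (φ : A →ₗ[C] V) (κ (X * Y))
    rw [map_mul κ]

end RightMod

/-! ### The coset of `n_{w_G w_P}` -/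

theorem wGP_conj_mem_opp {g : N ≃ₗ[ℝ] N} (hg : g ∈ finWeyl b J) :
    wGP b J * g * (wGP b J)⁻¹ ∈ finWeyl b (opp b J) := by
  induction hg using Subgroup.closure_induction with
  | mem g hg =>
    obtain ⟨j, hj, rfl⟩ := hg
    obtain ⟨i, hi⟩ := (exists_mapsRoot b (wGP_mem b J)).1 j
    rw [conj_reflection hi]
    exact coreflection_mem_of_mem_levRoots
      ((wGP_mem_levRoots b hi).1 (mem_levRoots_of_mem b hj))
  | one => simp
  | mul x y _ _ hx hy =>
    have := mul_mem hx hy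
    convert this using 1; group
  | inv x _ hx =>
    have := inv_mem hx
    convert this using 1; group

theorem Datum.nGP_conj_mem {x : W1} (hx : x ∈ D.lev J) :
    D.nGP J * x * (D.nGP J)⁻¹ ∈ D.lev (opp b J) := by
  have hn : D.proj (D.nGP J) = wGP b J := D.proj_n _
  change D.proj _ ∈ finWeyl b (opp b J)
  rw [map_mul, map_mul, map_inv, hn]
  exact wGP_conj_mem_opp hx

theorem Datum.IsMin.mul_nGP_inv {d : W1} (hd : D.IsMin J d) :
    D.IsMin (opp b J) (d * (D.nGP J)⁻¹) := by
  intro f hf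
  have h1 : f ∘ D.act1 (D.nGP J) ∈ affRoots b J := (Datum.comp_nGP_mem_iff (affRoots_univ hf)).2 hf
  have h2 := D.isMin_nGP J _ h1
  rw [Function.comp_apply (x := D.pt _), pt, D.act1_act1_inv] at h2
  rw [← h2, hd _ h1, mul_inv_rev, inv_inv, D.pt_mul]
  rfl

theorem Datum.act1_inv_zero {d : W1} (h : D.act1 d 0 = 0) : D.act1 d⁻¹ 0 = 0 := by
  have := D.act1_inv_act1 d 0
  rwa [h] at this

namespace Param

variable {p : Param D C} {X : Type*} [AddCommGroup X] [Module C X]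

/-! ### The two dualities -/

/-- The analogue of `coind_ext` for the embedding `T_w^{P*} ↦ T_w^*`, to which the
Iwahori–Matsumoto isomorphism reduces it. -/
theorem coind_star_ext {σ : RightMod C (p.Hecke J) X} {φ : p.Hecke Set.univ →ₗ[C] X}
    (hφ : φ ∈ coind (fun w : D.negSet J => p.Tstar J w)
      (fun w : D.negSet J => p.Tstar Set.univ (D.incl J w)) σ) {S : Set W1}
    (hS : ∀ d ∈ S, D.IsMin J d ∧ D.act1 d 0 = 0) (hS' : ∀ w, ∃ d ∈ S, d⁻¹ * w ∈ D.lev J)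
    (h0 : ∀ d ∈ S, φ (p.Tstar Set.univ (D.up d)) = 0) : φ = 0 := by
  have h := p.isNeg_negParam
  have h1 : φ ∘ₗ (kappa Set.univ h).toLinearMap = 0 := by
    refine coind_ext (p := p.negParam) (σ := RightMod.pullback (kappa J h) σ) ?_ hS hS'
      fun d hd => ?_
    · intro Y w
      change φ (kappa _ h (Y * p.negParam.T Set.univ (D.incl J w))) =
        σ (op (kappa J h (p.negParam.T J w))) (φ (kappa _ h Y))
      rw [map_mul, kappa_T, kappa_T]
      exact hφ _ _
    · change φ (kappa _ h _) = 0
      rw [kappa_T, h0 d hd]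
  refine LinearMap.ext fun Y => ?_
  have h2 := LinearMap.congr_fun h1 (kappa Set.univ h.symm Y)
  rwa [LinearMap.comp_apply, AlgHom.toLinearMap_apply, kappa_kappa h.symm] at h2

theorem walk_add (σ : RightMod C (p.Hecke J) X) (x y : X) (z : W1) :
    walk σ (x + y) z = walk σ x z + walk σ y z := by
  refine lhom_ext_up fun w => ?_
  rw [LinearMap.add_apply, walk, walk, walk, equivExt_vb, equivExt_vb, equivExt_vb, ← map_add]
  split_ifs
  · rw [map_add]
  · rw [add_zero]

theorem walk_smul (σ : RightMod C (p.Hecke J) X) (a : C) (x : X) (z : W1) :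
    walk σ (a • x) z = a • walk σ x z := by
  refine lhom_ext_up fun w => ?_
  rw [LinearMap.smul_apply, walk, walk, equivExt_vb, equivExt_vb, ← map_smul]
  split_ifs
  · rw [map_smul]
  · rw [smul_zero]

/-- The element of the induced module given by the equivariant map concentrated on `n W_J(1)` with
value `x` at `n`. -/
def phi (σ : RightMod C (p.Hecke J) X) :
    X →ₗ[C] coind (fun w : D.negSet J => p.T J w)
      (fun w : D.negSet J => p.T Set.univ (D.incl J w)) σ where
  toFun x := toInd (isEquivariant_walk σ x (D.nGP J)⁻¹)
  map_add' x y := Subtype.ext (LinearMap.ext fun h => by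
    change walk σ (x + y) _ _ = _
    rw [walk_add]
    rfl)
  map_smul' a x := Subtype.ext (LinearMap.ext fun h => by
    change walk σ (a • x) _ _ = _
    rw [walk_smul]
    rfl)

/-- The action of `T_w^*` on `φ_x` is the walk from `n⁻¹` to `n⁻¹ w`. -/
theorem phi_act_Tstar (σ : RightMod C (p.Hecke J) X) (x : X) {w : W1}
    (hw : D.NoCross (opp b J) w) :
    p.ind' J σ (op (p.Tstar Set.univ (D.up w))) (phi σ x) =
      toInd (isEquivariant_walk σ x ((D.nGP J)⁻¹ * w)) := by
  refine Subtype.ext (LinearMap.ext fun h => ?_)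
  rw [toInd_apply, ← walk_nGP_comp_star σ x hw]
  change walk σ x _ (p.star J (p.Tstar Set.univ (D.up w) * h) _) = _
  rw [map_mul]
  rfl

theorem phi_act_of_isNeg (σ : RightMod C (p.Hecke J) X) (x : X) {y : D.lev (opp b J)}
    (hy : D.IsNeg (opp b J) (y : W1)⁻¹) :
    p.ind' J σ (op (p.Tstar Set.univ (D.up y))) (phi σ x) =
      phi σ (σ (op (p.Tstar J (D.conj J y))) x) := by
  rw [phi_act_Tstar σ x (Datum.noCross_of_isNeg_inv hy)]
  have h1 : (D.nGP J)⁻¹ * y * D.nGP J ∈ D.lev J := D.conj_mem J y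
  have h2 : (D.nGP J)⁻¹ * D.nGP J ∈ D.lev J := by rw [inv_mul_cancel]; exact one_mem _
  have key : walk σ x ((D.nGP J)⁻¹ * y) =
      walk σ (σ (op (p.Tstar J (D.conj J y))) x) (D.nGP J)⁻¹ := by
    refine eq_walk (isEquivariant_walk σ x _) (D.isMin_nGP J) h2 ?_ fun w hw => ?_
    · have h3 : (⟨(D.nGP J)⁻¹ * D.nGP J, h2⟩ : D.lev J) = 1 :=
        Subtype.ext (inv_mul_cancel _)
      rw [walk_vb_of_mem σ x (D.isMin_nGP J) h1, h3, Tstar_one, op_one, map_one]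
      rfl
    · refine walk_vb_of_notMem σ x fun h => hw ?_
      have h3 := mul_mem (inv_mem h1) h
      rwa [show ((D.nGP J)⁻¹ * y * D.nGP J)⁻¹ * ((D.nGP J)⁻¹ * y * w) = (D.nGP J)⁻¹ * w by
        group] at h3
  refine Subtype.ext (LinearMap.ext fun h => ?_)
  rw [toInd_apply, key]
  rfl

theorem phi_act_of_fix (σ : RightMod C (p.Hecke J) X) (x : X) {d : W1} (hd : D.act1 d 0 = 0) :
    p.ind' J σ (op (p.Tstar Set.univ (D.up (D.nGP J * d⁻¹)))) (phi σ x) =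
      toInd (isEquivariant_walk σ x d⁻¹) := by
  rw [phi_act_Tstar σ x (Datum.noCross_of_fix (by
    rw [D.act1_mul_apply, Datum.act1_inv_zero hd, D.act1_nGP_zero]))]
  refine Subtype.ext (LinearMap.ext fun h => ?_)
  rw [toInd_apply, toInd_apply, inv_mul_cancel_left]

theorem toInd_walk_drep (σ : RightMod C (p.Hecke J) X) (x : X) [DecidableEq (W1 ⧸ D.lev J)]
    (q q' : W1 ⧸ D.lev J) :
    (toInd (isEquivariant_walk σ x (D.drep q)⁻¹) : p.Hecke Set.univ →ₗ[C] X)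
      (p.T Set.univ (D.up (D.drep q'))) = if q = q' then x else 0 := by
  rw [toInd_T _ (D.drep_spec q').1 (D.drep_spec q').2.1]
  split_ifs with h
  · subst h
    have h1 : (D.drep q)⁻¹ * D.drep q ∈ D.lev J := by rw [inv_mul_cancel]; exact one_mem _
    have h3 : (⟨(D.drep q)⁻¹ * D.drep q, h1⟩ : D.lev J) = 1 := Subtype.ext (inv_mul_cancel _)
    rw [walk_vb_of_mem σ x (D.drep_spec q).1 h1, h3, Tstar_one, op_one, map_one]
    rfl
  · refine walk_vb_of_notMem σ x fun h1 => h ?_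
    rw [← QuotientGroup.eq, (D.drep_spec q).2.2, (D.drep_spec q').2.2] at h1
    exact h1

theorem zeta_Tstar_drep (q : W1 ⧸ D.lev J) :
    p.zeta Set.univ (p.Tstar Set.univ (D.up (D.drep q * (D.nGP J)⁻¹))) =
      op (p.Tstar Set.univ (D.up (D.nGP J * (D.drep q)⁻¹))) := by
  rw [zeta_Tstar, ← map_inv, mul_inv_rev, inv_inv]

/-- The values `φ(T_d)` determine `φ` in the induced module, by an explicit formula. -/
theorem eq_sum_phi [Fintype (W1 ⧸ D.lev J)] (σ : RightMod C (p.Hecke J) X)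
    (φ : coind (fun w : D.negSet J => p.T J w)
      (fun w : D.negSet J => p.T Set.univ (D.incl J w)) σ) :
    φ = ∑ q : W1 ⧸ D.lev J,
      p.ind' J σ (p.zeta Set.univ (p.Tstar Set.univ (D.up (D.drep q * (D.nGP J)⁻¹))))
        (phi σ ((φ : p.Hecke Set.univ →ₗ[C] X) (p.T Set.univ (D.up (D.drep q))))) := by
  classical
  rw [← sub_eq_zero]
  refine Subtype.ext (coind_ext (Subtype.property _) (S := Set.range (D.drep (J := J))) ?_ ?_ ?_)
  · rintro _ ⟨q, rfl⟩
    exact ⟨(D.drep_spec q).1, (D.drep_spec q).2.1⟩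
  · exact fun w => ⟨_, ⟨_, rfl⟩, D.drep_inv_mul_mem w⟩
  · rintro _ ⟨q', rfl⟩
    rw [Submodule.coe_sub, Submodule.coe_sum, LinearMap.sub_apply, LinearMap.sum_apply,
      sub_eq_zero]
    have h : ∀ q : W1 ⧸ D.lev J, ∀ x : X,
        ((p.ind' J σ (p.zeta Set.univ (p.Tstar Set.univ (D.up (D.drep q * (D.nGP J)⁻¹))))
          (phi σ x) : coind _ _ σ) : p.Hecke Set.univ →ₗ[C] X)
          (p.T Set.univ (D.up (D.drep q'))) = if q = q' then x else 0 := fun q x => by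
      rw [zeta_Tstar_drep, phi_act_of_fix σ x (D.drep_spec q).2.1, toInd_walk_drep]
    simp only [h]
    rw [Finset.sum_ite_eq' Finset.univ q']
    simp

/-- The linear map `f ↦ ψ_f`, `ψ_f(Y)(x) = f(φ_x ζ(Y))`, from the dual of `I'_P(σ)` to
`I_{P'}(n σ^*)`. -/
def dualMap (σ : RightMod C (p.Hecke J) X) :
    Dual C (coind (fun w : D.negSet J => p.T J w)
      (fun w : D.negSet J => p.T Set.univ (D.incl J w)) σ) →ₗ[C]
    coind (fun w : D.negSet (opp b J) => p.Tstar (opp b J) w)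
      (fun w : D.negSet (opp b J) => p.Tstar Set.univ (D.incl (opp b J) w))
      (p.twist J (p.dual J σ)) where
  toFun f := ⟨{
      toFun := fun Y => f ∘ₗ p.ind' J σ (p.zeta Set.univ Y) ∘ₗ phi σ
      map_add' := fun Y Z => by rw [map_add, map_add, LinearMap.add_comp, LinearMap.comp_add]
      map_smul' := fun a Y => by
        rw [map_smul, map_smul, LinearMap.smul_comp, LinearMap.comp_smul, RingHom.id_apply] },
    fun Y w => LinearMap.ext fun x => by
      have hw : D.IsNeg (opp b J) (((w : D.lev (opp b J))⁻¹ : D.lev (opp b J)) : W1)⁻¹ := by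
        rw [InvMemClass.coe_inv, inv_inv]; exact w.2
      have hc : (D.conj J w)⁻¹ = D.conj J (w : D.lev (opp b J))⁻¹ := by
        ext; simp [Datum.conj, mul_assoc]
      change f (p.ind' J σ (p.zeta Set.univ (Y * p.Tstar Set.univ (D.up (w : D.lev (opp b J)))))
          (phi σ x)) =
        f (p.ind' J σ (p.zeta Set.univ Y) (phi σ
          (σ (p.zeta J (p.conjHom J (p.Tstar (opp b J) w))) x)))
      rw [conjHom_Tstar, zeta_Tstar, hc, ← phi_act_of_isNeg σ x hw, map_mul, map_mul,
        Module.End.mul_apply, zeta_Tstar]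
      rfl⟩
  map_add' f g := rfl
  map_smul' a f := rfl

theorem dualMap_apply (σ : RightMod C (p.Hecke J) X)
    (f : Dual C (coind (fun w : D.negSet J => p.T J w)
      (fun w : D.negSet J => p.T Set.univ (D.incl J w)) σ)) (Y : p.Hecke Set.univ) (x : X) :
    (dualMap σ f : p.Hecke Set.univ →ₗ[C] Dual C X) Y x =
      f (p.ind' J σ (p.zeta Set.univ Y) (phi σ x)) := rfl

theorem dualMap_injective (σ : RightMod C (p.Hecke J) X) : Function.Injective (dualMap σ) := by
  have := D.finite_quotient J
  let _ := Fintype.ofFinite (W1 ⧸ D.lev J)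
  refine (injective_iff_map_eq_zero _).2 fun f hf => LinearMap.ext fun φ => ?_
  rw [eq_sum_phi σ φ, map_sum]
  refine Finset.sum_eq_zero fun q _ => ?_
  rw [← dualMap_apply, hf]
  rfl

/-- A preimage of `ψ` is `f(φ) = ∑_d ψ(T_{d n⁻¹}^*)(φ(T_d))`, the sum over minimal representatives
`d`. -/
theorem dualMap_surjective (σ : RightMod C (p.Hecke J) X) : Function.Surjective (dualMap σ) := by
  classical
  have := D.finite_quotient J
  let _ := Fintype.ofFinite (W1 ⧸ D.lev J)
  intro ψ
  let f : Dual C (coind (fun w : D.negSet J => p.T J w)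
      (fun w : D.negSet J => p.T Set.univ (D.incl J w)) σ) :=
    ∑ q : W1 ⧸ D.lev J, (ψ : p.Hecke Set.univ →ₗ[C] Dual C X)
      (p.Tstar Set.univ (D.up (D.drep q * (D.nGP J)⁻¹))) ∘ₗ
        LinearMap.applyₗ (p.T Set.univ (D.up (D.drep q))) ∘ₗ Submodule.subtype _
  refine ⟨f, ?_⟩
  refine Subtype.ext (sub_eq_zero.1 (coind_star_ext (J := opp b J)
    (σ := p.twist J (p.dual J σ))
    (φ := (dualMap σ f : p.Hecke Set.univ →ₗ[C] Dual C X) -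
      (ψ : p.Hecke Set.univ →ₗ[C] Dual C X))
    (fun Y w => by
      rw [LinearMap.sub_apply, LinearMap.sub_apply, (dualMap σ f).2 Y w, ψ.2 Y w, map_sub])
    (S := Set.range fun q : W1 ⧸ D.lev J => D.drep q * (D.nGP J)⁻¹) ?_ ?_ ?_))
  · rintro _ ⟨q, rfl⟩
    refine ⟨(D.drep_spec q).1.mul_nGP_inv, ?_⟩
    rw [D.act1_mul_apply, Datum.act1_inv_zero (D.act1_nGP_zero J), (D.drep_spec q).2.1]
  · intro w
    refine ⟨_, ⟨((w * D.nGP J : W1) : W1 ⧸ D.lev J), rfl⟩, ?_⟩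
    have := Datum.nGP_conj_mem (D.drep_inv_mul_mem (J := J) (w * D.nGP J))
    convert this using 1
    group
  · rintro _ ⟨q', rfl⟩
    rw [LinearMap.sub_apply, sub_eq_zero]
    refine LinearMap.ext fun x => ?_
    rw [dualMap_apply, zeta_Tstar_drep, phi_act_of_fix σ x (D.drep_spec q').2.1,
      LinearMap.sum_apply]
    have h : ∀ q : W1 ⧸ D.lev J,
        ((ψ : p.Hecke Set.univ →ₗ[C] Dual C X)
          (p.Tstar Set.univ (D.up (D.drep q * (D.nGP J)⁻¹))) ∘ₗ
          LinearMap.applyₗ (p.T Set.univ (D.up (D.drep q))) ∘ₗ Submodule.subtype _)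
          (toInd (isEquivariant_walk σ x (D.drep q')⁻¹)) = if q' = q then
            (ψ : p.Hecke Set.univ →ₗ[C] Dual C X)
              (p.Tstar Set.univ (D.up (D.drep q * (D.nGP J)⁻¹))) x else 0 := fun q => by
      rw [LinearMap.comp_apply, LinearMap.comp_apply, LinearMap.applyₗ_apply_apply,
        Submodule.subtype_apply, toInd_walk_drep]
      split_ifs
      · rfl
      · rw [map_zero]
    simp only [h]
    rw [Finset.sum_ite_eq Finset.univ q']
    simp

/-- `I'_P(σ)^* ≅ I_{P'}(n σ^*)`. -/
theorem dual_ind'_iso (p : Param D C) (J : Set b.support) (σ : RightMod C (p.Hecke J) X) :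
    (p.dual Set.univ (p.ind' J σ)).Iso (p.ind (opp b J) (p.twist J (p.dual J σ))) := by
  refine ⟨LinearEquiv.ofBijective (dualMap σ) ⟨dualMap_injective σ, dualMap_surjective σ⟩,
    fun Y f => Subtype.ext (LinearMap.ext fun Z => LinearMap.ext fun x => ?_)⟩
  change f (p.ind' J σ (p.zeta Set.univ Y) (p.ind' J σ (p.zeta Set.univ Z) (phi σ x))) =
    f (p.ind' J σ (p.zeta Set.univ (Y * Z)) (phi σ x))
  rw [map_mul, map_mul, Module.End.mul_apply]

/-- `I_P(σ)^* ≅ I'_{P'}(n σ^*)`: this is `dual_ind'_iso` for the parameters `(q, -c)`, read through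
the Iwahori–Matsumoto isomorphism. -/
theorem dual_ind_iso (p : Param D C) (J : Set b.support) (σ : RightMod C (p.Hecke J) X) :
    (p.dual Set.univ (p.ind J σ)).Iso (p.ind' (opp b J) (p.twist J (p.dual J σ))) := by
  have h := p.isNeg_negParam
  have h1 := dual_ind'_iso p.negParam J (RightMod.pullback (kappa J h) σ)
  have h2 : (RightMod.pullback (kappa Set.univ h) (p.ind J σ)).Iso
      (p.negParam.ind' J (RightMod.pullback (kappa J h) σ)) :=
    RightMod.coindMod_pullback_iso (kappaEquiv Set.univ h) (kappa J h)
      (fun w => kappa_T h _) (fun w => kappa_T h _) σ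
  have h3 : (RightMod.pullback (kappa Set.univ h)
        (p.ind' (opp b J) (p.twist J (p.dual J σ)))).Iso
      (p.negParam.ind (opp b J)
        (RightMod.pullback (kappa (opp b J) h) (p.twist J (p.dual J σ)))) :=
    RightMod.coindMod_pullback_iso (kappaEquiv Set.univ h) (kappa (opp b J) h)
      (fun w => kappa_Tstar h _) (fun w => kappa_Tstar h _) _
  have h4 : p.negParam.twist J (p.negParam.dual J (RightMod.pullback (kappa J h) σ)) =
      RightMod.pullback (kappa (opp b J) h) (p.twist J (p.dual J σ)) := by
    rw [Param.dual, RightMod.dual_pullback (zeta_kappa h)]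
    refine AlgHom.ext fun x => ?_
    change p.dual J σ (op (kappa J h (p.negParam.conjHom J x.unop))) =
      p.dual J σ (op (p.conjHom J (kappa _ h x.unop)))
    rw [conjHom_kappa]
  have h5 := h2.dual (p.negParam.zeta Set.univ)
  rw [RightMod.dual_pullback (zeta_kappa h)] at h5
  rw [h4] at h1
  exact RightMod.Iso.of_pullback (kappaEquiv Set.univ h).surjective
    ((h5.symm.trans h1).trans h3.symm)

end Param

end Duality

end ProPIwahori

theorem mainTheorem7 {ι M N : Type*} [Finite ι] [AddCommGroup M] [Module ℝ M] [AddCommGroup N]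
    [Module ℝ N] {R : RootPairing ι ℝ M N} [R.IsCrystallographic] [R.IsReduced] {b : R.Base}
    {W1 : Type*} [Group W1] (D : ProPIwahori.Datum b W1)
    {C : Type*} [CommRing C] (p : ProPIwahori.Param D C) (J : Set b.support)
    {V : Type*} [AddCommGroup V] [Module C V] (σ : ProPIwahori.RightMod C (p.Hecke J) V) :
    (p.dual Set.univ (p.ind J σ)).Iso
        (p.ind' (ProPIwahori.opp b J) (p.twist J (p.dual J σ))) ∧
      (p.dual Set.univ (p.ind' J σ)).Iso
        (p.ind (ProPIwahori.opp b J) (p.twist J (p.dual J σ))) :=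
  ⟨ProPIwahori.Param.dual_ind_iso p J σ, ProPIwahori.Param.dual_ind'_iso p J σ⟩
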